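/- Let $k$ be a field of characteristic zero. A Poisson algebra over $k$ is a commutative $k$-algebra with a $k$-bilinear Lie bracket $\{-,-\}$ that is a derivation in each variable; a Poisson prime is a prime ideal $P$ with $\{A,P\}\subseteq P$. For a Poisson prime $P$ the bracket of $A$ induces one on $A/P$, which extends uniquely to the field of fractions $\operatorname{Fract} A/P$. For a field $K\supseteq k$ and an antisymmetric matrix $\mu\in M_m(k)$, let $K_\mu(y_1,\dots,y_m)$ denote the rational function field over $K$ with the $K$-bilinear Poisson bracket satisfying $\{y_i,y_j\}=\mu_{ij}y_iy_j$ (similarly for other finite index sets); it is regarded as a Poisson algebra over $k$. Let $n\ge 0$ and let $A$ be one of the following Poisson algebras (semiclassical limits of quantum algebras), each a polynomial algebra over $k$ with the Poisson bracket given on the indeterminates. (i) (Quantum affine spaces) $A=k[x_1,\dots,x_n]$, $\{x_i,x_j\}=q_{ij}x_ix_j$, with $(q_{ij})\in M_n(k)$ antisymmetric. (ii) (Quantum matrices) $A=k[X_{ij}\mid 1\le i,j\le n]$, with $\lambda\in k$, $(p_{ij})\in M_n(k)$ antisymmetric, and $$\{X_{lm},X_{ij}\}=\begin{cases}(p_{li}+p_{jm})X_{ij}X_{lm}+\lambda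 X_{im}X_{lj}&(l>i,\ m>j)\\(\lambda+p_{li}+p_{jm})X_{ij}X_{lm}&(l>i,\ m\le j)\\p_{jm}X_{ij}X_{lm}&(l=i,\ m>j).\end{cases}$$ (iii) (Quantum symplectic and even-dimensional euclidean spaces) $A=k[x_1,y_1,\dots,x_n,y_n]$, with $(\gamma_{ij})\in M_n(k)$ antisymmetric, $p,q\in k^n$ with $p_i\ne q_i$ for all $i$, and $$\begin{aligned}\{y_i,y_j\}&=\gamma_{ij}y_iy_j,\qquad \{x_i,x_j\}=(q_i-p_j+\gamma_{ij})x_ix_j\ (i<j),\\ \{x_i,y_j\}&=(p_j+\gamma_{ji})x_iy_j\ (i<j),\qquad \{x_i,y_j\}=(q_j+\gamma_{ji})x_iy_j\ (i>j),\\ \{x_i,y_i\}&=q_ix_iy_i+\textstyle\sum_{\ell<i}(q_\ell-p_\ell)x_\ell y_\ell.\end{aligned}$$ (iv) (Odd-dimensional quantum euclidean spaces) $A=k[z_0,x_1,y_1,\dots,x_n,y_n]$, with $\gamma,p,q$ as in (iii), $\lambda\in k$, the brackets of (iii) except that $\{x_i,y_i\}=q_ix_iy_i+\sum_{\ell<i}(q_\ell-p_\ell)x_\ell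 y_\ell+\lambda z_0^2$, and $\{z_0,x_i\}=-(p_i/2)z_0x_i$, $\{z_0,y_i\}=(p_i/2)z_0y_i$. (v) (Quantum symmetric matrices) $A=k[y_{ij}\mid 1\le i\le j\le n]$, with $y_{ji}:=y_{ij}$ and $$\{y_{ij},y_{lm}\}=(\operatorname{sign}(l-j)+\operatorname{sign}(m-i))y_{il}y_{jm}+(\operatorname{sign}(l-i)+\operatorname{sign}(m-j))y_{im}y_{jl}.$$ (vi) (Quantum antisymmetric matrices) $A=k[y_{ij}\mid 1\le i<j\le n]$, with $y_{ji}:=-y_{ij}$, $y_{ii}:=0$ and $$\{y_{ij},y_{lm}\}=(\operatorname{sign}(l-j)+\operatorname{sign}(m-i))y_{il}y_{jm}-(\operatorname{sign}(l-i)+\operatorname{sign}(m-j))y_{im}y_{jl}.$$ Then: (1) For every Poisson prime ideal $P$ of $A$ there are a field extension $K\supseteq k$, an integer $m\ge0$ and an antisymmetric matrix $\mu\in M_m(k)$ such that $\operatorname{Fract} A/P\cong K_\mu(y_1,\dots,y_m)$ as Poisson algebras over $k$. (2) For $P=0$ this holds with $K=k$ and $m=\operatorname{tr.deg}_kA$.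 (3) Explicitly, $\operatorname{Fract}A\cong k_\Lambda(Y_s)$ with one variable $Y_s$ for each indeterminate of $A$ and the following brackets. - (i): $\{Y_i,Y_j\}=q_{ij}Y_iY_j$. - (ii): $\{Y_{lm},Y_{ij}\}=(p_{li}+p_{jm})Y_{ij}Y_{lm}$ if $l\ge i$, $m>j$, and $=(\lambda+p_{li}+p_{jm})Y_{ij}Y_{lm}$ if $l>i$, $m\le j$. - (iii): with variables $v_i,w_i$: $\{w_i,w_j\}=\gamma_{ij}w_iw_j$; $\{v_i,w_j\}=(p_j+\gamma_{ji})v_iw_j$ for $i<j$ and $(q_j+\gamma_{ji})v_iw_j$ for $i\ge j$; $\{v_i,v_j\}=(q_i-p_j+\gamma_{ij})v_iv_j$ for $i<j$. - (iv): with variables $u_0,v_i,w_i$: the brackets of (iii), and $\{u_0,v_i\}=-(p_i/2)u_0v_i$, $\{u_0,w_i\}=(p_i/2)u_0w_i$. - (v): for $(i,j)<_{\rm lex}(l,m)$, $\{z_{ij},z_{lm}\}=c\,z_{ij}z_{lm}$, where $c=1$ if $i=l<j<m$ or $i<l<j=m$ or $i<j=l<m$; $c=2$ if $i=j=l<m$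 or $i<j=l=m$; and $c=0$ otherwise. - (vi): for $(i,j)<_{\rm lex}(l,m)$, $\{z_{ij},z_{lm}\}=z_{ij}z_{lm}$ if $|\{i,j\}\cap\{l,m\}|=1$, and $=0$ otherwise. -/

import Mathlib

open MvPolynomial

universe u

/-- A Poisson bracket on a commutative `k`-algebra `A`: a `k`-bilinear Lie bracket
which is a derivation in each variable. -/
structure PoissonBracket (k A : Type*) [CommRing k] [CommRing A] [Algebra k A] where
  bracket : A →ₗ[k] A →ₗ[k] A
  alt : ∀ a, bracket a a = 0
  jacobi : ∀ a b c,
    bracket a (bracket b c) + bracket b (bracket c a) + bracket c (bracket a b) = 0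
  leibniz : ∀ a b c, bracket a (b * c) = bracket a b * c + b * bracket a c

namespace PoissonBracket

section General

variable {k R A : Type*} [CommRing k] [CommRing R] [CommRing A] [Algebra k A] [Algebra R A]

theorem skew (π : PoissonBracket k A) (a b : A) : π.bracket a b = -π.bracket b a := by
  have h := π.alt (a + b)
  simp only [map_add, LinearMap.add_apply, π.alt, zero_add, add_zero] at h
  exact eq_neg_of_add_eq_zero_right h

/-- An ideal `I` is a Poisson ideal if `{A, I} ⊆ I`. -/
def IsPoissonIdeal (π : PoissonBracket k A) (I : Ideal A) : Prop :=
  ∀ a, ∀ b ∈ I, π.bracket a b ∈ I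

/-- The Jacobi expression of a biderivation. -/
def jac (D : Derivation R A (Derivation R A A)) (a b c : A) : A :=
  D a (D b c) + D b (D c a) + D c (D a b)

theorem bider_skew (D : Derivation R A (Derivation R A A)) (alt : ∀ a, D a a = 0) (a b : A) :
    D a b = -D b a := by
  have h := alt (a + b)
  simp only [map_add, Derivation.add_apply, alt, zero_add, add_zero] at h
  exact eq_neg_of_add_eq_zero_right h

theorem jac_eq (D : Derivation R A (Derivation R A A)) (alt : ∀ a, D a a = 0) (a b c : A) :
    jac D a b c = (⁅D a, D b⁆ - D (D a b)) c := by
  rw [Derivation.sub_apply, Derivation.commutator_apply, jac, bider_skew D alt c a,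
    bider_skew D alt c (D a b), map_neg]
  ring

theorem jac_swap (D : Derivation R A (Derivation R A A)) (alt : ∀ a, D a a = 0) (a b c : A) :
    jac D b a c = -jac D a b c := by
  rw [jac, jac, bider_skew D alt b a, bider_skew D alt a c, bider_skew D alt c b]
  simp only [map_neg]
  ring

/-- If `S` is a set on which derivations of `A` are determined, then the Jacobi identity for a
biderivation holds as soon as it holds on `S`. -/
theorem jac_of_set (D : Derivation R A (Derivation R A A)) (alt : ∀ a, D a a = 0) (S : Set A)
    (hS : ∀ d : Derivation R A A, (∀ s ∈ S, d s = 0) → d = 0)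
    (h : ∀ a ∈ S, ∀ b ∈ S, ∀ c ∈ S, jac D a b c = 0) (a b c : A) : jac D a b c = 0 := by
  have cyc : ∀ a b c, jac D a b c = jac D b c a := fun a b c => by simp only [jac]; ring
  have ext : ∀ a b, (∀ c ∈ S, jac D a b c = 0) → ∀ c, jac D a b c = 0 := by
    intro a b hab c
    have := hS (⁅D a, D b⁆ - D (D a b)) fun s hs => by rw [← jac_eq D alt, hab s hs]
    rw [jac_eq D alt, this, Derivation.zero_apply]
  have h1 : ∀ a ∈ S, ∀ b ∈ S, ∀ c, jac D a b c = 0 := fun a ha b hb => ext a b (h a ha b hb)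
  have h2 : ∀ a ∈ S, ∀ b c, jac D a b c = 0 := fun a ha b => ext a b fun c hc => by
    rw [← cyc, h1 c hc a ha]
  exact ext a b (fun c hc => by rw [← cyc, h2 c hc]) c

/-- An alternating biderivation over `R` satisfying the Jacobi identity, as a Poisson bracket over
a subring `k` of scalars. -/
def ofBiderivation [Algebra k R] [IsScalarTower k R A] (D : Derivation R A (Derivation R A A))
    (alt : ∀ a, D a a = 0) (jacobi : ∀ a b c, jac D a b c = 0) : PoissonBracket k A where
  bracket := LinearMap.mk₂ k (fun a b => D a b)
    (fun a b c => by simp) (fun r a b => by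
      rw [← algebraMap_smul R r a, Derivation.map_smul, Derivation.smul_apply, algebraMap_smul])
    (fun a b c => by simp) (fun r a b => by
      rw [← algebraMap_smul R r b, Derivation.map_smul, algebraMap_smul])
  alt := alt
  jacobi := jacobi
  leibniz a b c := by simp [mul_comm, add_comm]

@[simp]
theorem ofBiderivation_bracket [Algebra k R] [IsScalarTower k R A]
    (D : Derivation R A (Derivation R A A))
    (alt : ∀ a, D a a = 0) (jacobi : ∀ a b c, jac D a b c = 0) (a b : A) :
    (ofBiderivation (k := k) D alt jacobi).bracket a b = D a b := rfl

/-- The biderivation underlying a Poisson bracket. -/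
def toBiderivation (π : PoissonBracket k A) : Derivation k A (Derivation k A A) :=
  Derivation.mk'
    { toFun := fun a => Derivation.mk' (π.bracket a) fun b c => by
        rw [π.leibniz, smul_eq_mul, smul_eq_mul]; ring
      map_add' := fun a b => by ext; simp
      map_smul' := fun r a => by ext; simp }
    fun a b => by
      ext c
      simp only [LinearMap.coe_mk, AddHom.coe_mk, Derivation.add_apply,
        Derivation.smul_apply, smul_eq_mul, Derivation.coe_mk']
      rw [π.skew, π.leibniz, π.skew a c, π.skew b c]
      ring

@[simp]
theorem toBiderivation_apply (π : PoissonBracket k A) (a b : A) :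
    π.toBiderivation a b = π.bracket a b := rfl

end General

section Quotient

variable {k A : Type*} [CommRing k] [CommRing A] [Algebra k A]

theorem quotient_wd (π : PoissonBracket k A) (I : Ideal A) (hI : π.IsPoissonIdeal I)
    (a b : A) : Ideal.Quotient.mk I (π.bracket
      (Function.surjInv Ideal.Quotient.mk_surjective (Ideal.Quotient.mk I a))
      (Function.surjInv Ideal.Quotient.mk_surjective (Ideal.Quotient.mk I b))) =
    Ideal.Quotient.mk I (π.bracket a b) := by
  set a' := Function.surjInv Ideal.Quotient.mk_surjective (Ideal.Quotient.mk I a) with ha'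
  set b' := Function.surjInv Ideal.Quotient.mk_surjective (Ideal.Quotient.mk I b) with hb'
  have ha : a' - a ∈ I := Ideal.Quotient.eq.mp (Function.surjInv_eq _ _)
  have hb : b' - b ∈ I := Ideal.Quotient.eq.mp (Function.surjInv_eq _ _)
  rw [Ideal.Quotient.eq]
  have h1 := hI a' _ hb
  have h2 := hI b _ ha
  rw [π.skew] at h2
  have h3 := I.sub_mem h1 h2
  simp only [map_sub, LinearMap.sub_apply, sub_neg_eq_add] at h3 ⊢
  convert h3 using 1
  ring

/-- The Poisson bracket induced on `A / I` by a Poisson ideal `I`. -/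
noncomputable def quotient (π : PoissonBracket k A) (I : Ideal A) (hI : π.IsPoissonIdeal I) :
    PoissonBracket k (A ⧸ I) :=
  let f : A ⧸ I → A ⧸ I → A ⧸ I := fun x y => Ideal.Quotient.mk I
    (π.bracket (Function.surjInv Ideal.Quotient.mk_surjective x)
      (Function.surjInv Ideal.Quotient.mk_surjective y))
  have hf : ∀ a b, f (Ideal.Quotient.mk I a) (Ideal.Quotient.mk I b) =
      Ideal.Quotient.mk I (π.bracket a b) := π.quotient_wd I hI
  have hs : Function.Surjective (Ideal.Quotient.mk I) := Ideal.Quotient.mk_surjective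
  { bracket := LinearMap.mk₂ k f
      (hs.forall₃.mpr fun a b c => by rw [← map_add, hf, hf, hf, ← map_add, map_add,
        LinearMap.add_apply])
      (fun r => hs.forall₂.mpr fun a b => by
        rw [← Ideal.Quotient.mkₐ_eq_mk k, ← map_smul, Ideal.Quotient.mkₐ_eq_mk, hf, hf, map_smul,
          LinearMap.smul_apply, ← Ideal.Quotient.mkₐ_eq_mk k, map_smul])
      (hs.forall₃.mpr fun a b c => by rw [← map_add, hf, hf, hf, ← map_add, map_add])
      (fun r => hs.forall₂.mpr fun a b => by
        rw [← Ideal.Quotient.mkₐ_eq_mk k, ← map_smul, Ideal.Quotient.mkₐ_eq_mk, hf, hf, map_smul,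
          ← Ideal.Quotient.mkₐ_eq_mk k, map_smul])
    alt := hs.forall.mpr fun a => by rw [LinearMap.mk₂_apply, hf, π.alt, map_zero]
    jacobi := hs.forall₃.mpr fun a b c => by
      simp only [LinearMap.mk₂_apply, hf, ← map_add, π.jacobi, map_zero]
    leibniz := hs.forall₃.mpr fun a b c => by
      simp only [LinearMap.mk₂_apply, hf, ← map_add, ← map_mul, π.leibniz] }

@[simp]
theorem quotient_mk (π : PoissonBracket k A) (I : Ideal A) (hI : π.IsPoissonIdeal I) (a b : A) :
    (π.quotient I hI).bracket (Ideal.Quotient.mk I a) (Ideal.Quotient.mk I b) =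
      Ideal.Quotient.mk I (π.bracket a b) :=
  π.quotient_wd I hI a b

end Quotient

section Fraction

variable {k A : Type*} [CommRing k] [CommRing A] [Algebra k A]

/-- The extension of a derivation `A → M` to the ring of fractions `F` of `A`, for an
`F`-module `M`. -/
noncomputable def extendDer (F : Type*) [CommRing F] [Algebra k F] [Algebra A F]
    [IsScalarTower k A F] [IsFractionRing A F] {M : Type*} [AddCommGroup M] [Module k M]
    [Module A M] [Module F M] [IsScalarTower A F M] [IsScalarTower k F M] [IsScalarTower k A M]
    (d : Derivation k A M) : Derivation k F M :=
  haveI := Algebra.FormallyEtale.of_isLocalization (Rₘ := F) (nonZeroDivisors A)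
  ((KaehlerDifferential.isBaseChange_of_formallyEtale k A F).lift
    d.liftKaehlerDifferential).compDer (KaehlerDifferential.D k F)

theorem extendDer_algebraMap (F : Type*) [CommRing F] [Algebra k F] [Algebra A F]
    [IsScalarTower k A F] [IsFractionRing A F] {M : Type*} [AddCommGroup M] [Module k M]
    [Module A M] [Module F M] [IsScalarTower A F M] [IsScalarTower k F M] [IsScalarTower k A M]
    (d : Derivation k A M) (a : A) : extendDer F d (algebraMap A F a) = d a := by
  have := Algebra.FormallyEtale.of_isLocalization (Rₘ := F) (nonZeroDivisors A)
  have h := (KaehlerDifferential.isBaseChange_of_formallyEtale k A F).lift_eq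
    d.liftKaehlerDifferential (KaehlerDifferential.D k A a)
  rw [KaehlerDifferential.map_D, Derivation.liftKaehlerDifferential_comp_D] at h
  exact h

/-- Derivations on a ring of fractions are determined on the base ring. -/
theorem der_ext_fraction {k A : Type*} [CommRing k] [CommRing A] (F : Type*) [CommRing F] [Algebra k F] [Algebra A F]
    [IsFractionRing A F] {M : Type*} [AddCommGroup M] [Module k M]
    [Module F M] (d : Derivation k F M)
    (h : ∀ a : A, d (algebraMap A F a) = 0) : d = 0 := by
  ext f
  obtain ⟨a, s, rfl⟩ := IsLocalization.exists_mk'_eq (nonZeroDivisors A) f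
  have hs : IsUnit (algebraMap A F s) := IsLocalization.map_units F s
  have := congrArg d (IsLocalization.mk'_spec F a s)
  rw [Derivation.leibniz, h, h, smul_zero, zero_add] at this
  exact (hs.smul_eq_zero).mp this

/-- For fixed `a`, the derivation `{a, -} : A → F`, as a derivation in `a`. -/
noncomputable def extendFst (π : PoissonBracket k A) (F : Type*) [CommRing F] [Algebra k F]
    [Algebra A F] [IsScalarTower k A F] [IsFractionRing A F] :
    Derivation k A (Derivation k F F) :=
  have key : ∀ (d e : Derivation k F F), (∀ a : A, d (algebraMap A F a) = e (algebraMap A F a)) →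
      d = e := fun d e h => sub_eq_zero.mp <| der_ext_fraction F (d - e) fun a => by
        rw [Derivation.sub_apply, h a, sub_self]
  Derivation.mk'
    { toFun := fun a => extendDer F
        ((Algebra.linearMap A F).compDer (π.toBiderivation a))
      map_add' := fun a b => key _ _ fun c => by simp [extendDer_algebraMap]
      map_smul' := fun r a => key _ _ fun c => by
        simp [extendDer_algebraMap] }
    fun a b => key _ _ fun c => by
      simp [extendDer_algebraMap, Algebra.smul_def]

theorem extendFst_algebraMap (π : PoissonBracket k A) (F : Type*) [CommRing F] [Algebra k F]
    [Algebra A F] [IsScalarTower k A F] [IsFractionRing A F] (a b : A) :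
    π.extendFst F a (algebraMap A F b) = algebraMap A F (π.bracket a b) := by
  change extendDer F ((Algebra.linearMap A F).compDer (π.toBiderivation a)) _ = _
  rw [extendDer_algebraMap]
  rfl

/-- The biderivation on `Fract A` extending a Poisson bracket on `A`. -/
noncomputable def fractionBider (π : PoissonBracket k A) :
    Derivation k (FractionRing A) (Derivation k (FractionRing A) (FractionRing A)) :=
  extendDer (FractionRing A) (π.extendFst (FractionRing A))

theorem fractionBider_algebraMap (π : PoissonBracket k A) (a b : A) :
    π.fractionBider (algebraMap A (FractionRing A) a) (algebraMap A (FractionRing A) b) =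
      algebraMap A (FractionRing A) (π.bracket a b) := by
  rw [fractionBider, extendDer_algebraMap, extendFst_algebraMap]

theorem fractionBider_alt (π : PoissonBracket k A) (f : FractionRing A) :
    π.fractionBider f f = 0 := by
  have h1 : ∀ (f : FractionRing A) (b : A), π.fractionBider f (algebraMap A _ b) =
      -π.fractionBider (algebraMap A _ b) f := by
    intro f b
    obtain ⟨a, s, rfl⟩ := IsLocalization.exists_mk'_eq (nonZeroDivisors A) f
    have hs : IsUnit (algebraMap A (FractionRing A) s) := IsLocalization.map_units _ s
    have e := IsLocalization.mk'_spec (FractionRing A) a s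
    set f := IsLocalization.mk' (FractionRing A) a s
    have e1 := congrArg (fun x => π.fractionBider x (algebraMap A _ b)) e
    have e2 := congrArg (fun x => π.fractionBider (algebraMap A _ b) x) e
    simp only [Derivation.leibniz, Derivation.add_apply, Derivation.smul_apply, smul_eq_mul,
      fractionBider_algebraMap] at e1 e2
    rw [π.skew (s : A) b, π.skew a b, map_neg, map_neg] at e1
    refine hs.mul_left_cancel ?_
    linear_combination e1 + e2
  obtain ⟨a, s, hf⟩ := IsLocalization.exists_mk'_eq (nonZeroDivisors A) f
  have hs : IsUnit (algebraMap A (FractionRing A) s) := IsLocalization.map_units _ s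
  have e := IsLocalization.mk'_spec (FractionRing A) a s
  rw [hf] at e
  have e1 := congrArg (fun x => π.fractionBider x x) e
  simp only [Derivation.leibniz, Derivation.add_apply, Derivation.smul_apply, smul_eq_mul,
      fractionBider_algebraMap, π.alt, map_zero, h1 f s] at e1
  refine hs.mul_left_cancel (hs.mul_left_cancel ?_)
  linear_combination e1

/-- The extension of a Poisson bracket on `A` to `Fract A`; it is unique because derivations of
`Fract A` are determined on `A`. -/
noncomputable def fraction (π : PoissonBracket k A) : PoissonBracket k (FractionRing A) :=
  ofBiderivation π.fractionBider π.fractionBider_alt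
    (jac_of_set _ π.fractionBider_alt (Set.range (algebraMap A (FractionRing A)))
      (fun d hd => der_ext_fraction (A := A) _ d fun a => hd _ ⟨a, rfl⟩) (by
        rintro _ ⟨a, rfl⟩ _ ⟨b, rfl⟩ _ ⟨c, rfl⟩
        simp only [jac, fractionBider_algebraMap, ← map_add, π.jacobi, map_zero]))

@[simp]
theorem fraction_algebraMap (π : PoissonBracket k A) (a b : A) :
    π.fraction.bracket (algebraMap A (FractionRing A) a) (algebraMap A (FractionRing A) b) =
      algebraMap A (FractionRing A) (π.bracket a b) :=
  π.fractionBider_algebraMap a b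

end Fraction

section Polynomial

variable {R σ : Type*} [CommRing R]

/-- The biderivation of `R[X_s : s ∈ σ]` with `{X_s, X_t} = B s t`. -/
noncomputable def polyBider (B : σ → σ → MvPolynomial σ R) :
    Derivation R (MvPolynomial σ R) (Derivation R (MvPolynomial σ R) (MvPolynomial σ R)) :=
  mkDerivation R fun s => mkDerivation R fun t => B s t

@[simp]
theorem polyBider_X (B : σ → σ → MvPolynomial σ R) (s t : σ) :
    polyBider B (X s) (X t) = B s t := by
  rw [polyBider, mkDerivation_X, mkDerivation_X]

theorem polyBider_alt (B : σ → σ → MvPolynomial σ R) (h0 : ∀ s, B s s = 0)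
    (h1 : ∀ s t, B s t = -B t s) (f : MvPolynomial σ R) : polyBider B f f = 0 := by
  have hX : ∀ s f, polyBider B (X s) f = -polyBider B f (X s) := by
    intro s f
    induction f using MvPolynomial.induction_on with
    | C a => simp [MvPolynomial.derivation_C]
    | add p q hp hq => simp [hp, hq]; ring
    | mul_X p t hp =>
      simp only [Derivation.leibniz, Derivation.add_apply, Derivation.smul_apply, hp, polyBider_X,
        smul_eq_mul, h1 s t]
      ring
  have hsk : ∀ f g, polyBider B f g = -polyBider B g f := by
    intro f g
    induction f using MvPolynomial.induction_on with
    | C a => simp [MvPolynomial.derivation_C]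
    | add p q hp hq => simp [hp, hq]; ring
    | mul_X p t hp =>
      simp only [Derivation.leibniz, Derivation.add_apply, Derivation.smul_apply, hp, hX,
        smul_eq_mul]
      ring
  induction f using MvPolynomial.induction_on with
  | C a => simp [MvPolynomial.derivation_C]
  | add p q hp hq => simp [hp, hq, hsk p q]
  | mul_X p t hp =>
    simp only [Derivation.leibniz, Derivation.add_apply, Derivation.smul_apply, hp, polyBider_X,
      smul_eq_mul, h0, hX t p]
    ring

/-- The Poisson bracket on `R[X_s : s ∈ σ]` with `{X_s, X_t} = B s t`, provided that `B` is
alternating and that the Jacobi identity holds on the indeterminates. -/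
noncomputable def poly (k : Type*) [CommRing k] [Algebra k R]
    (B : σ → σ → MvPolynomial σ R) (h0 : ∀ s, B s s = 0) (h1 : ∀ s t, B s t = -B t s)
    (h2 : ∀ r s t, jac (polyBider B) (X r) (X s) (X t) = 0) :
    PoissonBracket k (MvPolynomial σ R) :=
  ofBiderivation (polyBider B) (polyBider_alt B h0 h1)
    (jac_of_set _ (polyBider_alt B h0 h1) (Set.range X)
      (fun d hd => MvPolynomial.derivation_ext fun i => hd _ ⟨i, rfl⟩)
      (by rintro _ ⟨r, rfl⟩ _ ⟨s, rfl⟩ _ ⟨t, rfl⟩; exact h2 r s t))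

@[simp]
theorem poly_X (k : Type*) [CommRing k] [Algebra k R]
    (B : σ → σ → MvPolynomial σ R) (h0 : ∀ s, B s s = 0) (h1 : ∀ s t, B s t = -B t s)
    (h2 : ∀ r s t, jac (polyBider B) (X r) (X s) (X t) = 0) (s t : σ) :
    (poly k B h0 h1 h2).bracket (X s) (X t) = B s t :=
  polyBider_X B s t

end Polynomial

section Families

variable {k : Type*} [Field k] [CharZero k]

theorem diag_zero {σ : Type*} {μ : Matrix σ σ k} (h : μ.transpose = -μ) (s : σ) : μ s s = 0 := by
  have := congrFun (congrFun h s) s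
  rw [Matrix.transpose_apply, Matrix.neg_apply] at this
  exact self_eq_neg.mp this

theorem skew_apply {k : Type*} [Field k] {σ : Type*} {μ : Matrix σ σ k} (h : μ.transpose = -μ) (s t : σ) :
    μ s t = -μ t s := congrFun (congrFun h t) s

/-- The Poisson algebra `K_μ[y_s : s ∈ σ]`, where `{y_s, y_t} = μ_{st} y_s y_t`, for an
antisymmetric matrix `μ` over `k` and a field extension `K` of `k`. -/
noncomputable def quadratic (K : Type*) [Field K] [Algebra k K] {σ : Type*} (μ : Matrix σ σ k)
    (hμ : μ.transpose = -μ) : PoissonBracket k (MvPolynomial σ K) :=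
  poly k (fun s t => C (algebraMap k K (μ s t)) * X s * X t)
    (fun s => by simp [diag_zero hμ])
    (fun s t => by rw [skew_apply hμ, map_neg, C_neg]; ring)
    (fun r s t => by
      simp only [jac, polyBider_X, Derivation.leibniz, MvPolynomial.derivation_C, smul_eq_mul,
        mul_zero, add_zero]
      rw [skew_apply hμ r t, skew_apply hμ s r, skew_apply hμ t s]
      simp only [map_neg]
      ring)

/-- `sign (a - b)` for indices `a`, `b`, as an element of a ring. -/
def sg (R : Type*) [Ring R] {n : ℕ} (a b : Fin n) : R :=
  if b < a then 1 else if a < b then -1 else 0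

theorem sg_skew (R : Type*) [Ring R] {n : ℕ} (a b : Fin n) : sg R a b = -sg R b a := by
  unfold sg
  rcases lt_trichotomy a b with h | h | h
  · simp [h, h.not_gt]
  · simp [h]
  · simp [h, h.not_gt]

theorem der_sg {R A : Type*} [CommRing R] [CommRing A] [Algebra R A] (d : Derivation R A A) {n : ℕ}
    (a b : Fin n) : d (sg A a b) = 0 := by
  unfold sg
  split_ifs <;> simp

theorem sg_cyc {R : Type*} [CommRing R] {n : ℕ} (a b c : Fin n) (P : R)
    (hP : a = b → b = c → P = 0) :
    (sg R a b * sg R b c + sg R b c * sg R c a + sg R c a * sg R a b + 1) * P = 0 := by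
  by_cases h : a = b ∧ b = c
  · rw [hP h.1 h.2, mul_zero]
  · suffices sg R a b * sg R b c + sg R b c * sg R c a + sg R c a * sg R a b + 1 = 0 by
      rw [this, zero_mul]
    unfold sg
    split_ifs <;> first | (exfalso; omega) | ring

/-- The alternating extension of a function prescribed on the pairs with `r a b`. -/
def skewExtend {σ G : Type*} [Neg G] [Zero G] (r : σ → σ → Prop) [DecidableRel r]
    (c : σ → σ → G) (a b : σ) : G :=
  if r a b then c a b else if r b a then -c b a else 0

theorem skewExtend_self {σ G : Type*} [Neg G] [Zero G] (r : σ → σ → Prop) [DecidableRel r]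
    (hr : ∀ a b, r a b → ¬ r b a) (c : σ → σ → G) (a : σ) : skewExtend r c a a = 0 := by
  have : ¬ r a a := fun h => hr a a h h
  simp [skewExtend, this]

theorem skewExtend_skew {σ G : Type*} [AddGroup G] (r : σ → σ → Prop) [DecidableRel r]
    (hr : ∀ a b, r a b → ¬ r b a) (c : σ → σ → G) (a b : σ) :
    skewExtend r c a b = -skewExtend r c b a := by
  unfold skewExtend
  by_cases h1 : r a b
  · simp [h1, hr a b h1]
  · by_cases h2 : r b a <;> simp [h1, h2]

/-- The lexicographic order on pairs of indices. -/
def LexLT {n : ℕ} (a b : Fin n × Fin n) : Prop :=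
  a.1 < b.1 ∨ (a.1 = b.1 ∧ a.2 < b.2)

instance {n : ℕ} : DecidableRel (LexLT (n := n)) := fun _ _ => inferInstanceAs (Decidable (_ ∨ _))

theorem LexLT.asymm {n : ℕ} (a b : Fin n × Fin n) (h : LexLT a b) : ¬ LexLT b a := by
  unfold LexLT at *
  omega

/-- The bracket `{X_{lm}, X_{ij}}` of the semiclassical limit of quantum `n × n` matrices with
parameters `lam` and `p`; it is prescribed for `(i,j) <_lex (l,m)`. -/
noncomputable def matricesGen {n : ℕ} (lam : k) (p : Matrix (Fin n) (Fin n) k) :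
    Fin n × Fin n → Fin n × Fin n → MvPolynomial (Fin n × Fin n) k :=
  skewExtend (fun a b => LexLT b a) fun (l, m) (i, j) =>
    if i < l ∧ j < m then
      C (p l i + p j m) * X (i, j) * X (l, m) + C lam * X (i, m) * X (l, j)
    else if i < l then
      C (lam + p l i + p j m) * X (i, j) * X (l, m)
    else
      C (p j m) * X (i, j) * X (l, m)

theorem matricesGen_self {k : Type*} [Field k] {n : ℕ} (lam : k) (p : Matrix (Fin n) (Fin n) k)
    (a : Fin n × Fin n) : matricesGen lam p a a = 0 :=
  skewExtend_self _ (fun a b h => LexLT.asymm b a h) _ a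

theorem matricesGen_skew {k : Type*} [Field k] {n : ℕ} (lam : k) (p : Matrix (Fin n) (Fin n) k)
    (a b : Fin n × Fin n) : matricesGen lam p a b = -matricesGen lam p b a :=
  skewExtend_skew _ (fun a b h => LexLT.asymm b a h) _ a b

theorem matricesGen_eq {n : ℕ} (h : k) (p : Matrix (Fin n) (Fin n) k)
    (hp : p.transpose = -p) (l m i j : Fin n) :
    matricesGen (h + h) p (l, m) (i, j) =
      (C (p l i) + C (p j m) + C h * (sg _ l i - sg _ m j)) * X (l, m) * X (i, j) +
        C h * (sg _ l i + sg _ m j) * X (i, m) * X (l, j) := by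
  have e1 := skew_apply hp i l
  have e2 := skew_apply hp m j
  have e3 := diag_zero hp
  unfold matricesGen skewExtend LexLT sg
  dsimp only
  rcases lt_trichotomy l i with h1 | rfl | h1 <;> rcases lt_trichotomy m j with h2 | rfl | h2 <;>
    simp [*, not_lt_of_gt, LT.lt.ne'] <;> ring

theorem matricesGen_jac {n : ℕ} (lam : k) (p : Matrix (Fin n) (Fin n) k)
    (hp : p.transpose = -p) (a b c : Fin n × Fin n) :
    jac (polyBider (matricesGen lam p)) (X a) (X b) (X c) = 0 := by
  obtain ⟨h, rfl⟩ : ∃ h, lam = h + h := ⟨lam / 2, (add_halves lam).symm⟩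
  obtain ⟨l, m⟩ := a
  obtain ⟨i, j⟩ := b
  obtain ⟨r, s⟩ := c
  simp only [jac, polyBider_X, matricesGen_eq h p hp, Derivation.leibniz, map_add, map_sub,
    MvPolynomial.derivation_C, der_sg, smul_eq_mul, mul_zero, add_zero, sub_zero]
  have h1 := sg_cyc l i r (C h ^ 2 * (X (l, j) * X (i, s) * X (r, m) -
    X (l, s) * X (i, m) * X (r, j)) : MvPolynomial (Fin n × Fin n) k)
    (by rintro rfl rfl; ring)
  have h2 := sg_cyc m j s (C h ^ 2 * (X (l, j) * X (i, s) * X (r, m) -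
    X (l, s) * X (i, m) * X (r, j)) : MvPolynomial (Fin n × Fin n) k)
    (by rintro rfl rfl; ring)
  rw [sg_skew _ i l, sg_skew _ r i, sg_skew _ r l, sg_skew _ j m, sg_skew _ s j, sg_skew _ s m,
    skew_apply hp i l, skew_apply hp r i, skew_apply hp r l, skew_apply hp j m, skew_apply hp s j,
    skew_apply hp s m] at *
  simp only [map_neg]
  linear_combination h2 - h1

/-- The indeterminates `y_{ij}`, `i ≤ j`, of symmetric `n × n` matrices, with `y_{ji} = y_{ij}`. -/
noncomputable def symY (k : Type*) [Field k] {n : ℕ} (i j : Fin n) :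
    MvPolynomial {a : Fin n × Fin n // a.1 ≤ a.2} k :=
  X ⟨(min i j, max i j), min_le_max⟩

theorem symY_comm (k : Type*) [Field k] {n : ℕ} (i j : Fin n) : symY k i j = symY k j i := by
  simp only [symY, min_comm, max_comm]

theorem symY_of_le (k : Type*) [Field k] (n : ℕ) (a : {a : Fin n × Fin n // a.1 ≤ a.2}) :
    symY k a.1.1 a.1.2 = X a := by
  simp only [symY, min_eq_left a.2, max_eq_right a.2]

/-- The bracket `{y_{ij}, y_{lm}}` of the semiclassical limit of quantum symmetric matrices. -/
noncomputable def symGen (k : Type*) [Field k] (n : ℕ) (a b : {a : Fin n × Fin n // a.1 ≤ a.2}) :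
    MvPolynomial {a : Fin n × Fin n // a.1 ≤ a.2} k :=
  let i := a.1.1
  let j := a.1.2
  let l := b.1.1
  let m := b.1.2
  (sg _ l j + sg _ m i) * symY k i l * symY k j m + (sg _ l i + sg _ m j) * symY k i m * symY k j l

theorem symGen_eq (k : Type*) [Field k] {n : ℕ} (i j l m : Fin n) :
    polyBider (symGen k n) (symY k i j) (symY k l m) =
      (sg _ l j + sg _ m i) * symY k i l * symY k j m +
        (sg _ l i + sg _ m j) * symY k i m * symY k j l := by
  have key : ∀ i j l m : Fin n, i ≤ j → l ≤ m →
      polyBider (symGen k n) (symY k i j) (symY k l m) =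
      (sg _ l j + sg _ m i) * symY k i l * symY k j m +
        (sg _ l i + sg _ m j) * symY k i m * symY k j l := by
    intro i j l m h1 h2
    have := polyBider_X (symGen k n) ⟨(i, j), h1⟩ ⟨(l, m), h2⟩
    rwa [← symY_of_le, ← symY_of_le] at this
  rcases le_total i j with h1 | h1 <;> rcases le_total l m with h2 | h2
  · exact key i j l m h1 h2
  · rw [symY_comm k l m, key i j m l h1 h2]; ring
  · rw [symY_comm k i j, key j i l m h1 h2]; ring
  · rw [symY_comm k i j, symY_comm k l m, key j i m l h1 h2]; ring

theorem symGen_skew (k : Type*) [Field k] {n : ℕ} (a b : {a : Fin n × Fin n // a.1 ≤ a.2}) :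
    symGen k n a b = -symGen k n b a := by
  obtain ⟨⟨i, j⟩, h1⟩ := a
  obtain ⟨⟨l, m⟩, h2⟩ := b
  simp only [symGen]
  rw [sg_skew _ l j, sg_skew _ m i, sg_skew _ l i, sg_skew _ m j, symY_comm k l i, symY_comm k m j,
    symY_comm k l j, symY_comm k m i]
  ring

theorem symGen_jac (k : Type*) [Field k] {n : ℕ} (a b c : {a : Fin n × Fin n // a.1 ≤ a.2}) :
    jac (polyBider (symGen k n)) (X a) (X b) (X c) = 0 := by
  rw [← symY_of_le k n a, ← symY_of_le k n b, ← symY_of_le k n c]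
  obtain ⟨⟨i, j⟩, h1⟩ := a
  obtain ⟨⟨l, m⟩, h2⟩ := b
  obtain ⟨⟨r, s⟩, h3⟩ := c
  have cert : ∀ x x' y y' z z' : Fin n, _ := fun x x' y y' z z' => sg_cyc x y z
    (symY k x y' * symY k y z' * symY k z x' - symY k x z' * symY k y x' * symY k z y')
    (by rintro rfl rfl; ring)
  have c1 := cert i j l m r s
  have c2 := cert i j l m s r
  have c3 := cert i j m l r s
  have c4 := cert i j m l s r
  have c5 := cert j i l m r s
  have c6 := cert j i l m s r
  have c7 := cert j i m l r s
  have c8 := cert j i m l s r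
  simp only [jac, symGen_eq, Derivation.leibniz, map_add, der_sg, smul_eq_mul, mul_zero, add_zero]
  rw [sg_skew _ l i, sg_skew _ l j, sg_skew _ m i, sg_skew _ m j, sg_skew _ r i, sg_skew _ r j,
    sg_skew _ s i, sg_skew _ s j, sg_skew _ r l, sg_skew _ r m, sg_skew _ s l, sg_skew _ s m,
    symY_comm k l i, symY_comm k l j, symY_comm k m i, symY_comm k m j, symY_comm k r i,
    symY_comm k r j, symY_comm k s i, symY_comm k s j, symY_comm k r l, symY_comm k r m,
    symY_comm k s l, symY_comm k s m] at *
  linear_combination -(c1 + c2 + c3 + c4 + c5 + c6 + c7 + c8)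

/-- The indeterminates `y_{ij}`, `i < j`, of antisymmetric `n × n` matrices, with
`y_{ji} = -y_{ij}` and `y_{ii} = 0`. -/
noncomputable def altY (k : Type*) [Field k] {n : ℕ} (i j : Fin n) :
    MvPolynomial {a : Fin n × Fin n // a.1 < a.2} k :=
  if h : i < j then X ⟨(i, j), h⟩ else if h : j < i then -X ⟨(j, i), h⟩ else 0

theorem altY_comm (k : Type*) [Field k] {n : ℕ} (i j : Fin n) : altY k i j = -altY k j i := by
  unfold altY
  rcases lt_trichotomy i j with h | h | h
  · simp [h, h.not_gt]
  · simp [h]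
  · simp [h, h.not_gt]

theorem altY_of_lt (k : Type*) [Field k] (n : ℕ) (a : {a : Fin n × Fin n // a.1 < a.2}) :
    altY k a.1.1 a.1.2 = X a := by
  rw [altY, dif_pos a.2]

theorem altY_self (k : Type*) [Field k] {n : ℕ} (i : Fin n) : altY k i i = 0 := by
  simp [altY]

/-- The bracket `{y_{ij}, y_{lm}}` of the semiclassical limit of quantum antisymmetric matrices. -/
noncomputable def altGen (k : Type*) [Field k] (n : ℕ) (a b : {a : Fin n × Fin n // a.1 < a.2}) :
    MvPolynomial {a : Fin n × Fin n // a.1 < a.2} k :=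
  let i := a.1.1
  let j := a.1.2
  let l := b.1.1
  let m := b.1.2
  (sg _ l j + sg _ m i) * altY k i l * altY k j m - (sg _ l i + sg _ m j) * altY k i m * altY k j l

theorem altGen_eq (k : Type*) [Field k] {n : ℕ} (i j l m : Fin n) :
    polyBider (altGen k n) (altY k i j) (altY k l m) =
      (sg _ l j + sg _ m i) * altY k i l * altY k j m -
        (sg _ l i + sg _ m j) * altY k i m * altY k j l := by
  have key : ∀ i j l m : Fin n, i < j → l < m →
      polyBider (altGen k n) (altY k i j) (altY k l m) =
      (sg _ l j + sg _ m i) * altY k i l * altY k j m -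
        (sg _ l i + sg _ m j) * altY k i m * altY k j l := by
    intro i j l m h1 h2
    have := polyBider_X (altGen k n) ⟨(i, j), h1⟩ ⟨(l, m), h2⟩
    rwa [← altY_of_lt, ← altY_of_lt] at this
  rcases lt_trichotomy i j with h1 | rfl | h1
  · rcases lt_trichotomy l m with h2 | rfl | h2
    · exact key i j l m h1 h2
    · rw [altY_self k l, map_zero]; ring
    · rw [altY_comm k l m, map_neg, key i j m l h1 h2]; ring
  · rw [altY_self k i, map_zero, Derivation.zero_apply]; ring
  · rcases lt_trichotomy l m with h2 | rfl | h2
    · rw [altY_comm k i j, map_neg, Derivation.neg_apply, key j i l m h1 h2]; ring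
    · rw [altY_self k l, map_zero]; ring
    · rw [altY_comm k i j, altY_comm k l m, map_neg, map_neg, Derivation.neg_apply,
        key j i m l h1 h2]
      ring

theorem altGen_skew (k : Type*) [Field k] {n : ℕ} (a b : {a : Fin n × Fin n // a.1 < a.2}) :
    altGen k n a b = -altGen k n b a := by
  obtain ⟨⟨i, j⟩, h1⟩ := a
  obtain ⟨⟨l, m⟩, h2⟩ := b
  simp only [altGen]
  rw [sg_skew _ l j, sg_skew _ m i, sg_skew _ l i, sg_skew _ m j, altY_comm k l i, altY_comm k m j,
    altY_comm k l j, altY_comm k m i]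
  ring

theorem altGen_jac (k : Type*) [Field k] {n : ℕ} (a b c : {a : Fin n × Fin n // a.1 < a.2}) :
    jac (polyBider (altGen k n)) (X a) (X b) (X c) = 0 := by
  rw [← altY_of_lt k n a, ← altY_of_lt k n b, ← altY_of_lt k n c]
  obtain ⟨⟨i, j⟩, h1⟩ := a
  obtain ⟨⟨l, m⟩, h2⟩ := b
  obtain ⟨⟨r, s⟩, h3⟩ := c
  have cert : ∀ x x' y y' z z' : Fin n, _ := fun x x' y y' z z' => sg_cyc x y z
    (altY k x y' * altY k y z' * altY k z x' - altY k x z' * altY k y x' * altY k z y')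
    (by rintro rfl rfl; ring)
  have c1 := cert i j l m r s
  have c2 := cert i j l m s r
  have c3 := cert i j m l r s
  have c4 := cert i j m l s r
  have c5 := cert j i l m r s
  have c6 := cert j i l m s r
  have c7 := cert j i m l r s
  have c8 := cert j i m l s r
  simp only [jac, altGen_eq, Derivation.leibniz, map_add, map_sub, der_sg, smul_eq_mul, mul_zero,
    add_zero]
  rw [sg_skew _ l i, sg_skew _ l j, sg_skew _ m i, sg_skew _ m j, sg_skew _ r i, sg_skew _ r j,
    sg_skew _ s i, sg_skew _ s j, sg_skew _ r l, sg_skew _ r m, sg_skew _ s l, sg_skew _ s m,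
    altY_comm k l i, altY_comm k l j, altY_comm k m i, altY_comm k m j, altY_comm k r i,
    altY_comm k r j, altY_comm k s i, altY_comm k s j, altY_comm k r l, altY_comm k r m,
    altY_comm k s l, altY_comm k s m] at *
  linear_combination -(c1 - c2 - c3 + c4 - c5 + c6 + c7 - c8)

theorem jac_self {R A : Type*} [CommRing R] [CommRing A] [Algebra R A]
    (D : Derivation R A (Derivation R A A)) (alt : ∀ a, D a a = 0) (a c : A) :
    jac D a a c = 0 := by
  rw [jac, alt, bider_skew D alt c a]
  simp

theorem jac_cyc {R A : Type*} [CommRing R] [CommRing A] [Algebra R A]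
    (D : Derivation R A (Derivation R A A)) (a b c : A) : jac D a b c = jac D b c a := by
  simp only [jac]; ring

/-- The Jacobi identity on generators for the brackets of quantum euclidean type. -/
theorem euclid_jac {A : Type*} [CommRing A] [Algebra k A] (D : Derivation k A (Derivation k A A))
    (alt : ∀ a, D a a = 0) {n : ℕ} (Γ : Matrix (Fin n) (Fin n) k) (hΓ : Γ.transpose = -Γ)
    (p q : Fin n → k) (lam : k) (x y : Fin n → A) (z : A)
    (hzx : ∀ i, D z (x i) = algebraMap k A (-(p i / 2)) * z * x i)
    (hzy : ∀ i, D z (y i) = algebraMap k A (p i / 2) * z * y i)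
    (hyy : ∀ i j, D (y i) (y j) = algebraMap k A (Γ i j) * y i * y j)
    (hlt : ∀ i j, i < j → D (x i) (y j) = algebraMap k A (p j + Γ j i) * x i * y j)
    (hgt : ∀ i j, j < i → D (x i) (y j) = algebraMap k A (q j + Γ j i) * x i * y j)
    (hxx : ∀ i j, i < j → D (x i) (x j) = algebraMap k A (q i - p j + Γ i j) * x i * x j)
    (hxy : ∀ i, D (x i) (y i) = algebraMap k A (q i) * x i * y i +
      (∑ l with l < i, algebraMap k A (q l - p l) * x l * y l) + algebraMap k A lam * z ^ 2)
    (a b c : A) (ha : a = z ∨ a ∈ Set.range x ∨ a ∈ Set.range y)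
    (hb : b = z ∨ b ∈ Set.range x ∨ b ∈ Set.range y)
    (hc : c = z ∨ c ∈ Set.range x ∨ c ∈ Set.range y) : jac D a b c = 0 := by
  have sk := bider_skew D alt
  set Om : ℕ → A := fun i => (∑ l : Fin n with l.val < i, algebraMap k A (q l - p l) * x l * y l) +
    algebraMap k A lam * z ^ 2 with hOm
  have Om0 : Om 0 = algebraMap k A lam * z ^ 2 := by simp [hOm]
  have OmS : ∀ i : Fin n, Om (i.val + 1) = Om i.val + algebraMap k A (q i - p i) * x i * y i := by
    intro i
    have : (Finset.univ.filter fun l : Fin n => l.val < i.val + 1) =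
        insert i (Finset.univ.filter fun l : Fin n => l.val < i.val) := by
      ext l
      simp only [Finset.mem_filter, Finset.mem_univ, true_and, Finset.mem_insert, Fin.ext_iff]
      omega
    simp only [hOm]
    rw [this, Finset.sum_insert (by simp)]
    ring
  have hxy' : ∀ i, D (x i) (y i) = algebraMap k A (q i) * x i * y i + Om i.val := by
    intro i
    rw [hxy, add_assoc]
    rfl
  have hgΓ : ∀ i j, algebraMap k A (Γ i j) = -algebraMap k A (Γ j i) := fun i j => by
    rw [skew_apply hΓ i j, map_neg]
  have hh : ∀ i, algebraMap k A (p i) = 2 * algebraMap k A (p i / 2) := fun i => by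
    rw [← map_ofNat (algebraMap k A) 2, ← map_mul]; congr 1; ring
  have hxz : ∀ i, D (x i) z = algebraMap k A (p i / 2) * z * x i := fun i => by
    rw [sk, hzx, map_neg]; ring
  have hyz : ∀ i, D (y i) z = -algebraMap k A (p i / 2) * z * y i := fun i => by
    rw [sk, hzy]; ring
  have hyx : ∀ i, D (y i) (x i) = -(algebraMap k A (q i) * x i * y i + Om i.val) := fun i => by
    rw [sk, hxy']
  -- brackets with the sums
  have zOm : ∀ i, i ≤ n → D z (Om i) = 0 := by
    intro i
    induction i with
    | zero => intro _; simp [Om0, alt, pow_two]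
    | succ i ih =>
      intro hi
      have := OmS ⟨i, hi⟩
      simp only at this
      rw [this, map_add, ih (by omega)]
      simp only [Derivation.leibniz, Derivation.map_algebraMap, hzx, hzy, smul_eq_mul, map_neg]
      ring
  have xOm : ∀ (j : Fin n) (i : ℕ), i ≤ n → D (x j) (Om i) =
      algebraMap k A (if i ≤ j.val then p j else q j) * Om i * x j := by
    intro j i
    induction i with
    | zero =>
      intro _
      simp only [Om0, zero_le, if_true, Derivation.leibniz, Derivation.map_algebraMap, pow_two,
        hxz, smul_eq_mul, hh]
      ring
    | succ i ih =>
      intro hi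
      have := OmS ⟨i, hi⟩
      simp only at this
      rw [this, map_add, ih (by omega)]
      simp only [Derivation.leibniz, Derivation.map_algebraMap, smul_eq_mul]
      rcases lt_trichotomy i j.val with h | h | h
      · have h' : (⟨i, hi⟩ : Fin n) < j := h
        rw [hgt j ⟨i, hi⟩ h', sk (x j), hxx ⟨i, hi⟩ j h', if_pos h.le, if_pos (by omega)]
        simp only [map_add, map_sub]
        ring
      · obtain rfl : j = ⟨i, hi⟩ := Fin.ext h.symm
        rw [hxy', alt, if_pos (by simp), if_neg (by simp)]
        simp only [map_sub]
        ring
      · have h' : j < (⟨i, hi⟩ : Fin n) := h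
        rw [hlt j ⟨i, hi⟩ h', hxx j ⟨i, hi⟩ h', if_neg (by omega), if_neg (by omega)]
        simp only [map_add, map_sub]
        rw [hgΓ j ⟨i, hi⟩]
        ring
  have yOm : ∀ (j : Fin n) (i : ℕ), i ≤ n → D (y j) (Om i) =
      -algebraMap k A (if i ≤ j.val then p j else q j) * Om i * y j := by
    intro j i
    induction i with
    | zero =>
      intro _
      simp only [Om0, zero_le, if_true, Derivation.leibniz, Derivation.map_algebraMap, pow_two,
        hyz, smul_eq_mul, hh]
      ring
    | succ i ih =>
      intro hi
      have := OmS ⟨i, hi⟩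
      simp only at this
      rw [this, map_add, ih (by omega)]
      simp only [Derivation.leibniz, Derivation.map_algebraMap, smul_eq_mul]
      rcases lt_trichotomy i j.val with h | h | h
      · have h' : (⟨i, hi⟩ : Fin n) < j := h
        rw [hyy, sk (y j), hlt ⟨i, hi⟩ j h', if_pos h.le, if_pos (by omega)]
        simp only [map_add]
        ring
      · obtain rfl : j = ⟨i, hi⟩ := Fin.ext h.symm
        rw [hyx, alt, if_pos (by simp), if_neg (by simp)]
        simp only [map_sub]
        ring
      · have h' : j < (⟨i, hi⟩ : Fin n) := h
        rw [hyy, sk (y j) (x _), hgt ⟨i, hi⟩ j h', if_neg (by omega), if_neg (by omega)]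
        simp only [map_add]
        ring
  -- uniform form of the quadratic brackets
  obtain ⟨ξ, m, hξ, hξs, hξ1, hm, hm1, r1, r2⟩ : ∃ ξ m : Fin n → Fin n → A,
      (∀ i j, D (x i) (x j) = ξ i j * x i * x j) ∧ (∀ i j, ξ i j = -ξ j i) ∧
      (∀ i j, ∃ c : k, ξ i j = algebraMap k A c) ∧
      (∀ i j, i ≠ j → D (x i) (y j) = m i j * x i * y j) ∧
      (∀ i j, ∃ c : k, m i j = algebraMap k A c) ∧
      (∀ i j, i ≠ j → algebraMap k A (if i.val ≤ j.val then p j else q j) = m j i - ξ i j) ∧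
      (∀ i j, i ≠ j → algebraMap k A (if i.val ≤ j.val then p j else q j) =
        m i j + algebraMap k A (Γ i j)) := by
    refine ⟨fun i j => algebraMap k A (if i < j then q i - p j + Γ i j else
      if j < i then -(q j - p i + Γ j i) else 0),
      fun i j => algebraMap k A (if i < j then p j + Γ j i else q j + Γ j i),
      ?_, ?_, fun i j => ⟨_, rfl⟩, ?_, fun i j => ⟨_, rfl⟩, ?_, ?_⟩
    · intro i j
      rcases lt_trichotomy i j with h | rfl | h
      · simp only [h, if_true, hxx i j h]
      · simp [alt]
      · simp only [h, h.not_gt, if_true, if_false, sk (x i), hxx j i h, map_neg]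
        ring
    · intro i j
      rcases lt_trichotomy i j with h | rfl | h
      · simp [h, h.not_gt]
      · simp
      · simp [h, h.not_gt]
    · intro i j hij
      rcases lt_or_gt_of_ne hij with h | h
      · simp only [h, if_true, hlt i j h]
      · simp only [h.not_gt, if_false, hgt i j h]
    · intro i j hij
      rcases lt_or_gt_of_ne hij with h | h
      · simp only [h, h.not_gt, if_true, if_false, Fin.val_fin_le.mpr h.le, map_add, map_sub]
        ring
      · have : ¬ i.val ≤ j.val := by simpa using h
        simp only [h, h.not_gt, if_true, if_false, this, map_add, map_sub, map_neg, hgΓ i j]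
        ring
    · intro i j hij
      rcases lt_or_gt_of_ne hij with h | h
      · simp only [h, if_true, Fin.val_fin_le.mpr h.le, map_add, hgΓ i j]
        ring
      · have : ¬ i.val ≤ j.val := by simpa using h
        simp only [h.not_gt, if_false, this, map_add, hgΓ i j]
        ring
  have ξd : ∀ (d : Derivation k A A) i j, d (ξ i j) = 0 := fun d i j => by
    obtain ⟨c, hc⟩ := hξ1 i j
    rw [hc, Derivation.map_algebraMap]
  have md : ∀ (d : Derivation k A A) i j, d (m i j) = 0 := fun d i j => by
    obtain ⟨c, hc⟩ := hm1 i j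
    rw [hc, Derivation.map_algebraMap]
  have hm' : ∀ i j, i ≠ j → D (y j) (x i) = -(m i j * x i * y j) := fun i j h => by
    rw [sk, hm i j h]
  have cyc := jac_cyc D
  have sw := jac_swap D alt
  have sf := jac_self D alt
  have xxx : ∀ i j r, jac D (x i) (x j) (x r) = 0 := fun i j r => by
    simp only [jac, hξ, Derivation.leibniz, ξd, smul_eq_mul]
    rw [hξs j i, hξs r j, hξs r i]
    ring
  have yyy : ∀ i j r, jac D (y i) (y j) (y r) = 0 := fun i j r => by
    simp only [jac, hyy, Derivation.leibniz, Derivation.map_algebraMap, smul_eq_mul]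
    rw [hgΓ j i, hgΓ r j, hgΓ r i]
    ring
  have xxy0 : ∀ i j, i ≠ j → jac D (x i) (x j) (y i) = 0 := fun i j h => by
    simp only [jac, hm j i h.symm, hyx, hξ, Derivation.leibniz, ξd, md, Derivation.map_algebraMap,
      smul_eq_mul, map_neg, map_add, hxy', hm' j i h.symm, xOm j i.val i.2.le]
    rw [r1 i j h, hξs j i]
    ring
  have yyx0 : ∀ i j, i ≠ j → jac D (y i) (y j) (x i) = 0 := fun i j h => by
    simp only [jac, hm i j h, hm' i j h, hxy', hyx, hyy, Derivation.leibniz, md,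
      Derivation.map_algebraMap, smul_eq_mul, map_neg, map_add, yOm j i.val i.2.le]
    rw [r2 i j h, hgΓ j i]
    ring
  have xxy : ∀ i j r, jac D (x i) (x j) (y r) = 0 := fun i j r => by
    by_cases h : i = j
    · rw [h, sf]
    by_cases h1 : i = r
    · rw [← h1, xxy0 i j h]
    by_cases h2 : j = r
    · rw [← h2, sw, xxy0 j i (Ne.symm h), neg_zero]
    simp only [jac, hm j r h2, hm i r h1, hm' j r h2, hm' i r h1, hξ, Derivation.leibniz, ξd, md,
      smul_eq_mul, map_neg]
    rw [hξs j i]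
    ring
  have yyx : ∀ i j r, jac D (y i) (y j) (x r) = 0 := fun i j r => by
    by_cases h : i = j
    · rw [h, sf]
    by_cases h1 : i = r
    · rw [← h1, yyx0 i j h]
    by_cases h2 : j = r
    · rw [← h2, sw, yyx0 j i (Ne.symm h), neg_zero]
    have h1' := Ne.symm h1
    have h2' := Ne.symm h2
    simp only [jac, hm r j h2', hm r i h1', hm' r j h2', hm' r i h1', hyy, Derivation.leibniz, md,
      Derivation.map_algebraMap, smul_eq_mul, map_neg]
    rw [hgΓ j i]
    ring
  have zxx : ∀ i j, jac D z (x i) (x j) = 0 := fun i j => by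
    simp only [jac, hξ, hzx, hxz, Derivation.leibniz, ξd, Derivation.map_algebraMap, smul_eq_mul,
      map_neg]
    rw [hξs j i]
    ring
  have zyy : ∀ i j, jac D z (y i) (y j) = 0 := fun i j => by
    simp only [jac, hyy, hzy, hyz, Derivation.leibniz, Derivation.map_algebraMap, smul_eq_mul,
      map_neg]
    rw [hgΓ j i]
    ring
  have zxy : ∀ i j, jac D z (x i) (y j) = 0 := fun i j => by
    by_cases h : i = j
    · subst h
      simp only [jac, hxy', hyx, hzx, hzy, hxz, hyz, Derivation.leibniz, Derivation.map_algebraMap,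
        smul_eq_mul, map_neg, map_add, zOm i.val i.2.le]
      ring
    · simp only [jac, hm i j h, hm' i j h, hzx, hzy, hxz, hyz, Derivation.leibniz, md,
        Derivation.map_algebraMap, smul_eq_mul, map_neg]
      ring
  rcases ha with rfl | ⟨i, rfl⟩ | ⟨i, rfl⟩ <;> rcases hb with rfl | ⟨j, rfl⟩ | ⟨j, rfl⟩ <;>
    rcases hc with rfl | ⟨r, rfl⟩ | ⟨r, rfl⟩
  · exact sf _ _
  · exact sf _ _
  · exact sf _ _
  · rw [cyc, cyc, sf]
  · exact zxx _ _
  · exact zxy _ _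
  · rw [cyc, cyc, sf]
  · rw [cyc, sw, cyc, cyc, zxy, neg_zero]
  · exact zyy _ _
  · rw [cyc, sf]
  · rw [cyc, zxx]
  · rw [sw, zxy, neg_zero]
  · rw [cyc, cyc, zxx]
  · exact xxx _ _ _
  · exact xxy _ _ _
  · rw [cyc, cyc, zxy]
  · rw [cyc, cyc, xxy]
  · rw [cyc, yyx]
  · rw [cyc, sf]
  · rw [cyc, zxy]
  · rw [cyc, zyy]
  · rw [sw, cyc, cyc, zxy, neg_zero]
  · rw [cyc, xxy]
  · rw [cyc, cyc, yyx]
  · rw [cyc, cyc, zyy]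
  · exact yyx _ _ _
  · exact yyy _ _ _

/-- The bracket on the generators `x_i = inl i`, `y_i = inr i` of the Horton-Oh algebra
`A^{P,Q}_{n,Γ}(k)`. -/
noncomputable def evenGen {n : ℕ} (Γ : Matrix (Fin n) (Fin n) k) (p q : Fin n → k) :
    Fin n ⊕ Fin n → Fin n ⊕ Fin n → MvPolynomial (Fin n ⊕ Fin n) k :=
  let x : Fin n → MvPolynomial (Fin n ⊕ Fin n) k := fun i => X (.inl i)
  let y : Fin n → MvPolynomial (Fin n ⊕ Fin n) k := fun i => X (.inr i)
  let xy : Fin n → Fin n → MvPolynomial (Fin n ⊕ Fin n) k := fun i j =>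
    if i < j then C (p j + Γ j i) * x i * y j
    else if j < i then C (q j + Γ j i) * x i * y j
    else C (q i) * x i * y i + ∑ l with l < i, C (q l - p l) * x l * y l
  fun
  | .inr i, .inr j => C (Γ i j) * y i * y j
  | .inl i, .inr j => xy i j
  | .inr j, .inl i => -xy i j
  | .inl i, .inl j => skewExtend (· < ·) (fun i j => C (q i - p j + Γ i j) * x i * x j) i j

theorem evenGen_self {n : ℕ} {Γ : Matrix (Fin n) (Fin n) k} (hΓ : Γ.transpose = -Γ)
    (p q : Fin n → k) (a : Fin n ⊕ Fin n) : evenGen Γ p q a a = 0 := by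
  rcases a with i | i
  · simp only [evenGen]
    exact skewExtend_self (G := MvPolynomial _ k) (fun i j : Fin n => i < j) (fun _ _ => lt_asymm) _ i
  · simp [evenGen, diag_zero hΓ]

theorem evenGen_skew {k : Type*} [Field k] {n : ℕ} {Γ : Matrix (Fin n) (Fin n) k} (hΓ : Γ.transpose = -Γ)
    (p q : Fin n → k) (a b : Fin n ⊕ Fin n) : evenGen Γ p q a b = -evenGen Γ p q b a := by
  rcases a with i | i <;> rcases b with j | j
  · simp only [evenGen]
    exact skewExtend_skew (G := MvPolynomial _ k) (fun i j : Fin n => i < j) (fun _ _ => lt_asymm) _ i j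
  · exact (neg_neg _).symm
  · rfl
  · simp only [evenGen, skew_apply hΓ i j, map_neg]
    ring

theorem evenGen_jac {n : ℕ} {Γ : Matrix (Fin n) (Fin n) k} (hΓ : Γ.transpose = -Γ)
    (p q : Fin n → k) (a b c : Fin n ⊕ Fin n) :
    jac (polyBider (evenGen Γ p q)) (X a) (X b) (X c) = 0 := by
  have mem : ∀ a : Fin n ⊕ Fin n, (X a : MvPolynomial (Fin n ⊕ Fin n) k) = 0 ∨
      (X a : MvPolynomial (Fin n ⊕ Fin n) k) ∈
        Set.range (fun i : Fin n => (X (.inl i) : MvPolynomial (Fin n ⊕ Fin n) k)) ∨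
      (X a : MvPolynomial (Fin n ⊕ Fin n) k) ∈
        Set.range (fun i : Fin n => (X (.inr i) : MvPolynomial (Fin n ⊕ Fin n) k)) := by
    rintro (i | i)
    · exact .inr (.inl ⟨i, rfl⟩)
    · exact .inr (.inr ⟨i, rfl⟩)
  refine euclid_jac (polyBider (evenGen Γ p q))
    (polyBider_alt _ (evenGen_self hΓ p q) (evenGen_skew hΓ p q)) Γ hΓ p q 0
    (fun i => X (.inl i)) (fun i => X (.inr i)) 0 (by simp) (by simp) ?_ ?_ ?_ ?_ ?_ _ _ _
    (mem a) (mem b) (mem c)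
  · intro i j; rw [polyBider_X]; rfl
  · intro i j h; rw [polyBider_X]; simp [evenGen, h]
  · intro i j h; rw [polyBider_X]; simp [evenGen, h, h.not_gt]
  · intro i j h; rw [polyBider_X]; simp [evenGen, skewExtend, h]
  · intro i; rw [polyBider_X]; simp [evenGen]

/-- The bracket on the generators `z_0 = none`, `x_i = some (inl i)`, `y_i = some (inr i)` of the
semiclassical limit of odd-dimensional quantum euclidean spaces. -/
noncomputable def oddGen {n : ℕ} (Γ : Matrix (Fin n) (Fin n) k) (p q : Fin n → k) (lam : k) :
    Option (Fin n ⊕ Fin n) → Option (Fin n ⊕ Fin n) → MvPolynomial (Option (Fin n ⊕ Fin n)) k :=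
  let z : MvPolynomial (Option (Fin n ⊕ Fin n)) k := X none
  let x : Fin n → MvPolynomial (Option (Fin n ⊕ Fin n)) k := fun i => X (some (.inl i))
  let y : Fin n → MvPolynomial (Option (Fin n ⊕ Fin n)) k := fun i => X (some (.inr i))
  let xy : Fin n → Fin n → MvPolynomial (Option (Fin n ⊕ Fin n)) k := fun i j =>
    if i < j then C (p j + Γ j i) * x i * y j
    else if j < i then C (q j + Γ j i) * x i * y j
    else C (q i) * x i * y i + (∑ l with l < i, C (q l - p l) * x l * y l) + C lam * z ^ 2
  fun
  | none, none => 0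
  | none, some (.inl i) => C (-(p i / 2)) * z * x i
  | none, some (.inr i) => C (p i / 2) * z * y i
  | some (.inl i), none => -(C (-(p i / 2)) * z * x i)
  | some (.inr i), none => -(C (p i / 2) * z * y i)
  | some (.inr i), some (.inr j) => C (Γ i j) * y i * y j
  | some (.inl i), some (.inr j) => xy i j
  | some (.inr j), some (.inl i) => -xy i j
  | some (.inl i), some (.inl j) =>
    skewExtend (· < ·) (fun i j => C (q i - p j + Γ i j) * x i * x j) i j

theorem oddGen_self {n : ℕ} {Γ : Matrix (Fin n) (Fin n) k} (hΓ : Γ.transpose = -Γ)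
    (p q : Fin n → k) (lam : k) (a : Option (Fin n ⊕ Fin n)) : oddGen Γ p q lam a a = 0 := by
  rcases a with _ | i | i
  · rfl
  · simp only [oddGen]
    exact skewExtend_self (G := MvPolynomial _ k) (fun i j : Fin n => i < j) (fun _ _ => lt_asymm) _ i
  · simp [oddGen, diag_zero hΓ]

theorem oddGen_skew {k : Type*} [Field k] {n : ℕ} {Γ : Matrix (Fin n) (Fin n) k} (hΓ : Γ.transpose = -Γ)
    (p q : Fin n → k) (lam : k) (a b : Option (Fin n ⊕ Fin n)) :
    oddGen Γ p q lam a b = -oddGen Γ p q lam b a := by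
  rcases a with _ | i | i <;> rcases b with _ | j | j
  · exact neg_zero.symm
  · exact (neg_neg _).symm
  · exact (neg_neg _).symm
  · rfl
  · simp only [oddGen]
    exact skewExtend_skew (G := MvPolynomial _ k) (fun i j : Fin n => i < j) (fun _ _ => lt_asymm) _ i j
  · exact (neg_neg _).symm
  · rfl
  · rfl
  · simp only [oddGen, skew_apply hΓ i j, map_neg]
    ring

theorem oddGen_jac {n : ℕ} {Γ : Matrix (Fin n) (Fin n) k} (hΓ : Γ.transpose = -Γ)
    (p q : Fin n → k) (lam : k) (a b c : Option (Fin n ⊕ Fin n)) :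
    jac (polyBider (oddGen Γ p q lam)) (X a) (X b) (X c) = 0 := by
  have mem : ∀ a : Option (Fin n ⊕ Fin n),
      (X a : MvPolynomial (Option (Fin n ⊕ Fin n)) k) = X none ∨
      (X a : MvPolynomial (Option (Fin n ⊕ Fin n)) k) ∈ Set.range
        (fun i : Fin n => (X (some (.inl i)) : MvPolynomial (Option (Fin n ⊕ Fin n)) k)) ∨
      (X a : MvPolynomial (Option (Fin n ⊕ Fin n)) k) ∈ Set.range
        (fun i : Fin n => (X (some (.inr i)) : MvPolynomial (Option (Fin n ⊕ Fin n)) k)) := by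
    rintro (_ | i | i)
    · exact .inl rfl
    · exact .inr (.inl ⟨i, rfl⟩)
    · exact .inr (.inr ⟨i, rfl⟩)
  refine euclid_jac (polyBider (oddGen Γ p q lam))
    (polyBider_alt _ (oddGen_self hΓ p q lam) (oddGen_skew hΓ p q lam)) Γ hΓ p q lam
    (fun i => X (some (.inl i))) (fun i => X (some (.inr i))) (X none) ?_ ?_ ?_ ?_ ?_ ?_ ?_ _ _ _
    (mem a) (mem b) (mem c)
  · intro i; rw [polyBider_X]; rfl
  · intro i; rw [polyBider_X]; rfl
  · intro i j; rw [polyBider_X]; rfl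
  · intro i j h; rw [polyBider_X]; simp [oddGen, h]
  · intro i j h; rw [polyBider_X]; simp [oddGen, h, h.not_gt]
  · intro i j h; rw [polyBider_X]; simp [oddGen, skewExtend, h]
  · intro i; rw [polyBider_X]; simp [oddGen]

/-- The Poisson algebra `O(M_n(k))`, semiclassical limit of multiparameter quantum matrices. -/
noncomputable def matrices {n : ℕ} (lam : k) (p : Matrix (Fin n) (Fin n) k)
    (hp : p.transpose = -p) : PoissonBracket k (MvPolynomial (Fin n × Fin n) k) :=
  poly k (matricesGen lam p) (matricesGen_self lam p) (matricesGen_skew lam p)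
    (matricesGen_jac lam p hp)

/-- The Poisson algebra `A^{P,Q}_{n,Γ}(k)` on `k[x_1, y_1, …, x_n, y_n]`, semiclassical limit of
quantum symplectic and even-dimensional euclidean spaces. -/
noncomputable def evenEuclidean {n : ℕ} (Γ : Matrix (Fin n) (Fin n) k) (hΓ : Γ.transpose = -Γ)
    (p q : Fin n → k) : PoissonBracket k (MvPolynomial (Fin n ⊕ Fin n) k) :=
  poly k (evenGen Γ p q) (evenGen_self hΓ p q) (evenGen_skew hΓ p q) (evenGen_jac hΓ p q)

/-- The Poisson algebra on `k[z_0, x_1, y_1, …, x_n, y_n]`, semiclassical limit of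
odd-dimensional quantum euclidean spaces. -/
noncomputable def oddEuclidean {n : ℕ} (Γ : Matrix (Fin n) (Fin n) k) (hΓ : Γ.transpose = -Γ)
    (p q : Fin n → k) (lam : k) : PoissonBracket k (MvPolynomial (Option (Fin n ⊕ Fin n)) k) :=
  poly k (oddGen Γ p q lam) (oddGen_self hΓ p q lam) (oddGen_skew hΓ p q lam)
    (oddGen_jac hΓ p q lam)

/-- The Poisson algebra on `k[y_{ij} : i ≤ j]`, semiclassical limit of quantum symmetric
matrices. -/
noncomputable def symmetric (k : Type*) [Field k] [CharZero k] (n : ℕ) :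
    PoissonBracket k (MvPolynomial {a : Fin n × Fin n // a.1 ≤ a.2} k) :=
  poly k (symGen k n) (fun a => self_eq_neg.mp (symGen_skew k a a)) (symGen_skew k) (symGen_jac k)

/-- The Poisson algebra on `k[y_{ij} : i < j]`, semiclassical limit of quantum antisymmetric
matrices. -/
noncomputable def antisymmetric (k : Type*) [Field k] [CharZero k] (n : ℕ) :
    PoissonBracket k (MvPolynomial {a : Fin n × Fin n // a.1 < a.2} k) :=
  poly k (altGen k n) (fun a => self_eq_neg.mp (altGen_skew k a a)) (altGen_skew k) (altGen_jac k)

/-! The antisymmetric matrices `Λ` of the quadratic Poisson fields isomorphic to `Fract A`: the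
entry at `(s, t)` is the scalar with `{Y_s, Y_t} = Λ_{st} Y_s Y_t`. -/

def matricesField {n : ℕ} (lam : k) (p : Matrix (Fin n) (Fin n) k) :
    Matrix (Fin n × Fin n) (Fin n × Fin n) k :=
  Matrix.of <| skewExtend (fun a b => LexLT b a) fun (l, m) (i, j) =>
    if i ≤ l ∧ j < m then p l i + p j m else lam + p l i + p j m

theorem matricesField_skew {k : Type*} [Field k] {n : ℕ} (lam : k) (p : Matrix (Fin n) (Fin n) k) :
    (matricesField lam p).transpose = -matricesField lam p := by
  ext a b
  simp only [matricesField, Matrix.transpose_apply, Matrix.neg_apply, Matrix.of_apply]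
  exact skewExtend_skew (G := k) _ (fun a b h => LexLT.asymm b a h) _ b a

def evenField {n : ℕ} (Γ : Matrix (Fin n) (Fin n) k) (p q : Fin n → k) :
    Matrix (Fin n ⊕ Fin n) (Fin n ⊕ Fin n) k :=
  let vw : Fin n → Fin n → k := fun i j => if i < j then p j + Γ j i else q j + Γ j i
  Matrix.of fun
  | .inr i, .inr j => Γ i j
  | .inl i, .inr j => vw i j
  | .inr j, .inl i => -vw i j
  | .inl i, .inl j => skewExtend (· < ·) (fun i j => q i - p j + Γ i j) i j

theorem evenField_skew {k : Type*} [Field k] {n : ℕ} {Γ : Matrix (Fin n) (Fin n) k} (hΓ : Γ.transpose = -Γ)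
    (p q : Fin n → k) : (evenField Γ p q).transpose = -evenField Γ p q := by
  ext a b
  rcases a with i | i <;> rcases b with j | j
  · simp only [evenField, Matrix.transpose_apply, Matrix.neg_apply, Matrix.of_apply]
    exact skewExtend_skew (G := k) (fun i j : Fin n => i < j) (fun _ _ => lt_asymm) _ j i
  · rfl
  · exact (neg_neg _).symm
  · exact skew_apply hΓ j i

def oddField {n : ℕ} (Γ : Matrix (Fin n) (Fin n) k) (p q : Fin n → k) :
    Matrix (Option (Fin n ⊕ Fin n)) (Option (Fin n ⊕ Fin n)) k :=
  Matrix.of fun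
  | none, none => 0
  | none, some (.inl i) => -(p i / 2)
  | none, some (.inr i) => p i / 2
  | some (.inl i), none => p i / 2
  | some (.inr i), none => -(p i / 2)
  | some a, some b => evenField Γ p q a b

theorem oddField_skew {k : Type*} [Field k] {n : ℕ} {Γ : Matrix (Fin n) (Fin n) k} (hΓ : Γ.transpose = -Γ)
    (p q : Fin n → k) : (oddField Γ p q).transpose = -oddField Γ p q := by
  ext a b
  rcases a with _ | a <;> rcases b with _ | b
  · exact neg_zero.symm
  · rcases b with i | i
    · exact (neg_neg _).symm
    · rfl
  · rcases a with i | i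
    · rfl
    · exact (neg_neg _).symm
  · have := skew_apply (evenField_skew hΓ p q) b a
    rcases a with i | i <;> rcases b with j | j <;> exact this

def symmetricField (k : Type*) [Field k] (n : ℕ) :
    Matrix {a : Fin n × Fin n // a.1 ≤ a.2} {a : Fin n × Fin n // a.1 ≤ a.2} k :=
  Matrix.of <| skewExtend (fun a b => LexLT a.1 b.1) fun ⟨(i, j), _⟩ ⟨(l, m), _⟩ =>
    if (i = l ∧ l < j ∧ j < m) ∨ (i < l ∧ l < j ∧ j = m) ∨ (i < j ∧ j = l ∧ l < m) then 1
    else if (i = j ∧ j = l ∧ l < m) ∨ (i < j ∧ j = l ∧ l = m) then 2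
    else 0

theorem symmetricField_skew (k : Type*) [Field k] (n : ℕ) :
    (symmetricField k n).transpose = -symmetricField k n := by
  ext a b
  simp only [symmetricField, Matrix.transpose_apply, Matrix.neg_apply, Matrix.of_apply]
  exact skewExtend_skew (G := k) _ (fun a b h => LexLT.asymm a.1 b.1 h) _ b a

def antisymmetricField (k : Type*) [Field k] (n : ℕ) :
    Matrix {a : Fin n × Fin n // a.1 < a.2} {a : Fin n × Fin n // a.1 < a.2} k :=
  Matrix.of <| skewExtend (fun a b => LexLT a.1 b.1) fun ⟨(i, j), _⟩ ⟨(l, m), _⟩ =>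
    if (({i, j} : Finset (Fin n)) ∩ {l, m}).card = 1 then 1 else 0

theorem antisymmetricField_skew (k : Type*) [Field k] (n : ℕ) :
    (antisymmetricField k n).transpose = -antisymmetricField k n := by
  ext a b
  simp only [antisymmetricField, Matrix.transpose_apply, Matrix.neg_apply, Matrix.of_apply]
  exact skewExtend_skew (G := k) _ (fun a b h => LexLT.asymm a.1 b.1 h) _ b a

end Families

/-- Isomorphism of Poisson `k`-algebras. -/
def Isomorphic {k A B : Type*} [CommRing k] [CommRing A] [CommRing B] [Algebra k A] [Algebra k B]
    (π : PoissonBracket k A) (ρ : PoissonBracket k B) : Prop :=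
  ∃ e : A ≃ₐ[k] B, ∀ a b, e (π.bracket a b) = ρ.bracket (e a) (e b)

theorem isPoissonIdeal_bot {k A : Type*} [CommRing k] [CommRing A] [Algebra k A]
    (π : PoissonBracket k A) : π.IsPoissonIdeal ⊥ := by
  intro a b hb
  rw [Ideal.mem_bot] at hb ⊢
  rw [hb, map_zero]

/-- For every Poisson prime `P` of `A`, the Poisson field `Fract (A/P)` is isomorphic to
`K_μ(y_1, …, y_m)` for some field extension `K` of `k` and some antisymmetric `μ` over `k`; for
`P = 0` this holds with `K = k` and `m = tr.deg A`; and `Fract A` is isomorphic to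
`k_Λ(y_s : s ∈ σ)`. -/
def QuadraticGelfandKirillov {k A : Type u} [Field k] [CharZero k] [CommRing A] [Algebra k A]
    (π : PoissonBracket k A) {σ : Type} (Λ : Matrix σ σ k) (hΛ : Λ.transpose = -Λ) : Prop :=
  (∀ (P : Ideal A) (_ : P.IsPrime) (hP : π.IsPoissonIdeal P),
    ∃ (K : Type u) (_ : Field K) (_ : Algebra k K) (m : ℕ) (μ : Matrix (Fin m) (Fin m) k)
      (hμ : μ.transpose = -μ),
      Isomorphic (π.quotient P hP).fraction (quadratic K μ hμ).fraction) ∧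
  (∃ (m : ℕ) (μ : Matrix (Fin m) (Fin m) k) (hμ : μ.transpose = -μ),
    Algebra.trdeg k A = m ∧
    Isomorphic (π.quotient ⊥ π.isPoissonIdeal_bot).fraction (quadratic k μ hμ).fraction) ∧
  Isomorphic π.fraction (quadratic k Λ hΛ).fraction

end PoissonBracket

/-!
Order the indeterminates so that `{X_t, f} = α(f) X_t + δ(f)` for polynomials `f` in the earlier
ones, where `α` is diagonal on the indeterminates, `δ` is a locally nilpotent derivation, and
`α δ - δ α = s δ` with `s ≠ 0` unless `δ = 0`. In a Poisson field where the image `x` of `X_t` is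
nonzero, the map `f ↦ ∑ l, y ^ l δ ^ l(f) / l!` with `y = -(s x)⁻¹` is again a Poisson
homomorphism on the earlier indeterminates, and it satisfies `{x, f} = α(f) x`: the derivation `δ`
is deleted. If `x = 0`, then `δ(f)` is already mapped to `0`. Deleting the derivations from the
last indeterminate down to the first gives log-canonical generators of `Fract A / P` with a matrix
`Λ` independent of `P`. For `P = 0` they are algebraically independent by their number.

For general `P`, drop the generators that vanish. A Laurent monomial `m` in the others satisfies
`{y_i, m} = c_i y_i m`, and its weight `(c_i)` depends additively on the exponent; the weights
form a free abelian group of finite rank. Monomials of weight `0` lie in the Poisson centre `K`,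
so monomials lifting a basis of this group generate `Fract A / P` over `K`, and they are
algebraically independent over `K` because monomials of distinct weights are simultaneous
eigenvectors with distinct eigenvalues.
-/

namespace PoissonBracket

section Basic

variable {k A : Type*} [CommRing k] [CommRing A] [Algebra k A]

theorem bracket_mul_left (π : PoissonBracket k A) (a b c : A) :
    π.bracket (a * b) c = a * π.bracket b c + b * π.bracket a c := by
  rw [π.skew, π.leibniz, π.skew c a, π.skew c b]
  ring

theorem bracket_algebraMap_right (π : PoissonBracket k A) (a : A) (c : k) :
    π.bracket a (algebraMap k A c) = 0 :=
  (π.toBiderivation a).map_algebraMap c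

theorem bracket_algebraMap_left (π : PoissonBracket k A) (a : A) (c : k) :
    π.bracket (algebraMap k A c) a = 0 := by
  rw [π.skew, bracket_algebraMap_right, neg_zero]

theorem bracket_bracket (π : PoissonBracket k A) (a b c : A) :
    π.bracket a (π.bracket b c) = π.bracket (π.bracket a b) c + π.bracket b (π.bracket a c) := by
  have h := π.jacobi a b c
  rw [π.skew c a, map_neg, π.skew c (π.bracket a b)] at h
  linear_combination h

end Basic

theorem adjoin_image_algebraMap_eq_top {k B F : Type*} [Field k] [CommRing B] [Field F]
    [Algebra k B] [Algebra k F] [Algebra B F] [IsScalarTower k B F] [IsFractionRing B F]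
    {S : Set B} (hS : Algebra.adjoin k S = ⊤) :
    IntermediateField.adjoin k (algebraMap B F '' S) = ⊤ := by
  set E := IntermediateField.adjoin k (algebraMap B F '' S)
  have hB : Algebra.adjoin k S ≤ E.toSubalgebra.comap (IsScalarTower.toAlgHom k B F) :=
    Algebra.adjoin_le fun b hb => IntermediateField.subset_adjoin _ _ ⟨b, hb, rfl⟩
  refine eq_top_iff.mpr fun f _ => ?_
  obtain ⟨a, b, -, rfl⟩ := IsFractionRing.div_surjective B f
  exact div_mem (hB (hS ▸ Algebra.mem_top)) (hB (hS ▸ Algebra.mem_top))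

section Field

variable {k F : Type*} [Field k] [Field F] [Algebra k F]

theorem bracket_inv_right (π : PoissonBracket k F) (a b : F) :
    π.bracket a b⁻¹ = -(b⁻¹ ^ 2 * π.bracket a b) := by
  simpa using (π.toBiderivation a).leibniz_inv b

/-- The subfield of the elements of a Poisson field that Poisson commute with all elements of `S`;
for `S = Set.univ` it is the Poisson centre. -/
def centralizer (π : PoissonBracket k F) (S : Set F) : IntermediateField k F where
  carrier := {f | ∀ a ∈ S, π.bracket a f = 0}
  mul_mem' hf hg a ha := by rw [π.leibniz, hf a ha, hg a ha, zero_mul, mul_zero, add_zero]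
  add_mem' hf hg a ha := by rw [map_add, hf a ha, hg a ha, add_zero]
  algebraMap_mem' c a _ := π.bracket_algebraMap_right a c
  inv_mem' f hf a ha := by rw [bracket_inv_right, hf a ha, mul_zero, neg_zero]

theorem mem_centralizer {π : PoissonBracket k F} {S : Set F} {f : F} :
    f ∈ π.centralizer S ↔ ∀ a ∈ S, π.bracket a f = 0 := Iff.rfl

theorem centralizer_univ_of_adjoin_eq_top (π : PoissonBracket k F) {S : Set F}
    (hS : IntermediateField.adjoin k S = ⊤) : π.centralizer Set.univ = π.centralizer S := by
  refine le_antisymm (fun f hf a _ => hf a (Set.mem_univ a)) fun f hf a _ => ?_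
  have h : IntermediateField.adjoin k S ≤ π.centralizer {f} := by
    rw [IntermediateField.adjoin_le_iff]
    rintro a ha _ rfl
    rw [skew, hf a ha, neg_zero]
  have ha : π.bracket f a = 0 := h (hS ▸ IntermediateField.mem_top) f rfl
  rw [skew, ha, neg_zero]

theorem bracket_algebraMap_center (π : PoissonBracket k F) (c : π.centralizer Set.univ) (f : F) :
    π.bracket (algebraMap _ F c) f = 0 := by
  rw [skew, show π.bracket f (algebraMap _ F c) = 0 from c.2 f (Set.mem_univ f), neg_zero]

theorem map_bracket_of_adjoin_eq_top {L : Type*} [Field L] [Algebra k L] (π : PoissonBracket k F)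
    (ρ : PoissonBracket k L) (e : F →ₐ[k] L) {S : Set F}
    (hS : IntermediateField.adjoin k S = ⊤)
    (h : ∀ a ∈ S, ∀ b ∈ S, e (π.bracket a b) = ρ.bracket (e a) (e b)) (a b : F) :
    e (π.bracket a b) = ρ.bracket (e a) (e b) := by
  have ext : ∀ a, (∀ b ∈ S, e (π.bracket a b) = ρ.bracket (e a) (e b)) →
      ∀ b, e (π.bracket a b) = ρ.bracket (e a) (e b) := by
    intro a ha b
    have hb : b ∈ IntermediateField.adjoin k S := hS ▸ IntermediateField.mem_top
    induction hb using IntermediateField.adjoin_induction with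
    | mem x hx => exact ha x hx
    | algebraMap x => rw [bracket_algebraMap_right, map_zero, e.commutes, bracket_algebraMap_right]
    | add x y _ _ hx hy => simp only [map_add, hx, hy]
    | inv x _ hx => simp only [bracket_inv_right, map_neg, map_mul, map_pow, map_inv₀, hx]
    | mul x y _ _ hx hy => simp only [π.leibniz, ρ.leibniz, map_add, map_mul, hx, hy]
  refine ext a (fun b hb => ?_) b
  rw [π.skew, ρ.skew, map_neg, ext b (h b hb) a]

end Field

section LogCanonical

variable {k A ι : Type*} [Field k]

/-- The family `y` is log-canonical with matrix `Λ` if `{y_i, y_j} = Λ_{ij} y_i y_j`. -/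
def IsLogCanonical [CommRing A] [Algebra k A] (π : PoissonBracket k A) (Λ : Matrix ι ι k)
    (y : ι → A) : Prop :=
  ∀ i j, π.bracket (y i) (y j) = algebraMap k A (Λ i j) * y i * y j

theorem IsLogCanonical.comp [CommRing A] [Algebra k A] {π : PoissonBracket k A}
    {Λ : Matrix ι ι k} {y : ι → A} (h : IsLogCanonical π Λ y) {κ : Type*} (e : κ → ι) :
    IsLogCanonical π (Λ.submatrix e e) (y ∘ e) :=
  fun i j => h (e i) (e j)

theorem IsLogCanonical.transpose_eq_neg [CommRing A] [IsDomain A] [Algebra k A]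
    {π : PoissonBracket k A} {Λ : Matrix ι ι k} {y : ι → A} (h : IsLogCanonical π Λ y)
    (hy : ∀ i, y i ≠ 0) : Λ.transpose = -Λ := by
  ext i j
  have hskew := π.skew (y j) (y i)
  rw [h j i, h i j] at hskew
  refine (algebraMap k A).injective (mul_right_cancel₀ (mul_ne_zero (hy i) (hy j)) ?_)
  rw [Matrix.transpose_apply, Matrix.neg_apply, map_neg]
  linear_combination hskew

end LogCanonical

section QuadraticField

variable {k : Type*} [Field k] [CharZero k] (K : Type*) [Field K] [Algebra k K] {σ : Type*}
  (μ : Matrix σ σ k) (hμ : μ.transpose = -μ)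

theorem quadratic_X (s t : σ) :
    (quadratic K μ hμ).bracket (X s) (X t) = C (algebraMap k K (μ s t)) * X s * X t :=
  poly_X _ _ _ _ _ s t

theorem quadratic_C_left (c : K) (f : MvPolynomial σ K) :
    (quadratic K μ hμ).bracket (C c) f = 0 := by
  change polyBider _ (C c) f = 0
  rw [MvPolynomial.derivation_C, Derivation.zero_apply]

theorem quadratic_C_right (c : K) (f : MvPolynomial σ K) :
    (quadratic K μ hμ).bracket f (C c) = 0 := by
  rw [skew, quadratic_C_left, neg_zero]

theorem adjoin_range_C_union_range_X (k : Type*) [Field k] (K : Type*) [Field K] [Algebra k K]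
    (σ : Type*) : Algebra.adjoin k (Set.range C ∪ Set.range X : Set (MvPolynomial σ K)) = ⊤ := by
  refine eq_top_iff.mpr fun p _ => ?_
  induction p using MvPolynomial.induction_on with
  | C a => exact Algebra.subset_adjoin (.inl ⟨a, rfl⟩)
  | add p q hp hq => exact add_mem (hp trivial) (hq trivial)
  | mul_X p s hp => exact mul_mem (hp trivial) (Algebra.subset_adjoin (.inr ⟨s, rfl⟩))

theorem isomorphic_quadratic {F : Type*} [Field F] [Algebra k F] (ρ : PoissonBracket k F)
    [Algebra K F] [IsScalarTower k K F] (z : σ → F)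
    (hz : AlgebraicIndependent K z) (htop : IntermediateField.adjoin K (Set.range z) = ⊤)
    (hK : ∀ (c : K) (f : F), ρ.bracket (algebraMap K F c) f = 0) (hlog : IsLogCanonical ρ μ z) :
    Isomorphic ρ (quadratic K μ hμ).fraction := by
  let e : FractionRing (MvPolynomial σ K) ≃ₐ[k] F :=
    (hz.aevalEquivField.trans
      ((IntermediateField.equivOfEq htop).trans IntermediateField.topEquiv)).restrictScalars k
  have he : ∀ p, (e : FractionRing (MvPolynomial σ K) →ₐ[k] F) (algebraMap _ _ p) = aeval z p :=
    hz.aevalEquivField_algebraMap_apply_coe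
  have hK' : ∀ (c : K) (f : F), ρ.bracket f (algebraMap K F c) = 0 := fun c f => by
    rw [skew, hK, neg_zero]
  have hbracket : ∀ a b, e ((quadratic K μ hμ).fraction.bracket a b) = ρ.bracket (e a) (e b) := by
    refine map_bracket_of_adjoin_eq_top _ ρ (e : FractionRing (MvPolynomial σ K) →ₐ[k] F)
      (adjoin_image_algebraMap_eq_top (adjoin_range_C_union_range_X k K σ)) ?_
    rintro _ ⟨_, ⟨c, rfl⟩ | ⟨s, rfl⟩, rfl⟩ _ ⟨_, ⟨d, rfl⟩ | ⟨t, rfl⟩, rfl⟩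
    all_goals
      simp only [fraction_algebraMap, he, quadratic_C_left, quadratic_C_right, quadratic_X,
        hlog _ _, map_zero, map_mul, aeval_C, aeval_X, hK, hK', ← IsScalarTower.algebraMap_apply]
  exact ⟨e.symm, fun a b => by
    rw [AlgEquiv.symm_apply_eq, hbracket, e.apply_symm_apply, e.apply_symm_apply]⟩

end QuadraticField

section LogCanonicalField

theorem linearIndependent_of_joint_eigenvectors {K V ι J : Type*} [Field K] [AddCommGroup V]
    [Module K V] (f : J → V →ₗ[K] V) {χ : ι → J → K} (hχ : Function.Injective χ) {v : ι → V}
    (hv : ∀ i, v i ≠ 0) (hf : ∀ i j, f j (v i) = χ i j • v i) : LinearIndependent K v := by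
  classical
  rw [linearIndependent_iff']
  intro s
  induction s using Finset.induction_on with
  | empty => simp
  | insert i s his ih =>
    intro g hg
    have hs : ∀ l ∈ s, g l = 0 := by
      intro l hl
      obtain ⟨j, hj⟩ := Function.ne_iff.mp (hχ.ne (ne_of_mem_of_not_mem hl his))
      have hsum : ∑ l ∈ s, (g l * (χ l j - χ i j)) • v l = 0 := by
        have := congrArg (f j - χ i j • (LinearMap.id : V →ₗ[K] V)) hg
        simpa [Finset.sum_insert his, hf, mul_sub, sub_smul, smul_smul, mul_comm (χ i j),
          smul_sub, Finset.smul_sum, sub_eq_zero] using this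
      exact (mul_eq_zero.mp (ih _ hsum l hl)).resolve_right (sub_ne_zero.mpr hj)
    rw [Finset.sum_insert his, Finset.sum_eq_zero fun l hl => by rw [hs l hl, zero_smul],
      add_zero] at hg
    exact Finset.forall_mem_insert _ _ _ |>.mpr ⟨(smul_eq_zero.mp hg).resolve_right (hv i), hs⟩

theorem algebraicIndependent_of_linearIndependent_monomials {R A ι : Type*} [CommRing R]
    [CommRing A] [Algebra R A] {z : ι → A}
    (h : LinearIndependent R fun d : ι →₀ ℕ => d.prod fun i n => z i ^ n) :
    AlgebraicIndependent R z := by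
  have hz : (aeval z : MvPolynomial ι R →ₐ[R] A).toLinearMap =
      Finsupp.linearCombination R (fun d : ι →₀ ℕ => d.prod fun i n => z i ^ n) ∘ₗ
        (basisMonomials ι R).repr.toLinearMap :=
    (basisMonomials ι R).ext fun d => by
      rw [LinearMap.comp_apply, LinearEquiv.coe_coe, Module.Basis.repr_self,
        Finsupp.linearCombination_single]
      simp [aeval_monomial]
  rw [algebraicIndependent_iff_injective_aeval]
  change Function.Injective (aeval z : MvPolynomial ι R →ₐ[R] A).toLinearMap
  rw [hz, LinearMap.coe_comp]
  exact Function.Injective.comp h (basisMonomials ι R).repr.injective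

theorem exists_linearIndependent_lift_range {R M N : Type*} [CommRing R] [IsDomain R]
    [IsPrincipalIdealRing R] [AddCommGroup M] [Module R M] [Module.Finite R M] [AddCommGroup N]
    [Module R N] [Module.IsTorsionFree R N] (Φ : M →ₗ[R] N) :
    ∃ (m : ℕ) (c : Fin m → M), LinearIndependent R (Φ ∘ c) ∧
      ∀ a, ∃ d : Fin m → R, Φ (a - ∑ j, d j • c j) = 0 := by
  let b := Module.finBasis R (LinearMap.range Φ)
  choose c hc using fun j => (b j).2
  have hΦc : Φ ∘ c = (LinearMap.range Φ).subtype ∘ b := funext hc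
  refine ⟨_, c, ?_, fun a => ⟨b.repr ⟨Φ a, a, rfl⟩, ?_⟩⟩
  · rw [hΦc]
    exact b.linearIndependent.map' _ (Submodule.ker_subtype _)
  · have hsum := congrArg (LinearMap.range Φ).subtype (b.sum_repr ⟨Φ a, a, rfl⟩)
    simp only [map_sum, map_smul, Submodule.subtype_apply] at hsum
    simp only [map_sub, map_sum, map_smul, hc, hsum, sub_self]

/-- The Laurent monomial `∏ i, y i ^ a i`. -/
def laurentMonomial {F ι : Type*} [Field F] [Fintype ι] (y : ι → F) (a : ι → ℤ) : F :=
  ∏ i, y i ^ a i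

section LaurentMonomial

variable {F ι : Type*} [Field F] [Fintype ι] {y : ι → F} (hy : ∀ i, y i ≠ 0)

theorem laurentMonomial_single [DecidableEq ι] (y : ι → F) (i : ι) :
    laurentMonomial y (Pi.single i 1) = y i := by
  rw [laurentMonomial, Finset.prod_eq_single i (fun j _ hj => by simp [hj]) (by simp)]
  simp

include hy

theorem laurentMonomial_ne_zero (a : ι → ℤ) : laurentMonomial y a ≠ 0 :=
  Finset.prod_ne_zero_iff.mpr fun i _ => zpow_ne_zero _ (hy i)

theorem laurentMonomial_add (a b : ι → ℤ) :
    laurentMonomial y (a + b) = laurentMonomial y a * laurentMonomial y b := by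
  simp only [laurentMonomial, Pi.add_apply, zpow_add₀ (hy _), Finset.prod_mul_distrib]

theorem laurentMonomial_sum_zsmul {κ : Type*} (s : Finset κ) (d : κ → ℤ) (c : κ → ι → ℤ) :
    laurentMonomial y (∑ j ∈ s, d j • c j) = ∏ j ∈ s, laurentMonomial y (c j) ^ d j := by
  classical
  induction s using Finset.induction_on with
  | empty => simp [laurentMonomial]
  | insert j s hj ih =>
    rw [Finset.sum_insert hj, Finset.prod_insert hj, laurentMonomial_add hy, ih]
    simp only [laurentMonomial, Pi.smul_apply, smul_eq_mul, mul_comm (d j), zpow_mul,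
      Finset.prod_zpow]

theorem derivation_laurentMonomial {k : Type*} [CommRing k] [Algebra k F] (D : Derivation k F F)
    {c : ι → F} (hc : ∀ i, D (y i) = c i * y i) (a : ι → ℤ) :
    D (laurentMonomial y a) = (∑ i, a i * c i) * laurentMonomial y a := by
  classical
  rw [laurentMonomial]
  induction (Finset.univ : Finset ι) using Finset.induction_on with
  | empty => simp
  | insert i s his ih =>
    have hDi : D (y i ^ a i) = a i * c i * y i ^ a i := by
      rw [Derivation.leibniz_zpow, hc, zpow_sub_one₀ (hy i), zsmul_eq_mul, smul_eq_mul]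
      field_simp [hy i]
    rw [Finset.prod_insert his, Finset.sum_insert his, Derivation.leibniz, ih, hDi]
    simp only [smul_eq_mul]
    ring

end LaurentMonomial

/-- The weight of the Laurent monomial with exponent `a` in a family `y` which is log-canonical
with matrix `Λ`: the family of the eigenvalues of the derivations `{y_i, -} / y_i` on it. -/
def weight {k ι : Type*} [Ring k] [Fintype ι] (Λ : Matrix ι ι k) : (ι → ℤ) →ₗ[ℤ] ι → k :=
  Fintype.linearCombination ℤ fun j i => Λ i j

theorem weight_apply {k ι : Type*} [Ring k] [Fintype ι] (Λ : Matrix ι ι k) (a : ι → ℤ) (i : ι) :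
    weight Λ a i = ∑ j, (a j : k) * Λ i j := by
  simp [weight, Fintype.linearCombination_apply, Finset.sum_apply]

namespace IsLogCanonical

variable {k F ι : Type*} [Field k] [Field F] [Algebra k F] [Fintype ι] {ρ : PoissonBracket k F}
  {Λ : Matrix ι ι k} {y : ι → F} (h : IsLogCanonical ρ Λ y) (hy : ∀ i, y i ≠ 0)

include h hy

theorem bracket_laurentMonomial (i : ι) (a : ι → ℤ) :
    ρ.bracket (y i) (laurentMonomial y a) =
      algebraMap k F (weight Λ a i) * y i * laurentMonomial y a := by
  have := derivation_laurentMonomial hy (ρ.toBiderivation (y i)) (h i) a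
  rw [toBiderivation_apply] at this
  rw [this, weight_apply, map_sum]
  simp only [Finset.sum_mul, map_mul, map_intCast, mul_assoc]

theorem isLogCanonical_laurentMonomial {κ : Type*} (c : κ → ι → ℤ) :
    IsLogCanonical ρ (Matrix.of fun s t => ∑ i, (c s i : k) * weight Λ (c t) i)
      fun j => laurentMonomial y (c j) := by
  intro s t
  have := derivation_laurentMonomial hy (ρ.toBiderivation (laurentMonomial y (c t)))
    (c := fun i => -(algebraMap k F (weight Λ (c t) i) * laurentMonomial y (c t)))
    (fun i => by rw [toBiderivation_apply, skew, h.bracket_laurentMonomial hy]; ring) (c s)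
  rw [toBiderivation_apply] at this
  rw [skew, this, Matrix.of_apply, map_sum, ← neg_mul, ← Finset.sum_neg_distrib]
  simp only [Finset.sum_mul, map_mul, map_intCast]
  exact Finset.sum_congr rfl fun i _ => by ring

theorem laurentMonomial_mem_center (htop : IntermediateField.adjoin k (Set.range y) = ⊤)
    {a : ι → ℤ} (ha : weight Λ a = 0) :
    laurentMonomial y a ∈ ρ.centralizer Set.univ := by
  rw [centralizer_univ_of_adjoin_eq_top ρ htop, mem_centralizer]
  rintro _ ⟨i, rfl⟩
  rw [h.bracket_laurentMonomial hy, ha, Pi.zero_apply, map_zero, zero_mul, zero_mul]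

/-- Over the Poisson centre, Laurent monomials of distinct weights are eigenvectors of the
derivations `{y_i, -} / y_i` with distinct eigenvalues. -/
theorem algebraicIndependent_laurentMonomial {κ : Type*} {c : κ → ι → ℤ}
    (hc : LinearIndependent ℤ (weight Λ ∘ c)) :
    AlgebraicIndependent (ρ.centralizer Set.univ)
      fun j => laurentMonomial y (c j) := by
  set K := ρ.centralizer Set.univ
  let D (i : ι) : F →ₗ[K] F :=
    { toFun := fun f => (y i)⁻¹ * ρ.bracket (y i) f
      map_add' := fun f g => by rw [map_add, mul_add]
      map_smul' := fun x f => by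
        rw [Algebra.smul_def, leibniz, skew _ _ (algebraMap K F x), bracket_algebraMap_center,
          RingHom.id_apply, Algebra.smul_def]
        ring }
  let exponent (d : κ →₀ ℕ) : ι → ℤ :=
    Finsupp.linearCombination ℤ c (d.mapRange Nat.cast Nat.cast_zero)
  have hmon (d : κ →₀ ℕ) : (d.prod fun j n => laurentMonomial y (c j) ^ n) =
      laurentMonomial y (exponent d) := by
    simp only [exponent]
    rw [Finsupp.linearCombination_apply, Finsupp.sum_mapRange_index fun j => zero_smul ℤ (c j),
      Finsupp.sum, laurentMonomial_sum_zsmul hy]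
    simp only [zpow_natCast, Finsupp.prod]
  have hinj : Function.Injective fun d i => algebraMap k K (weight Λ (exponent d) i) := by
    intro d d' hdd'
    have hweight : weight Λ (exponent d) = weight Λ (exponent d') :=
      funext fun i => (algebraMap k K).injective (congrFun hdd' i)
    simp only [exponent, Finsupp.apply_linearCombination] at hweight
    exact Finsupp.mapRange_injective _ _ Nat.cast_injective (hc hweight)
  refine algebraicIndependent_of_linearIndependent_monomials
    (linearIndependent_of_joint_eigenvectors D hinj (fun d => ?_) fun d i => ?_)
  · rw [hmon]
    exact laurentMonomial_ne_zero hy _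
  · change (y i)⁻¹ * ρ.bracket (y i) _ = _
    rw [hmon, h.bracket_laurentMonomial hy, Algebra.smul_def, ← IsScalarTower.algebraMap_apply]
    field_simp [hy i]

theorem adjoin_laurentMonomial_eq_top (htop : IntermediateField.adjoin k (Set.range y) = ⊤)
    {κ : Type*} [Fintype κ] {c : κ → ι → ℤ}
    (hc : ∀ a, ∃ d : κ → ℤ, weight Λ (a - ∑ j, d j • c j) = 0) :
    IntermediateField.adjoin (ρ.centralizer Set.univ)
      (Set.range fun j => laurentMonomial y (c j)) = ⊤ := by
  classical
  set K := ρ.centralizer Set.univ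
  set E := IntermediateField.adjoin K (Set.range fun j => laurentMonomial y (c j))
  have hyE (i : ι) : y i ∈ E := by
    obtain ⟨d, hd⟩ := hc (Pi.single i 1)
    rw [← laurentMonomial_single y i, ← sub_add_cancel (Pi.single i 1) (∑ j, d j • c j),
      laurentMonomial_add hy, laurentMonomial_sum_zsmul hy]
    exact mul_mem (E.algebraMap_mem ⟨_, h.laurentMonomial_mem_center hy htop hd⟩)
      (prod_mem fun j _ => zpow_mem (IntermediateField.subset_adjoin _ _ (Set.mem_range_self j)) _)
  have hE : IntermediateField.adjoin k (Set.range y) ≤ E.restrictScalars k :=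
    IntermediateField.adjoin_le_iff.mpr (Set.range_subset_iff.mpr hyE)
  exact eq_top_iff.mpr fun f _ => hE (htop ▸ IntermediateField.mem_top)

end IsLogCanonical

variable {k F : Type u} [Field k] [CharZero k] [Field F] [Algebra k F] {ρ : PoissonBracket k F}
  {ι : Type*} [Finite ι] {Λ : Matrix ι ι k} {y : ι → F}

theorem IsLogCanonical.exists_isomorphic_quadratic_of_ne_zero (h : IsLogCanonical ρ Λ y)
    (hy : ∀ i, y i ≠ 0) (htop : IntermediateField.adjoin k (Set.range y) = ⊤) :
    ∃ (K : Type u) (_ : Field K) (_ : Algebra k K) (m : ℕ) (μ : Matrix (Fin m) (Fin m) k)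
      (hμ : μ.transpose = -μ), Isomorphic ρ (quadratic K μ hμ).fraction := by
  have := Fintype.ofFinite ι
  obtain ⟨m, c, hind, hspan⟩ := exists_linearIndependent_lift_range (weight Λ)
  have hz := h.isLogCanonical_laurentMonomial hy c
  have hμ := hz.transpose_eq_neg fun j => laurentMonomial_ne_zero hy (c j)
  exact ⟨ρ.centralizer Set.univ, inferInstance, inferInstance, m, _, hμ,
    isomorphic_quadratic _ _ hμ ρ _ (h.algebraicIndependent_laurentMonomial hy hind)
      (h.adjoin_laurentMonomial_eq_top hy htop hspan) ρ.bracket_algebraMap_center hz⟩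

theorem IsLogCanonical.exists_isomorphic_quadratic (h : IsLogCanonical ρ Λ y)
    (htop : IntermediateField.adjoin k (Set.range y) = ⊤) :
    ∃ (K : Type u) (_ : Field K) (_ : Algebra k K) (m : ℕ) (μ : Matrix (Fin m) (Fin m) k)
      (hμ : μ.transpose = -μ), Isomorphic ρ (quadratic K μ hμ).fraction := by
  refine (h.comp (Subtype.val : {i // y i ≠ 0} → ι)).exists_isomorphic_quadratic_of_ne_zero
    (fun i => i.2) ?_
  rw [eq_top_iff, ← htop, IntermediateField.adjoin_le_iff]
  rintro _ ⟨i, rfl⟩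
  by_cases hi : y i = 0
  · rw [hi]
    exact zero_mem _
  · exact IntermediateField.subset_adjoin _ _ ⟨⟨i, hi⟩, rfl⟩

end LogCanonicalField

section Reduction

/-- Every Poisson homomorphism from the polynomial algebra `k[X_s]` to a Poisson field takes values
in a subfield generated by a log-canonical family with matrix `Λ`. -/
def HasLogCanonicalImages {k : Type u} [Field k] {σ : Type*}
    (π : PoissonBracket k (MvPolynomial σ k)) (Λ : Matrix σ σ k) : Prop :=
  ∀ (F : Type u) [Field F] [Algebra k F] (ρ : PoissonBracket k F) (φ : MvPolynomial σ k →ₐ[k] F),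
    (∀ a b, φ (π.bracket a b) = ρ.bracket (φ a) (φ b)) →
    ∃ y : σ → F, IsLogCanonical ρ Λ y ∧ ∀ s, φ (X s) ∈ IntermediateField.adjoin k (Set.range y)

namespace HasLogCanonicalImages

variable {k : Type u} [Field k]

section Generators

variable {σ : Type*} {π : PoissonBracket k (MvPolynomial σ k)}
  {Λ : Matrix σ σ k} (h : HasLogCanonicalImages π Λ) {B : Type u} [CommRing B] [IsDomain B]
  [Algebra k B] (ρ : PoissonBracket k B) (g : MvPolynomial σ k →ₐ[k] B)
  (hgb : ∀ a b, g (π.bracket a b) = ρ.bracket (g a) (g b))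

include h hgb

theorem exists_generators (hg : Function.Surjective g) :
    ∃ y : σ → FractionRing B, IsLogCanonical ρ.fraction Λ y ∧
      IntermediateField.adjoin k (Set.range y) = ⊤ := by
  obtain ⟨y, hy, hmem⟩ := h (FractionRing B) ρ.fraction
    ((IsScalarTower.toAlgHom k B (FractionRing B)).comp g) fun a b => by
      simp only [AlgHom.comp_apply, IsScalarTower.toAlgHom_apply, fraction_algebraMap, hgb]
  have hgX : Algebra.adjoin k (g '' Set.range X) = ⊤ := by
    rw [← AlgHom.map_adjoin, adjoin_range_X, Algebra.map_top, (AlgHom.range_eq_top g).mpr hg]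
  refine ⟨y, hy, ?_⟩
  rw [eq_top_iff, ← adjoin_image_algebraMap_eq_top (F := FractionRing B) hgX,
    IntermediateField.adjoin_le_iff]
  rintro _ ⟨_, ⟨_, ⟨s, rfl⟩, rfl⟩, rfl⟩
  exact hmem s

theorem exists_algebraicIndependent_generators [Finite σ] (hg : Function.Bijective g) :
    ∃ y : σ → FractionRing B, IsLogCanonical ρ.fraction Λ y ∧
      IntermediateField.adjoin k (Set.range y) = ⊤ ∧ AlgebraicIndependent k y := by
  obtain ⟨y, hy, htop⟩ := h.exists_generators ρ g hgb hg.2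
  have hX : AlgebraicIndependent k fun s => algebraMap B (FractionRing B) (g (X s)) :=
    (MvPolynomial.algebraicIndependent_X σ k).map'
      (f := (IsScalarTower.toAlgHom k B (FractionRing B)).comp g)
      ((IsFractionRing.injective B (FractionRing B)).comp hg.1)
  have halg : Algebra.IsAlgebraic (Algebra.adjoin k (Set.range y)) (FractionRing B) :=
    ⟨fun f => IntermediateField.isAlgebraic_adjoin_iff.mp (isAlgebraic_algebraMap
      (⟨f, htop ▸ IntermediateField.mem_top⟩ : IntermediateField.adjoin k (Set.range y)))⟩
  exact ⟨y, hy, htop, (Algebra.IsAlgebraic.isTranscendenceBasis_of_lift_le_trdeg_of_finite k y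
    hX.lift_cardinalMk_le_trdeg).1⟩

end Generators

theorem quadraticGelfandKirillov [CharZero k] {σ : Type} [Finite σ]
    {π : PoissonBracket k (MvPolynomial σ k)} {Λ : Matrix σ σ k} (h : HasLogCanonicalImages π Λ)
    (hΛ : Λ.transpose = -Λ) : π.QuadraticGelfandKirillov Λ hΛ := by
  refine ⟨fun P _ hP => ?_, ?_, ?_⟩
  · obtain ⟨y, hy, htop⟩ := h.exists_generators (π.quotient P hP) (Ideal.Quotient.mkₐ k P)
      (fun a b => (π.quotient_mk P hP a b).symm) Ideal.Quotient.mk_surjective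
    exact hy.exists_isomorphic_quadratic htop
  · have : (⊥ : Ideal (MvPolynomial σ k)).IsPrime := Ideal.isPrime_bot
    obtain ⟨y, hy, htop, hind⟩ := h.exists_algebraicIndependent_generators
      (π.quotient ⊥ π.isPoissonIdeal_bot) (Ideal.Quotient.mkₐ k ⊥)
      (fun a b => (π.quotient_mk ⊥ π.isPoissonIdeal_bot a b).symm)
      ⟨(RingHom.injective_iff_ker_eq_bot _).mpr Ideal.mk_ker, Ideal.Quotient.mk_surjective⟩
    let e : Fin (Nat.card σ) ≃ σ := (Finite.equivFin σ).symm
    have hμ : (Λ.submatrix e e).transpose = -Λ.submatrix e e := by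
      rw [Matrix.transpose_submatrix, hΛ, Matrix.submatrix_neg, Pi.neg_apply, Pi.neg_apply]
    refine ⟨Nat.card σ, Λ.submatrix e e, hμ, ?_,
      isomorphic_quadratic k _ hμ _ (y ∘ e) (hind.comp e e.injective) ?_
        (fun c f => bracket_algebraMap_left _ f c) (hy.comp e)⟩
    · rw [MvPolynomial.trdeg_of_isDomain, ← Nat.cast_card, Cardinal.lift_natCast]
    · rw [e.surjective.range_comp, htop]
  · obtain ⟨y, hy, htop, hind⟩ := h.exists_algebraicIndependent_generators π (AlgHom.id k _)
      (fun a b => rfl) Function.bijective_id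
    exact isomorphic_quadratic k Λ hΛ _ y hind htop (fun c f => bracket_algebraMap_left _ f c) hy

end HasLogCanonicalImages

end Reduction

section Antidiagonal

open Finset

theorem sum_antidiagonal_succ_nsmul {M : Type*} [AddCommMonoid M] (g : ℕ → ℕ → M) (n : ℕ) :
    ∑ p ∈ antidiagonal n, ((p.1 + 1) • g (p.1 + 1) p.2 + (p.2 + 1) • g p.1 (p.2 + 1)) =
      (n + 1) • ∑ p ∈ antidiagonal (n + 1), g p.1 p.2 := by
  have hfst := Nat.sum_antidiagonal_succ (n := n) (f := fun p => p.1 • g p.1 p.2)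
  have hsnd := Nat.sum_antidiagonal_succ' (n := n) (f := fun p => p.2 • g p.1 p.2)
  rw [zero_smul, zero_add] at hfst hsnd
  rw [sum_add_distrib, ← hfst, ← hsnd, ← sum_add_distrib, smul_sum]
  exact sum_congr rfl fun p hp => by rw [← add_smul, mem_antidiagonal.mp hp]

theorem sum_range_sum_antidiagonal {M : Type*} [AddCommMonoid M] {g : ℕ → ℕ → M} {m n : ℕ}
    (hm : ∀ i j, m ≤ i → g i j = 0) (hn : ∀ i j, n ≤ j → g i j = 0) :
    ∑ l ∈ range (m + n), ∑ p ∈ antidiagonal l, g p.1 p.2 =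
      ∑ i ∈ range m, ∑ j ∈ range n, g i j := by
  have hmaps : ∀ p ∈ range m ×ˢ range n, p.1 + p.2 ∈ range (m + n) := fun p hp => by
    simp only [mem_product, mem_range] at hp ⊢
    omega
  rw [← sum_product', ← sum_fiberwise_of_maps_to hmaps]
  refine sum_congr rfl fun l _ => (sum_subset (fun p hp => ?_) fun p hp hp' => ?_).symm
  · exact mem_antidiagonal.mpr (mem_filter.mp hp).2
  · simp only [mem_filter, mem_product, mem_range, mem_antidiagonal.mp hp, and_true, not_and_or,
      not_lt] at hp'
    exact hp'.elim (hm _ _) (hn _ _)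

end Antidiagonal

section LocallyNilpotent

open Finset

variable {k B : Type*} [Field k] [CommRing B] [Algebra k B]

/-- The `l`-th divided power `δ ^ l / l!` of a derivation. -/
noncomputable def dividedPower (δ : Derivation k B B) (l : ℕ) : B →ₗ[k] B :=
  (l.factorial : k)⁻¹ • (δ : B →ₗ[k] B) ^ l

theorem dividedPower_apply (δ : Derivation k B B) (l : ℕ) (b : B) :
    dividedPower δ l b = (l.factorial : k)⁻¹ • δ^[l] b := by
  rw [dividedPower, LinearMap.smul_apply, Module.End.pow_apply]
  rfl

theorem dividedPower_zero (δ : Derivation k B B) (b : B) : dividedPower δ 0 b = b := by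
  simp [dividedPower_apply]

/-- A derivation is locally nilpotent if each element is killed by some power of it. -/
def IsLocallyNilpotent (δ : Derivation k B B) : Prop :=
  ∀ b, ∃ n, δ^[n] b = 0

theorem iterate_derivation_eq_zero_of_le {δ : Derivation k B B} {b : B} {m n : ℕ}
    (h : δ^[m] b = 0) (hmn : m ≤ n) : δ^[n] b = 0 := by
  rw [← Nat.sub_add_cancel hmn, Function.iterate_add_apply, h, iterate_map_zero]

theorem iterate_derivation_add_eq_zero {δ : Derivation k B B} {a b : B} {m n : ℕ}
    (hm : δ^[m] a = 0) (hn : δ^[n] b = 0) : δ^[m + n] (a + b) = 0 := by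
  rw [iterate_map_add, iterate_derivation_eq_zero_of_le hm (Nat.le_add_right m n),
    iterate_derivation_eq_zero_of_le hn (Nat.le_add_left n m), add_zero]

theorem dividedPower_eq_zero_of_le {δ : Derivation k B B} {b : B} {m n : ℕ} (h : δ^[m] b = 0)
    (hmn : m ≤ n) : dividedPower δ n b = 0 := by
  rw [dividedPower_apply, iterate_derivation_eq_zero_of_le h hmn, smul_zero]

theorem iterate_dividedPower_eq_zero {δ : Derivation k B B} {b : B} {l m n : ℕ}
    (h : δ^[m] b = 0) (hmn : m ≤ n + l) : δ^[n] (dividedPower δ l b) = 0 := by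
  rw [dividedPower_apply, ← Derivation.coeFn_coe, ← Module.End.pow_apply, map_smul,
    Module.End.pow_apply, Derivation.coeFn_coe, ← Function.iterate_add_apply,
    iterate_derivation_eq_zero_of_le h hmn, smul_zero]

variable [CharZero k]

theorem derivation_dividedPower (δ : Derivation k B B) (l : ℕ) (b : B) :
    δ (dividedPower δ l b) = (l + 1) • dividedPower δ (l + 1) b := by
  have : ((l + 1 : ℕ) : k) ≠ 0 := Nat.cast_ne_zero.mpr l.succ_ne_zero
  rw [dividedPower_apply, dividedPower_apply, Derivation.map_smul, ← Function.iterate_succ_apply' δ,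
    ← Nat.cast_smul_eq_nsmul k, smul_smul, Nat.factorial_succ, Nat.cast_mul, mul_inv,
    mul_inv_cancel_left₀ this]

theorem dividedPower_mul (δ : Derivation k B B) (a b : B) (n : ℕ) :
    dividedPower δ n (a * b) =
      ∑ p ∈ antidiagonal n, dividedPower δ p.1 a * dividedPower δ p.2 b := by
  induction n with
  | zero => simp [dividedPower_zero]
  | succ n ih =>
    have hn : ((n + 1 : ℕ) : k) ≠ 0 := Nat.cast_ne_zero.mpr n.succ_ne_zero
    refine smul_right_injective B hn ?_
    simp only [Nat.cast_smul_eq_nsmul]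
    rw [← derivation_dividedPower, ih, map_sum,
      ← sum_antidiagonal_succ_nsmul fun i j => dividedPower δ i a * dividedPower δ j b]
    refine sum_congr rfl fun p _ => ?_
    rw [Derivation.leibniz, derivation_dividedPower, derivation_dividedPower, smul_eq_mul,
      smul_eq_mul, mul_smul_comm, mul_smul_comm, add_comm, mul_comm (dividedPower δ p.2 b)]

theorem iterate_derivation_mul_eq_zero {δ : Derivation k B B} {a b : B} {m n : ℕ}
    (hm : δ^[m] a = 0) (hn : δ^[n] b = 0) : δ^[m + n] (a * b) = 0 := by
  have hmn : dividedPower δ (m + n) (a * b) = 0 := by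
    rw [dividedPower_mul]
    refine sum_eq_zero fun p hp => ?_
    have hp' := mem_antidiagonal.mp hp
    rcases le_or_gt m p.1 with hp₁ | hp₁
    · rw [dividedPower_eq_zero_of_le hm hp₁, zero_mul]
    · rw [dividedPower_eq_zero_of_le hn (by omega), mul_zero]
  rw [dividedPower_apply] at hmn
  exact (smul_eq_zero.mp hmn).resolve_left
    (inv_ne_zero (Nat.cast_ne_zero.mpr (m + n).factorial_ne_zero))

/-- The subalgebra of the elements killed by some power of a derivation. -/
def nilpotentSubalgebra (δ : Derivation k B B) : Subalgebra k B where
  carrier := {b | ∃ n, δ^[n] b = 0}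
  algebraMap_mem' c := ⟨1, δ.map_algebraMap c⟩
  add_mem' := fun ⟨m, hm⟩ ⟨n, hn⟩ => ⟨m + n, iterate_derivation_add_eq_zero hm hn⟩
  mul_mem' := fun ⟨m, hm⟩ ⟨n, hn⟩ => ⟨m + n, iterate_derivation_mul_eq_zero hm hn⟩

theorem mem_nilpotentSubalgebra_of_apply_mem {δ : Derivation k B B} {b : B}
    (h : δ b ∈ nilpotentSubalgebra δ) : b ∈ nilpotentSubalgebra δ := by
  obtain ⟨n, hn⟩ := h
  exact ⟨n + 1, hn⟩

theorem isLocallyNilpotent_of_adjoin_eq_top {δ : Derivation k B B} {S : Set B}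
    (hS : Algebra.adjoin k S = ⊤) (h : S ⊆ nilpotentSubalgebra δ) : IsLocallyNilpotent δ :=
  fun _ => Algebra.adjoin_le h (hS ▸ Algebra.mem_top)

end LocallyNilpotent

section Exponential

open Finset

variable {k B F : Type*} [Field k] [CommRing B] [Algebra k B] [CommRing F] [Algebra k F]

theorem finsum_pow_mul_dividedPower_eq (φ : B →ₐ[k] F) {δ : Derivation k B B} (y : F) {b : B}
    {n : ℕ} (hn : δ^[n] b = 0) :
    ∑ᶠ l, y ^ l * φ (dividedPower δ l b) = ∑ l ∈ range n, y ^ l * φ (dividedPower δ l b) := by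
  refine finsum_eq_sum_of_support_subset _ (Function.support_subset_iff'.mpr fun l hl => ?_)
  rw [dividedPower_eq_zero_of_le hn (by simpa using hl), map_zero, mul_zero]

variable [CharZero k]

/-- The homomorphism `b ↦ ∑ l, y ^ l * φ (δ ^ l b) / l!`, that is, `φ` composed with the
exponential `exp(y δ)` of a locally nilpotent derivation `δ`. -/
noncomputable def expHom (φ : B →ₐ[k] F) {δ : Derivation k B B} (hδ : IsLocallyNilpotent δ)
    (y : F) : B →ₐ[k] F where
  toFun b := ∑ᶠ l, y ^ l * φ (dividedPower δ l b)
  map_zero' := by simp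
  map_one' := by
    rw [finsum_pow_mul_dividedPower_eq φ y (n := 1) δ.map_one_eq_zero]
    simp [dividedPower_zero]
  map_add' a b := by
    obtain ⟨m, hm⟩ := hδ a
    obtain ⟨n, hn⟩ := hδ b
    rw [finsum_pow_mul_dividedPower_eq φ y
        (iterate_derivation_eq_zero_of_le hm (Nat.le_add_right m n)),
      finsum_pow_mul_dividedPower_eq φ y
        (iterate_derivation_eq_zero_of_le hn (Nat.le_add_left n m)),
      finsum_pow_mul_dividedPower_eq φ y (iterate_derivation_add_eq_zero hm hn),
      ← sum_add_distrib]
    simp only [map_add, mul_add]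
  map_mul' a b := by
    obtain ⟨m, hm⟩ := hδ a
    obtain ⟨n, hn⟩ := hδ b
    rw [finsum_pow_mul_dividedPower_eq φ y hm, finsum_pow_mul_dividedPower_eq φ y hn,
      finsum_pow_mul_dividedPower_eq φ y (iterate_derivation_mul_eq_zero hm hn), sum_mul_sum,
      ← sum_range_sum_antidiagonal
        (fun i j hi => by rw [dividedPower_eq_zero_of_le hm hi, map_zero, mul_zero, zero_mul])
        (fun i j hj => by rw [dividedPower_eq_zero_of_le hn hj, map_zero, mul_zero, mul_zero])]
    refine sum_congr rfl fun l _ => ?_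
    rw [dividedPower_mul, map_sum, mul_sum]
    refine sum_congr rfl fun p hp => ?_
    rw [map_mul, ← mem_antidiagonal.mp hp]
    ring
  commutes' c := by
    rw [finsum_pow_mul_dividedPower_eq φ y (n := 1) (δ.map_algebraMap c)]
    simp [dividedPower_zero]

variable {φ : B →ₐ[k] F} {δ : Derivation k B B} (hδ : IsLocallyNilpotent δ) {y : F}

theorem expHom_eq_sum {b : B} {n : ℕ} (hn : δ^[n] b = 0) :
    expHom φ hδ y b = ∑ l ∈ range n, y ^ l * φ (dividedPower δ l b) :=
  finsum_pow_mul_dividedPower_eq φ y hn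

theorem expHom_eq_of_derivation_eq_zero {b : B} (hb : δ b = 0) : expHom φ hδ y b = φ b := by
  rw [expHom_eq_sum hδ (n := 1) hb, sum_range_one, pow_zero, one_mul, dividedPower_zero]

theorem mem_of_expHom_mem {E : Subalgebra k F} (hy : y ∈ E) (hE : ∀ b, expHom φ hδ y b ∈ E)
    (b : B) : φ b ∈ E := by
  obtain ⟨n, hn⟩ := hδ b
  induction n generalizing b with
  | zero => rw [show b = 0 from hn, map_zero]; exact zero_mem E
  | succ n ih =>
    have hb := expHom_eq_sum (φ := φ) (y := y) hδ hn
    rw [sum_range_succ', pow_zero, one_mul, dividedPower_zero] at hb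
    rw [← sub_eq_of_eq_add' hb]
    refine sub_mem (hE b) (sum_mem fun l _ => mul_mem (pow_mem hy _) (ih _ ?_))
    exact iterate_dividedPower_eq_zero hn (by omega)

end Exponential

section Deletion

open Finset

theorem bracket_pow_right {k A : Type*} [CommRing k] [CommRing A] [Algebra k A]
    (π : PoissonBracket k A) (a b : A) (n : ℕ) :
    π.bracket a (b ^ n) = n * b ^ (n - 1) * π.bracket a b := by
  have := (π.toBiderivation a).leibniz_pow b n
  rwa [nsmul_eq_mul, smul_eq_mul, ← mul_assoc] at this

theorem dividedPower_eigenvector {k B : Type*} [Field k] [CommRing B] [Algebra k B]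
    {α : B →ₗ[k] B} {δ : Derivation k B B} {s : k}
    (hα : ∀ b, α (δ b) = δ (α b) + s • δ b) {b : B} {w : k} (hb : α b = w • b) (l : ℕ) :
    α (dividedPower δ l b) = (w + l * s) • dividedPower δ l b := by
  rw [dividedPower_apply, map_smul, smul_comm]
  congr 1
  induction l with
  | zero => simpa using hb
  | succ l ih =>
    rw [Function.iterate_succ_apply', hα, ih, Derivation.map_smul, ← add_smul]
    push_cast
    ring_nf

section Sequence

variable {k F : Type*} [Field k] [Field F] [Algebra k F] {ρ : PoissonBracket k F} {x y : F} {s : k}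

theorem bracket_pow_of_mul_eq_neg_one (hyx : algebraMap k F s * y * x = -1) (f : F) (n : ℕ) :
    ρ.bracket f (y ^ n) = algebraMap k F s * n * y ^ (n + 1) * ρ.bracket f x := by
  have h := congrArg (ρ.bracket f) hyx
  rw [leibniz, leibniz, bracket_algebraMap_right, map_neg, ← map_one (algebraMap k F),
    bracket_algebraMap_right] at h
  have hy : ρ.bracket f y = algebraMap k F s * y ^ 2 * ρ.bracket f x := by
    linear_combination -y * h + ρ.bracket f y * hyx
  rw [bracket_pow_right, hy]
  rcases n with _ | n
  · simp only [Nat.cast_zero, zero_mul, mul_zero]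
  · rw [Nat.add_sub_cancel]
    ring

/-- The bracket relations between `x` and the images `a l` of the divided powers `δ ^ l b / l!` of
an eigenvector `b` of `α` of eigenvalue `w`, when `{x, b} = α b * x + δ b` and
`α * δ - δ * α = s * δ`. -/
def IsDeletionSequence (ρ : PoissonBracket k F) (x : F) (s w : k) (a : ℕ → F) : Prop :=
  ∀ l : ℕ, ρ.bracket x (a l) =
    algebraMap k F (w + l * s) * a l * x + algebraMap k F (l + 1) * a (l + 1)

namespace IsDeletionSequence

variable {v w : k} {a b c : ℕ → F}

theorem bracket_sum (ha : IsDeletionSequence ρ x s w a) (hyx : algebraMap k F s * y * x = -1)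
    {n : ℕ} (hn : a n = 0) :
    ρ.bracket x (∑ l ∈ range n, y ^ l * a l) =
      algebraMap k F w * x * ∑ l ∈ range n, y ^ l * a l := by
  have hterm (l : ℕ) : ρ.bracket x (y ^ l * a l) = algebraMap k F w * x * (y ^ l * a l) +
      ((l + 1 : ℕ) * y ^ (l + 1 - 1) * a (l + 1) - l * y ^ (l - 1) * a l) := by
    rw [leibniz, bracket_pow_of_mul_eq_neg_one hyx, ρ.alt, ha l]
    rcases l with _ | l
    · simp only [map_add, map_mul, map_one, map_zero, Nat.cast_zero]
      ring
    · simp only [map_add, map_mul, map_one, map_natCast, Nat.add_sub_cancel, Nat.cast_add,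
        Nat.cast_one]
      linear_combination (l + 1) * y ^ l * a (l + 1) * hyx
  simp only [map_sum, hterm, sum_add_distrib, ← mul_sum]
  rw [sum_range_sub (fun l => (l : F) * y ^ (l - 1) * a l), hn]
  simp

/-- The coefficients of the expansion of `{∑ y ^ i * a i, ∑ y ^ j * b j}` in powers of
`y = -(s * x)⁻¹`, for deletion sequences `a` and `b` of eigenvalues `w` and `v`. -/
def bracketCoeff (ρ : PoissonBracket k F) (w v : k) (a b : ℕ → F) (i j : ℕ) : F :=
  ρ.bracket (a i) (b j) + algebraMap k F (j * w - i * v) * a i * b j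

theorem bracket_bracketCoeff (ha : IsDeletionSequence ρ x s w a)
    (hb : IsDeletionSequence ρ x s v b) (i j : ℕ) :
    ρ.bracket x (bracketCoeff ρ w v a b i j) =
      algebraMap k F (w + v + (i + j : ℕ) * s) * bracketCoeff ρ w v a b i j * x +
      ((i + 1) • bracketCoeff ρ w v a b (i + 1) j + (j + 1) • bracketCoeff ρ w v a b i (j + 1)) +
      algebraMap k F s *
        (i * (j + 1 : ℕ) * a i * b (j + 1) - (i + 1 : ℕ) * j * a (i + 1) * b j) := by
  have hleft : ρ.bracket (ρ.bracket x (a i)) (b j) =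
      algebraMap k F (w + i * s) * (a i * ρ.bracket x (b j) + x * ρ.bracket (a i) (b j)) +
        algebraMap k F (i + 1) * ρ.bracket (a (i + 1)) (b j) := by
    rw [ha i, map_add, LinearMap.add_apply]
    simp only [bracket_mul_left, bracket_algebraMap_left]
    ring
  have hright : ρ.bracket (a i) (ρ.bracket x (b j)) =
      algebraMap k F (v + j * s) * (x * ρ.bracket (a i) (b j) - b j * ρ.bracket x (a i)) +
        algebraMap k F (j + 1) * ρ.bracket (a i) (b (j + 1)) := by
    rw [hb j, map_add, ρ.skew x (a i)]
    simp only [leibniz, bracket_algebraMap_right]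
    ring
  simp only [bracketCoeff]
  rw [map_add, ρ.bracket_bracket x (a i) (b j), hleft, hright, leibniz, leibniz,
    bracket_algebraMap_right, ha i, hb j]
  simp only [map_add, map_sub, map_mul, map_natCast, map_one, nsmul_eq_mul, Nat.cast_add,
    Nat.cast_one]
  ring

theorem eq_sum_bracketCoeff [CharZero F] (ha : IsDeletionSequence ρ x s w a)
    (hb : IsDeletionSequence ρ x s v b) (hc : IsDeletionSequence ρ x s (w + v) c)
    (habc : c 0 = ρ.bracket (a 0) (b 0)) (n : ℕ) :
    c n = ∑ p ∈ antidiagonal n, bracketCoeff ρ w v a b p.1 p.2 := by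
  induction n with
  | zero => simp [habc, bracketCoeff]
  | succ n ih =>
    have hcancel : ∑ p ∈ antidiagonal n, (p.1 * (p.2 + 1 : ℕ) * a p.1 * b (p.2 + 1) -
        (p.1 + 1 : ℕ) * p.2 * a (p.1 + 1) * b p.2) = 0 := by
      have hfst := Nat.sum_antidiagonal_succ (n := n) (f := fun p => p.1 * p.2 * a p.1 * b p.2)
      have hsnd := Nat.sum_antidiagonal_succ' (n := n) (f := fun p => p.1 * p.2 * a p.1 * b p.2)
      rw [sum_sub_distrib, sub_eq_zero]
      simpa using hsnd.symm.trans hfst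
    have hsucc := hc n
    rw [ih, map_sum, sum_congr rfl fun p hp => by
      rw [bracket_bracketCoeff ha hb, mem_antidiagonal.mp hp], sum_add_distrib, sum_add_distrib,
      sum_antidiagonal_succ_nsmul (bracketCoeff ρ w v a b), ← mul_sum, hcancel, mul_zero, add_zero,
      ← sum_mul, ← mul_sum, add_right_inj, nsmul_eq_mul, ← Nat.cast_succ, map_natCast] at hsucc
    exact (mul_left_cancel₀ (Nat.cast_ne_zero.mpr n.succ_ne_zero) hsucc).symm

theorem bracket_pow_mul_pow_mul (hyx : algebraMap k F s * y * x = -1)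
    (ha : IsDeletionSequence ρ x s w a) (hb : IsDeletionSequence ρ x s v b) (i j : ℕ) :
    ρ.bracket (y ^ i * a i) (y ^ j * b j) = y ^ (i + j) * bracketCoeff ρ w v a b i j +
      algebraMap k F s * ((i * (y ^ i * a i)) * ((j + 1 : ℕ) * (y ^ (j + 1) * b (j + 1))) -
        ((i + 1 : ℕ) * (y ^ (i + 1) * a (i + 1))) * (j * (y ^ j * b j))) := by
  have hay : ρ.bracket (a i) (y ^ j) =
      -(algebraMap k F s * j * y ^ (j + 1) * ρ.bracket x (a i)) := by
    rw [bracket_pow_of_mul_eq_neg_one hyx, ρ.skew, mul_neg]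
  have hyb : ρ.bracket (y ^ i) (b j) = algebraMap k F s * i * y ^ (i + 1) * ρ.bracket x (b j) := by
    rw [ρ.skew, bracket_pow_of_mul_eq_neg_one hyx, ρ.skew x, mul_neg]
  have hyy : ρ.bracket (y ^ i) (y ^ j) = 0 := by
    rw [bracket_pow_of_mul_eq_neg_one hyx, ρ.skew, bracket_pow_of_mul_eq_neg_one hyx, ρ.alt]
    simp only [mul_zero, neg_zero]
  rw [bracket_mul_left, leibniz, leibniz, hay, hyb, hyy, ha i, hb j, bracketCoeff]
  simp only [map_add, map_sub, map_mul, map_natCast, map_one, Nat.cast_add, Nat.cast_one]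
  linear_combination y ^ (i + j) * a i * b j *
    (i * algebraMap k F v - j * algebraMap k F w) * hyx

theorem bracket_sum_sum [CharZero F] (hyx : algebraMap k F s * y * x = -1)
    (ha : IsDeletionSequence ρ x s w a) (hb : IsDeletionSequence ρ x s v b)
    (hc : IsDeletionSequence ρ x s (w + v) c) (habc : c 0 = ρ.bracket (a 0) (b 0)) {m n : ℕ}
    (hm : ∀ i, m ≤ i → a i = 0) (hn : ∀ j, n ≤ j → b j = 0) :
    ρ.bracket (∑ i ∈ range m, y ^ i * a i) (∑ j ∈ range n, y ^ j * b j) =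
      ∑ l ∈ range (m + n), y ^ l * c l := by
  have hshift {d : ℕ → F} {N : ℕ} (hd : d N = 0) : ∑ i ∈ range N, (i + 1 : ℕ) * (y ^ (i + 1) *
      d (i + 1)) = ∑ i ∈ range N, i * (y ^ i * d i) := by
    rw [← sub_eq_zero, ← sum_sub_distrib, sum_range_sub (fun i => (i : F) * (y ^ i * d i)), hd]
    simp only [mul_zero, Nat.cast_zero, zero_mul, sub_zero]
  have hcoeff : ∑ l ∈ range (m + n), y ^ l * c l =
      ∑ i ∈ range m, ∑ j ∈ range n, y ^ (i + j) * bracketCoeff ρ w v a b i j := by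
    rw [← sum_range_sum_antidiagonal
      (fun i j hi => by simp [bracketCoeff, hm i hi])
      (fun i j hj => by simp [bracketCoeff, hn j hj])]
    refine sum_congr rfl fun l _ => ?_
    rw [eq_sum_bracketCoeff ha hb hc habc, mul_sum]
    exact sum_congr rfl fun p hp => by rw [mem_antidiagonal.mp hp]
  simp only [map_sum, LinearMap.sum_apply]
  rw [sum_comm]
  simp only [bracket_pow_mul_pow_mul hyx ha hb, sum_add_distrib, ← mul_sum, sum_sub_distrib]
  rw [← sum_mul, ← sum_mul, hshift (hn n le_rfl), hshift (hm m le_rfl), sub_self, mul_zero,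
    add_zero, hcoeff]

end IsDeletionSequence

end Sequence

variable {k B F : Type*} [Field k] [CharZero k] [CommRing B] [Algebra k B] [Field F] [Algebra k F]
  {ρ : PoissonBracket k F} {φ : B →ₐ[k] F} {δ : Derivation k B B} (hδ : IsLocallyNilpotent δ)
  {α : B →ₗ[k] B} {x : F} {s : k}

theorem bracket_expHom_of_eigenvector {γ : B →ₗ[k] B} {v y : F} {c w : k}
    (hv : ∀ b, ρ.bracket v (φ b) = φ (γ b) * v) (hγ : ∀ b, γ (δ b) = δ (γ b) + c • δ b)
    (hy : ρ.bracket v y = -(c • (y * v))) {b : B} (hb : γ b = w • b) :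
    ρ.bracket v (expHom φ hδ y b) = algebraMap k F w * v * expHom φ hδ y b := by
  obtain ⟨n, hn⟩ := hδ b
  rw [expHom_eq_sum hδ hn, map_sum, mul_sum]
  refine sum_congr rfl fun l _ => ?_
  rw [leibniz, bracket_pow_right, hy, hv, dividedPower_eigenvector hγ hb, map_smul]
  rcases l with _ | l
  · simp only [Algebra.smul_def, map_add, map_mul, map_zero, Nat.cast_zero]
    ring
  · simp only [Algebra.smul_def, map_add, map_mul, map_natCast, Nat.add_sub_cancel]
    ring

theorem isDeletionSequence_dividedPower
    (hx : ∀ b, ρ.bracket x (φ b) = φ (α b) * x + φ (δ b))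
    (hα : ∀ b, α (δ b) = δ (α b) + s • δ b) {b : B} {w : k} (hb : α b = w • b) :
    IsDeletionSequence ρ x s w fun l => φ (dividedPower δ l b) := by
  intro l
  rw [hx, dividedPower_eigenvector hα hb, derivation_dividedPower, map_smul, map_nsmul,
    Algebra.smul_def, nsmul_eq_mul, map_add (algebraMap k F) (l : k) 1, map_natCast, map_one,
    Nat.cast_add, Nat.cast_one]

variable {y : F} (hx : ∀ b, ρ.bracket x (φ b) = φ (α b) * x + φ (δ b))
  (hα : ∀ b, α (δ b) = δ (α b) + s • δ b) (hyx : algebraMap k F s * y * x = -1)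

include hx hα hyx

theorem bracket_expHom {b : B} {w : k} (hb : α b = w • b) :
    ρ.bracket x (expHom φ hδ y b) = algebraMap k F w * x * expHom φ hδ y b := by
  obtain ⟨n, hn⟩ := hδ b
  rw [expHom_eq_sum hδ hn]
  refine (isDeletionSequence_dividedPower hx hα hb).bracket_sum hyx ?_
  rw [dividedPower_eq_zero_of_le hn le_rfl, map_zero]

theorem expHom_bracket {a b c : B} {v w : k} (ha : α a = w • a) (hb : α b = v • b)
    (hc : α c = (w + v) • c) (habc : φ c = ρ.bracket (φ a) (φ b)) :
    expHom φ hδ y c = ρ.bracket (expHom φ hδ y a) (expHom φ hδ y b) := by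
  have : CharZero F := charZero_of_injective_algebraMap (algebraMap k F).injective
  obtain ⟨l, hl⟩ := hδ c
  obtain ⟨m, hm⟩ := hδ a
  obtain ⟨n, hn⟩ := hδ b
  have hm' := iterate_derivation_eq_zero_of_le hm (Nat.le_add_left m l)
  have hzero {d : B} {N i : ℕ} (hd : δ^[N] d = 0) (hi : N ≤ i) : φ (dividedPower δ i d) = 0 := by
    rw [dividedPower_eq_zero_of_le hd hi, map_zero]
  rw [expHom_eq_sum hδ hm', expHom_eq_sum hδ hn,
    expHom_eq_sum hδ (iterate_derivation_eq_zero_of_le hl (by omega : l ≤ l + m + n))]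
  refine ((isDeletionSequence_dividedPower hx hα ha).bracket_sum_sum hyx
    (isDeletionSequence_dividedPower hx hα hb) (isDeletionSequence_dividedPower hx hα hc) ?_
    (fun _ => hzero hm') fun _ => hzero hn).symm
  simpa only [dividedPower_zero] using habc

end Deletion

section IteratedDeletion

variable {k : Type*} [Field k] {σ : Type*}

/-- The derivation of `k[X_s]` with `X_i ↦ Λ_{ui} X_i`, which is the bracket with `X_u`, divided by
`X_u`, for the log-canonical bracket with matrix `Λ`. -/
noncomputable def weightDer (Λ : Matrix σ σ k) (u : σ) :
    Derivation k (MvPolynomial σ k) (MvPolynomial σ k) :=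
  mkDerivation k fun i => Λ u i • X i

/-- The difference between the bracket `{X_t, X_i}` and its log-canonical part. -/
noncomputable def defect (π : PoissonBracket k (MvPolynomial σ k)) (Λ : Matrix σ σ k) (t i : σ) :
    MvPolynomial σ k :=
  π.bracket (X t) (X i) - C (Λ t i) * X t * X i

/-- The derivation of `k[X_s]` which maps `X_i` to the defect of `{X_t, X_i}` if `i` has smaller
rank than `t`, and to zero otherwise. -/
noncomputable def defectDer (π : PoissonBracket k (MvPolynomial σ k)) (Λ : Matrix σ σ k)
    (r : σ → ℕ) (t : σ) : Derivation k (MvPolynomial σ k) (MvPolynomial σ k) :=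
  mkDerivation k fun i => if r i < r t then defect π Λ t i else 0

/-- The bracket `π` on `k[X_s]` is that of an iterated Poisson-Ore extension, with the
indeterminates adjoined in the order of their rank, to which the deleting derivations algorithm
applies: the bracket with `X_t` is `X_t • weightDer Λ t + defectDer π Λ r t` on the indeterminates
of smaller rank, where `defectDer π Λ r t` is locally nilpotent and an eigenvector of the weight
derivations of `t`, with eigenvalue `s t`, and of the indeterminates of larger rank. -/
structure IsDeletable (π : PoissonBracket k (MvPolynomial σ k)) (Λ : Matrix σ σ k) (r : σ → ℕ)
    (s : σ → k) : Prop where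
  rank_injective : Function.Injective r
  isLocallyNilpotent : ∀ t, IsLocallyNilpotent (defectDer π Λ r t)
  ne_zero_or : ∀ t, s t ≠ 0 ∨ defectDer π Λ r t = 0
  lie_weightDer_self : ∀ t, ⁅weightDer Λ t, defectDer π Λ r t⁆ = s t • defectDer π Λ r t
  lie_weightDer_of_lt : ∀ t u, r t < r u →
    ⁅weightDer Λ u, defectDer π Λ r t⁆ = Λ u t • defectDer π Λ r t

theorem weightDer_X (Λ : Matrix σ σ k) (u i : σ) : weightDer Λ u (X i) = Λ u i • X i :=
  mkDerivation_X _ _ _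

theorem weightDer_X_mul_X (Λ : Matrix σ σ k) (u i j : σ) :
    weightDer Λ u (X i * X j) = (Λ u i + Λ u j) • (X i * X j) := by
  rw [Derivation.leibniz, weightDer_X, weightDer_X, smul_eq_mul, smul_eq_mul, mul_smul_comm,
    mul_smul_comm, mul_comm (X j), ← add_smul, add_comm]

theorem defectDer_X_of_lt (π : PoissonBracket k (MvPolynomial σ k)) (Λ : Matrix σ σ k) {r : σ → ℕ}
    {t i : σ} (h : r i < r t) : defectDer π Λ r t (X i) = defect π Λ t i := by
  rw [defectDer, mkDerivation_X, if_pos h]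

theorem defectDer_X_of_le (π : PoissonBracket k (MvPolynomial σ k)) (Λ : Matrix σ σ k)
    {r : σ → ℕ} {t i : σ} (h : r t ≤ r i) : defectDer π Λ r t (X i) = 0 := by
  rw [defectDer, mkDerivation_X, if_neg h.not_gt]

theorem bracket_eq_add_defectDer (π : PoissonBracket k (MvPolynomial σ k)) (Λ : Matrix σ σ k)
    {r : σ → ℕ} {t i : σ} (h : r i < r t) :
    π.bracket (X t) (X i) = weightDer Λ t (X i) * X t + defectDer π Λ r t (X i) := by
  rw [defectDer_X_of_lt π Λ h, weightDer_X, defect, MvPolynomial.smul_eq_C_mul]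
  ring

theorem bracket_map_eq {F : Type*} [CommRing F] [Algebra k F] (ρ : PoissonBracket k F)
    (φ : MvPolynomial σ k →ₐ[k] F) (x : F)
    (D E : Derivation k (MvPolynomial σ k) (MvPolynomial σ k))
    (h : ∀ i, ρ.bracket x (φ (X i)) = φ (D (X i)) * x + φ (E (X i))) (f : MvPolynomial σ k) :
    ρ.bracket x (φ f) = φ (D f) * x + φ (E f) := by
  induction f using MvPolynomial.induction_on with
  | C c =>
    rw [← MvPolynomial.algebraMap_eq, Derivation.map_algebraMap, Derivation.map_algebraMap,
      φ.commutes, bracket_algebraMap_right, map_zero, zero_mul, add_zero]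
  | add f g hf hg =>
    simp only [map_add, hf, hg]
    ring
  | mul_X f i hf =>
    simp only [map_mul, ρ.leibniz, hf, h, Derivation.leibniz, map_add, smul_eq_mul]
    ring

/-- `φ` is compatible with the brackets of the indeterminates of rank below `N`, and the images of
the remaining indeterminates are log-canonical. -/
structure IsLogCanonicalFrom {F : Type*} [Field F] [Algebra k F]
    (π : PoissonBracket k (MvPolynomial σ k)) (Λ : Matrix σ σ k) (r : σ → ℕ)
    (ρ : PoissonBracket k F) (N : ℕ) (φ : MvPolynomial σ k →ₐ[k] F) : Prop where
  map_bracket : ∀ i j, r i < N → r j < N →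
    φ (π.bracket (X i) (X j)) = ρ.bracket (φ (X i)) (φ (X j))
  logCanonical : ∀ u i, N ≤ r u →
    ρ.bracket (φ (X u)) (φ (X i)) = algebraMap k F (Λ u i) * φ (X u) * φ (X i)

namespace IsDeletable

variable {π : PoissonBracket k (MvPolynomial σ k)} {Λ : Matrix σ σ k} {r : σ → ℕ} {s : σ → k}

theorem weightDer_bracket (h : IsDeletable π Λ r s) {t i j : σ} (hi : r i < r t) (hj : r j < r t) :
    weightDer Λ t (π.bracket (X i) (X j)) = (Λ t i + Λ t j) • π.bracket (X i) (X j) := by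
  have hlt {i j : σ} (hij : r i < r j) (hj : r j < r t) :
      weightDer Λ t (π.bracket (X j) (X i)) = (Λ t j + Λ t i) • π.bracket (X j) (X i) := by
    have hδ := DFunLike.congr_fun (h.lie_weightDer_of_lt j t hj) (X i)
    rw [Derivation.commutator_apply, weightDer_X, Derivation.map_smul, Derivation.smul_apply,
      sub_eq_iff_eq_add, ← add_smul] at hδ
    rw [bracket_eq_add_defectDer π Λ hij, map_add, hδ, weightDer_X, smul_mul_assoc,
      Derivation.map_smul, weightDer_X_mul_X, smul_add, smul_comm, add_comm (Λ t i)]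
  rcases lt_trichotomy (r i) (r j) with hij | hij | hij
  · rw [π.skew, map_neg, hlt hij hj, smul_neg, add_comm]
  · rw [h.rank_injective hij, π.alt, map_zero, smul_zero]
  · exact hlt hij hi

variable {F : Type*} [Field F] [Algebra k F] {ρ : PoissonBracket k F}
  {φ : MvPolynomial σ k →ₐ[k] F}

section

variable [CharZero k]

theorem bracket_map_X (h : IsDeletable π Λ r s) (hΛ : Λ.transpose = -Λ) {t : σ}
    (hφ : IsLogCanonicalFrom π Λ r ρ (r t + 1) φ) (f : MvPolynomial σ k) :
    ρ.bracket (φ (X t)) (φ f) = φ (weightDer Λ t f) * φ (X t) + φ (defectDer π Λ r t f) := by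
  refine bracket_map_eq ρ φ _ _ _ (fun i => ?_) f
  rcases lt_or_ge (r i) (r t) with hi | hi
  · rw [← hφ.map_bracket t i (by omega) (by omega), bracket_eq_add_defectDer π Λ hi, map_add,
      map_mul]
  rw [defectDer_X_of_le π Λ hi, map_zero, add_zero, weightDer_X, map_smul, Algebra.smul_def]
  rcases hi.eq_or_lt with hi | hi
  · rw [← h.rank_injective hi, ρ.alt, diag_zero hΛ, map_zero, zero_mul, zero_mul]
  · rw [ρ.skew, hφ.logCanonical i t hi, skew_apply hΛ i t, map_neg]
    ring

theorem isLogCanonicalFrom_of_defectDer_eq_zero (h : IsDeletable π Λ r s)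
    (hΛ : Λ.transpose = -Λ) {t : σ} (hφ : IsLogCanonicalFrom π Λ r ρ (r t + 1) φ)
    (ht : φ (X t) = 0 ∨ defectDer π Λ r t = 0) : IsLogCanonicalFrom π Λ r ρ (r t) φ where
  map_bracket i j hi hj := hφ.map_bracket i j (by omega) (by omega)
  logCanonical u i hu := by
    rcases hu.eq_or_lt with hu | hu
    · rw [← h.rank_injective hu]
      rcases ht with ht | ht
      · rw [ht, map_zero, LinearMap.zero_apply, mul_zero, zero_mul]
      · rw [h.bracket_map_X hΛ hφ, ht, Derivation.zero_apply, map_zero, add_zero, weightDer_X,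
          map_smul, Algebra.smul_def, mul_right_comm]
    · exact hφ.logCanonical u i hu

theorem isLogCanonicalFrom_expHom (h : IsDeletable π Λ r s) (hΛ : Λ.transpose = -Λ) {t : σ}
    (hφ : IsLogCanonicalFrom π Λ r ρ (r t + 1) φ) {y : F}
    (hy : algebraMap k F (s t) * y * φ (X t) = -1) :
    IsLogCanonicalFrom π Λ r ρ (r t) (expHom φ (h.isLocallyNilpotent t) y) := by
  have hcomm {u : σ} {c : k} (hu : ⁅weightDer Λ u, defectDer π Λ r t⁆ = c • defectDer π Λ r t)
      (f : MvPolynomial σ k) : weightDer Λ u (defectDer π Λ r t f) =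
        defectDer π Λ r t (weightDer Λ u f) + c • defectDer π Λ r t f := by
    rw [← sub_eq_iff_eq_add', ← Derivation.commutator_apply, hu, Derivation.smul_apply]
  refine ⟨fun i j hi hj => ?_, fun u i hu => ?_⟩
  · exact expHom_bracket (α := weightDer Λ t) _ (h.bracket_map_X hΛ hφ)
      (hcomm (h.lie_weightDer_self t)) hy (weightDer_X Λ t i) (weightDer_X Λ t j)
      (h.weightDer_bracket hi hj) (hφ.map_bracket i j (by omega) (by omega))
  rw [expHom_eq_of_derivation_eq_zero _ (defectDer_X_of_le π Λ hu)]
  rcases hu.eq_or_lt with hu | hu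
  · rw [← h.rank_injective hu]
    exact bracket_expHom (α := weightDer Λ t) _ (h.bracket_map_X hΛ hφ)
      (hcomm (h.lie_weightDer_self t)) hy (weightDer_X Λ t i)
  · refine bracket_expHom_of_eigenvector (γ := weightDer Λ u) _ (fun f => ?_)
      (hcomm (h.lie_weightDer_of_lt t u hu)) ?_ (weightDer_X Λ u i)
    · simpa using bracket_map_eq ρ φ (φ (X u)) (weightDer Λ u) 0 (fun j => by
        rw [hφ.logCanonical u j hu, weightDer_X, map_smul, Algebra.smul_def,
          Derivation.zero_apply, map_zero, add_zero, mul_right_comm]) f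
    · have hyu := bracket_pow_of_mul_eq_neg_one (ρ := ρ) hy (φ (X u)) 1
      rw [pow_one, Nat.cast_one, hφ.logCanonical u t hu] at hyu
      rw [hyu, Algebra.smul_def]
      linear_combination algebraMap k F (Λ u t) * y * φ (X u) * hy

theorem exists_isLogCanonicalFrom (h : IsDeletable π Λ r s) (hΛ : Λ.transpose = -Λ) {N : ℕ}
    (hφ : IsLogCanonicalFrom π Λ r ρ (N + 1) φ) :
    ∃ ψ : MvPolynomial σ k →ₐ[k] F, IsLogCanonicalFrom π Λ r ρ N ψ ∧
      IntermediateField.adjoin k (Set.range φ) ≤ IntermediateField.adjoin k (Set.range ψ) := by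
  by_cases hN : ∃ t, r t = N
  swap
  · exact ⟨φ, ⟨fun i j hi hj => hφ.map_bracket i j (by omega) (by omega), fun u i hu =>
      hφ.logCanonical u i (Nat.lt_of_le_of_ne hu fun hu => hN ⟨u, hu.symm⟩)⟩, le_rfl⟩
  obtain ⟨t, rfl⟩ := hN
  by_cases ht : φ (X t) = 0 ∨ defectDer π Λ r t = 0
  · exact ⟨φ, h.isLogCanonicalFrom_of_defectDer_eq_zero hΛ hφ ht, le_rfl⟩
  rw [not_or] at ht
  have hs : algebraMap k F (s t) * φ (X t) ≠ 0 := mul_ne_zero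
    (fun hs => ((h.ne_zero_or t).resolve_right ht.2) (by simpa using hs)) ht.1
  set y := -(algebraMap k F (s t) * φ (X t))⁻¹ with hy
  have hyx : algebraMap k F (s t) * y * φ (X t) = -1 := by
    rw [mul_right_comm, hy, mul_neg, mul_inv_cancel₀ hs]
  refine ⟨expHom φ (h.isLocallyNilpotent t) y, h.isLogCanonicalFrom_expHom hΛ hφ hyx,
    IntermediateField.adjoin_le_iff.mpr ?_⟩
  set E := IntermediateField.adjoin k (Set.range (expHom φ (h.isLocallyNilpotent t) y))
  have hE (f : MvPolynomial σ k) : expHom φ (h.isLocallyNilpotent t) y f ∈ E :=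
    IntermediateField.subset_adjoin _ _ ⟨f, rfl⟩
  have hxE : φ (X t) ∈ E := by
    simpa only [expHom_eq_of_derivation_eq_zero _ (defectDer_X_of_le π Λ le_rfl)] using hE (X t)
  have hyE : y ∈ E := neg_mem (inv_mem (mul_mem (E.algebraMap_mem _) hxE))
  rintro _ ⟨f, rfl⟩
  exact mem_of_expHom_mem (E := E.toSubalgebra) _ hyE hE f

end

theorem hasLogCanonicalImages {k : Type u} [Field k] [CharZero k] [Finite σ]
    {π : PoissonBracket k (MvPolynomial σ k)} {Λ : Matrix σ σ k} {s : σ → k}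
    (h : IsDeletable π Λ r s) (hΛ : Λ.transpose = -Λ) : HasLogCanonicalImages π Λ := by
  intro F _ _ ρ φ hφ
  have hdelete (N : ℕ) (φ : MvPolynomial σ k →ₐ[k] F) (hφ : IsLogCanonicalFrom π Λ r ρ N φ) :
      ∃ ψ : MvPolynomial σ k →ₐ[k] F, IsLogCanonicalFrom π Λ r ρ 0 ψ ∧
        IntermediateField.adjoin k (Set.range φ) ≤ IntermediateField.adjoin k (Set.range ψ) := by
    induction N generalizing φ with
    | zero => exact ⟨φ, hφ, le_rfl⟩
    | succ N ih =>
      obtain ⟨ψ, hψ, hle⟩ := h.exists_isLogCanonicalFrom hΛ hφ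
      obtain ⟨χ, hχ, hle'⟩ := ih ψ hψ
      exact ⟨χ, hχ, hle.trans hle'⟩
  obtain ⟨N, hN⟩ := (Set.finite_range r).bddAbove
  obtain ⟨ψ, hψ, hle⟩ := hdelete (N + 1) φ
    ⟨fun i j _ _ => hφ _ _, fun u i hu => absurd (hN ⟨u, rfl⟩) (Nat.not_le.mpr hu)⟩
  refine ⟨fun i => ψ (X i), fun i j => hψ.logCanonical i j (Nat.zero_le _), fun i => ?_⟩
  have hψE : IntermediateField.adjoin k (Set.range ψ) ≤
      IntermediateField.adjoin k (Set.range fun i => ψ (X i)) := by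
    rw [IntermediateField.adjoin_le_iff]
    rintro _ ⟨f, rfl⟩
    refine IntermediateField.algebra_adjoin_le_adjoin k _ ?_
    rw [show (fun i => ψ (X i)) = ψ ∘ X from rfl, Algebra.adjoin_range_eq_range_aeval,
      ← aeval_unique ψ]
    exact ⟨f, rfl⟩
  exact hψE (hle (IntermediateField.subset_adjoin _ _ ⟨X i, rfl⟩))

end IsDeletable

section Criterion

variable {π : PoissonBracket k (MvPolynomial σ k)} {Λ : Matrix σ σ k} {r : σ → ℕ} {s : σ → k}

theorem lie_weightDer_defectDer {t u : σ} {c : k}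
    (h : ∀ i, r i < r t → defect π Λ t i ∈
      Submodule.span k {f | ∃ a b, f = X a * X b ∧ Λ u a + Λ u b = Λ u i + c}) :
    ⁅weightDer Λ u, defectDer π Λ r t⁆ = c • defectDer π Λ r t := by
  refine derivation_ext fun i => ?_
  rw [Derivation.commutator_apply, weightDer_X, Derivation.map_smul, Derivation.smul_apply]
  rcases lt_or_ge (r i) (r t) with hi | hi
  · have heigen : Submodule.span k {f | ∃ a b, f = X a * X b ∧ Λ u a + Λ u b = Λ u i + c} ≤
        Module.End.eigenspace (weightDer Λ u : Module.End k (MvPolynomial σ k)) (Λ u i + c) := by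
      rw [Submodule.span_le]
      rintro _ ⟨a, b, rfl, hab⟩
      exact Module.End.mem_eigenspace_iff.mpr (hab ▸ weightDer_X_mul_X Λ u a b)
    have hdefect : weightDer Λ u (defect π Λ t i) = (Λ u i + c) • defect π Λ t i :=
      Module.End.mem_eigenspace_iff.mp (heigen (h i hi))
    rw [defectDer_X_of_lt π Λ hi, hdefect, add_smul, add_sub_cancel_left]
  · rw [defectDer_X_of_le π Λ hi, map_zero, smul_zero, smul_zero, sub_zero]

theorem isLocallyNilpotent_defectDer [CharZero k] (depth : σ → ℕ) {t : σ}
    (h : ∀ i, r i < r t → defect π Λ t i ∈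
      Submodule.span k {f | ∃ a b, f = X a * X b ∧ depth a < depth i ∧ depth b < depth i}) :
    IsLocallyNilpotent (defectDer π Λ r t) := by
  refine isLocallyNilpotent_of_adjoin_eq_top adjoin_range_X ?_
  rintro _ ⟨i, rfl⟩
  induction hd : depth i using Nat.strong_induction_on generalizing i with
  | _ d ih =>
    subst hd
    refine mem_nilpotentSubalgebra_of_apply_mem ?_
    rcases lt_or_ge (r i) (r t) with hi | hi
    · rw [defectDer_X_of_lt π Λ hi]
      refine (Submodule.span_le
        (p := (nilpotentSubalgebra (defectDer π Λ r t)).toSubmodule)).mpr ?_ (h i hi)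
      rintro _ ⟨a, b, rfl, ha, hb⟩
      exact (nilpotentSubalgebra _).mul_mem (ih _ ha a rfl) (ih _ hb b rfl)
    · rw [defectDer_X_of_le π Λ hi]
      exact zero_mem _

theorem isDeletable_of_defect_mem_span [CharZero k] (hr : Function.Injective r)
    (hs : ∀ t, s t ≠ 0 ∨ ∀ i, r i < r t → defect π Λ t i = 0) (depth : σ → ℕ)
    (h : ∀ t i, r i < r t → defect π Λ t i ∈ Submodule.span k {f | ∃ a b, f = X a * X b ∧
      (depth a < depth i ∧ depth b < depth i) ∧ Λ t a + Λ t b = Λ t i + s t ∧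
        ∀ u, r t < r u → Λ u a + Λ u b = Λ u i + Λ u t}) :
    IsDeletable π Λ r s where
  rank_injective := hr
  isLocallyNilpotent t := isLocallyNilpotent_defectDer depth fun i hi =>
    Submodule.span_mono (by rintro _ ⟨a, b, hf, hd, -⟩; exact ⟨a, b, hf, hd⟩) (h t i hi)
  ne_zero_or t := (hs t).imp_right fun ht => derivation_ext fun i => by
    rcases lt_or_ge (r i) (r t) with hi | hi
    · rw [defectDer_X_of_lt π Λ hi, ht i hi, Derivation.zero_apply]
    · rw [defectDer_X_of_le π Λ hi, Derivation.zero_apply]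
  lie_weightDer_self t := lie_weightDer_defectDer fun i hi =>
    Submodule.span_mono (by rintro _ ⟨a, b, hf, -, hw, -⟩; exact ⟨a, b, hf, hw⟩) (h t i hi)
  lie_weightDer_of_lt t u hu := lie_weightDer_defectDer fun i hi =>
    Submodule.span_mono (by rintro _ ⟨a, b, hf, -, -, hw⟩; exact ⟨a, b, hf, hw u hu⟩) (h t i hi)

end Criterion

end IteratedDeletion

section AffineSpaces

theorem quadratic_hasLogCanonicalImages {k : Type u} [Field k] [CharZero k] {σ : Type*}
    (Λ : Matrix σ σ k) (hΛ : Λ.transpose = -Λ) : HasLogCanonicalImages (quadratic k Λ hΛ) Λ := by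
  intro F _ _ ρ φ hφ
  refine ⟨fun s => φ (X s), fun s t => ?_, fun s => IntermediateField.subset_adjoin _ _ ⟨s, rfl⟩⟩
  rw [← hφ, quadratic_X, map_mul, map_mul, ← MvPolynomial.algebraMap_eq, φ.commutes]
  rfl

end AffineSpaces

section Matrices

variable {n : ℕ}

/-- The rank of a pair of indices in the lexicographic order. -/
def lexRank (a : Fin n × Fin n) : ℕ := finProdFinEquiv a

theorem lexRank_injective : Function.Injective (lexRank (n := n)) :=
  Fin.val_injective.comp finProdFinEquiv.injective

theorem lexRank_lt_of_lexLT {a b : Fin n × Fin n} (h : LexLT a b) : lexRank a < lexRank b := by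
  simp only [lexRank, finProdFinEquiv_apply_val]
  rcases h with h | ⟨h₁, h₂⟩
  · calc a.2 + n * a.1 < n * (a.1 + 1) := by rw [mul_add_one]; omega
      _ ≤ n * b.1 := Nat.mul_le_mul_left n h
      _ ≤ b.2 + n * b.1 := Nat.le_add_left _ _
  · rw [h₁]
    exact Nat.add_lt_add_right h₂ _

theorem lexRank_lt_iff {a b : Fin n × Fin n} : lexRank a < lexRank b ↔ LexLT a b := by
  refine ⟨fun h => ?_, lexRank_lt_of_lexLT⟩
  by_contra hab
  obtain hba | rfl : LexLT b a ∨ a = b := by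
    simp only [LexLT, Prod.ext_iff] at hab ⊢
    omega
  · exact h.not_gt (lexRank_lt_of_lexLT hba)
  · exact h.false

variable {k : Type*} [Field k]

theorem matricesField_of_lexLT (lam : k) (p : Matrix (Fin n) (Fin n) k) {u a : Fin n × Fin n}
    (h : LexLT a u) :
    matricesField lam p u a = p u.1 a.1 + p a.2 u.2 + if u.2 ≤ a.2 then lam else 0 := by
  simp only [matricesField, Matrix.of_apply, skewExtend, if_pos h]
  have h₁ : a.1 ≤ u.1 := by unfold LexLT at h; omega
  by_cases h₂ : a.2 < u.2
  · rw [if_pos ⟨h₁, h₂⟩, if_neg h₂.not_ge, add_zero]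
  · rw [if_neg fun h => h₂ h.2, if_pos (not_lt.mp h₂)]
    ring

variable [CharZero k]

theorem matrices_defect (lam : k) {p : Matrix (Fin n) (Fin n) k} (hp : p.transpose = -p)
    {t a : Fin n × Fin n} (h : LexLT a t) :
    defect (matrices lam p hp) (matricesField lam p) t a =
      if a.1 < t.1 ∧ a.2 < t.2 then lam • (X (a.1, t.2) * X (t.1, a.2)) else 0 := by
  have hgen : (matrices lam p hp).bracket (X t) (X a) = matricesGen lam p t a := poly_X ..
  rw [defect, hgen, matricesField_of_lexLT lam p h]
  obtain ⟨l, m⟩ := t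
  obtain ⟨i, j⟩ := a
  simp only [matricesGen, skewExtend, if_pos h, MvPolynomial.smul_eq_C_mul]
  rcases h with hil | ⟨rfl, hjm⟩
  · rcases lt_or_ge j m with hjm | hjm
    · simp only [hil, hjm, and_self, if_true, hjm.not_ge, if_false, add_zero]
      ring
    · simp only [hil, hjm, hjm.not_gt, and_false, if_true, if_false, C_add]
      ring
  · simp only [lt_irrefl, false_and, if_false, hjm.not_ge, diag_zero hp, add_zero, zero_add]
    ring

theorem matrices_isDeletable (lam : k) {p : Matrix (Fin n) (Fin n) k} (hp : p.transpose = -p) :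
    IsDeletable (matrices lam p hp) (matricesField lam p) lexRank fun _ => lam := by
  refine isDeletable_of_defect_mem_span lexRank_injective (fun _ => ?_)
    (fun a => 2 * n - (a.1 + a.2)) fun t a ha => ?_
  · refine or_iff_not_imp_left.mpr fun hlam a ha => ?_
    rw [matrices_defect lam hp (lexRank_lt_iff.mp ha), not_not.mp hlam, zero_smul, ite_self]
  rw [lexRank_lt_iff] at ha
  rw [matrices_defect lam hp ha]
  split_ifs with h
  swap
  · exact zero_mem _
  obtain ⟨l, m⟩ := t
  obtain ⟨i, j⟩ := a
  obtain ⟨hil : i < l, hjm : j < m⟩ := h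
  have him : LexLT (i, m) (l, m) := .inl hil
  have hlj : LexLT (l, j) (l, m) := .inr ⟨rfl, hjm⟩
  refine Submodule.smul_mem _ _ (Submodule.subset_span
    ⟨(i, m), (l, j), rfl, ⟨?_, ?_⟩, ?_, fun u hu => ?_⟩)
  · dsimp only
    omega
  · dsimp only
    omega
  · rw [matricesField_of_lexLT lam p him, matricesField_of_lexLT lam p hlj,
      matricesField_of_lexLT lam p ha]
    simp only [diag_zero hp, le_refl, if_true, if_neg hjm.not_ge]
    ring
  · have htrans {a : Fin n × Fin n} (h : LexLT a (l, m)) : LexLT a u :=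
      lexRank_lt_iff.mp ((lexRank_lt_of_lexLT h).trans hu)
    rw [matricesField_of_lexLT lam p (htrans him), matricesField_of_lexLT lam p (htrans hlj),
      matricesField_of_lexLT lam p (htrans ha),
      matricesField_of_lexLT lam p (lexRank_lt_iff.mp hu)]
    ring

end Matrices

section Euclidean

variable {k : Type*} [Field k] {n : ℕ}

/-- The rank of the indeterminates of even-dimensional euclidean spaces: `y_1, …, y_n` come first,
followed by `x_1, …, x_n`. -/
def evenRank : Fin n ⊕ Fin n → ℕ := Sum.elim (fun i => n + i) fun i => i

theorem evenRank_injective : Function.Injective (evenRank (n := n)) :=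
  Function.Injective.sumElim (fun i j h => Fin.ext (Nat.add_left_cancel h)) Fin.val_injective
    fun i j => by omega

/-- The eigenvalues attached to the indeterminates of even-dimensional euclidean spaces. -/
def evenEigenvalue (p q : Fin n → k) : Fin n ⊕ Fin n → k := Sum.elim (fun i => p i - q i) 0

/-- The depth of the indeterminates of even-dimensional euclidean spaces: the defects vanish at the
`x_i`, and the ones at `y_i` involve `y_l` for `l < i` only. -/
def evenDepth : Fin n ⊕ Fin n → ℕ := Sum.elim 0 fun i => i + 1

theorem evenField_inl_add_inr (Γ : Matrix (Fin n) (Fin n) k) (p q : Fin n → k) {i l : Fin n}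
    (h : l < i) :
    evenField Γ p q (.inl i) (.inl l) + evenField Γ p q (.inl i) (.inr l) = p i := by
  simp only [evenField, Matrix.of_apply, skewExtend, h, h.not_gt, if_true, if_false]
  ring

theorem evenRank_inl_lt {i : Fin n} {u : Fin n ⊕ Fin n} (h : evenRank (.inl i) < evenRank u) :
    ∃ j, i < j ∧ u = .inl j := by
  rcases u with j | j <;> simp only [evenRank, Sum.elim_inl, Sum.elim_inr] at h
  · exact ⟨j, by omega, rfl⟩
  · omega

theorem exists_eq_inl_of_evenRank_swap_lt {t : Fin n ⊕ Fin n}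
    (h : evenRank t.swap < evenRank t) : ∃ i, t = .inl i := by
  rcases t with i | i
  · exact ⟨i, rfl⟩
  · simp only [evenRank, Sum.swap_inr, Sum.elim_inl, Sum.elim_inr] at h
    omega

/-- The rank of the indeterminates of odd-dimensional euclidean spaces: `z_0` comes first, followed
by the indeterminates of even-dimensional euclidean spaces. -/
def oddRank (t : Option (Fin n ⊕ Fin n)) : ℕ := t.elim 0 fun a => evenRank a + 1

theorem oddRank_injective : Function.Injective (oddRank (n := n)) := by
  rintro (_ | a) (_ | b) h
  · rfl
  · exact absurd h (Nat.succ_ne_zero _).symm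
  · exact absurd h (Nat.succ_ne_zero _)
  · exact congrArg some (evenRank_injective (Nat.succ_injective h))

theorem exists_eq_some_inl_of_oddRank_swap_lt {t : Option (Fin n ⊕ Fin n)}
    (h : oddRank (t.map Sum.swap) < oddRank t) : ∃ i, t = some (.inl i) := by
  rcases t with _ | t
  · exact absurd h (Nat.not_lt_zero _)
  · obtain ⟨i, rfl⟩ := exists_eq_inl_of_evenRank_swap_lt (Nat.lt_of_succ_lt_succ h)
    exact ⟨i, rfl⟩

theorem oddRank_some_inl_lt {i : Fin n} {u : Option (Fin n ⊕ Fin n)}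
    (h : oddRank (some (.inl i)) < oddRank u) : ∃ j, i < j ∧ u = some (.inl j) := by
  rcases u with _ | u
  · exact absurd h (Nat.not_lt_zero _)
  · obtain ⟨j, hij, rfl⟩ := evenRank_inl_lt (Nat.lt_of_succ_lt_succ h)
    exact ⟨j, hij, rfl⟩

theorem oddField_some (Γ : Matrix (Fin n) (Fin n) k) (p q : Fin n → k) (a b : Fin n ⊕ Fin n) :
    oddField Γ p q (some a) (some b) = evenField Γ p q a b := by
  rcases a with i | i <;> rcases b with j | j <;> rfl

variable [CharZero k]

theorem evenField_inl_inr_self {Γ : Matrix (Fin n) (Fin n) k} (hΓ : Γ.transpose = -Γ)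
    (p q : Fin n → k) (i : Fin n) : evenField Γ p q (.inl i) (.inr i) = q i := by
  simp [evenField, diag_zero hΓ]

theorem even_defect_eq_zero {Γ : Matrix (Fin n) (Fin n) k} (hΓ : Γ.transpose = -Γ)
    (p q : Fin n → k) {t a : Fin n ⊕ Fin n} (h : evenRank a < evenRank t) (ht : a ≠ t.swap) :
    defect (evenEuclidean Γ hΓ p q) (evenField Γ p q) t a = 0 := by
  have hgen : (evenEuclidean Γ hΓ p q).bracket (X t) (X a) = evenGen Γ p q t a := poly_X ..
  rw [defect, hgen, sub_eq_zero]
  rcases t with i | i <;> rcases a with j | j <;>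
    simp only [evenRank, Sum.elim_inl, Sum.elim_inr] at h
  · have hji : j < i := by omega
    simp only [evenGen, evenField, Matrix.of_apply, skewExtend, hji, hji.not_gt, if_true, if_false,
      C_neg]
    ring
  · rcases lt_or_gt_of_ne fun hij : i = j => ht (by rw [hij, Sum.swap_inl]) with hij | hij
    · simp only [evenGen, evenField, Matrix.of_apply, hij, if_true]
    · simp only [evenGen, evenField, Matrix.of_apply, hij, hij.not_gt, if_true, if_false]
  · omega
  · rfl

theorem even_defect {Γ : Matrix (Fin n) (Fin n) k} (hΓ : Γ.transpose = -Γ)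
    (p q : Fin n → k) (i : Fin n) :
    defect (evenEuclidean Γ hΓ p q) (evenField Γ p q) (.inl i) (.inr i) =
      ∑ l with l < i, (q l - p l) • (X (.inl l) * X (.inr l)) := by
  have hgen : (evenEuclidean Γ hΓ p q).bracket (X (.inl i)) (X (.inr i)) =
    evenGen Γ p q (.inl i) (.inr i) := poly_X ..
  rw [defect, hgen, evenField_inl_inr_self hΓ]
  simp only [evenGen, lt_irrefl, if_false, MvPolynomial.smul_eq_C_mul, mul_assoc,
    add_sub_cancel_left]

theorem isDeletable_of_defect_eq_zero {σ : Type*} {π : PoissonBracket k (MvPolynomial σ k)}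
    {Λ : Matrix σ σ k} {r : σ → ℕ} {s : σ → k} (hr : Function.Injective r) (τ : σ → σ)
    (hτ : ∀ t i, r i < r t → i ≠ τ t → defect π Λ t i = 0)
    (hs : ∀ t, r (τ t) < r t → s t ≠ 0) (depth : σ → ℕ)
    (h : ∀ t, r (τ t) < r t → defect π Λ t (τ t) ∈ Submodule.span k {f | ∃ a b, f = X a * X b ∧
      (depth a < depth (τ t) ∧ depth b < depth (τ t)) ∧ Λ t a + Λ t b = Λ t (τ t) + s t ∧
        ∀ u, r t < r u → Λ u a + Λ u b = Λ u (τ t) + Λ u t}) :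
    IsDeletable π Λ r s := by
  refine isDeletable_of_defect_mem_span hr (fun t => ?_) depth fun t i hi => ?_
  · refine or_iff_not_imp_left.mpr fun hst i hi => hτ t i hi ?_
    rintro rfl
    exact hst (hs t hi)
  by_cases hit : i = τ t
  · subst hit
    exact h t hi
  · rw [hτ t i hi hit]
    exact zero_mem _

theorem even_isDeletable {Γ : Matrix (Fin n) (Fin n) k} (hΓ : Γ.transpose = -Γ)
    (p q : Fin n → k) (hpq : ∀ i, p i ≠ q i) :
    IsDeletable (evenEuclidean Γ hΓ p q) (evenField Γ p q) evenRank (evenEigenvalue p q) := by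
  refine isDeletable_of_defect_eq_zero evenRank_injective Sum.swap
    (fun t a => even_defect_eq_zero hΓ p q) (fun t ht => ?_) evenDepth fun t ht => ?_
  · obtain ⟨i, rfl⟩ := exists_eq_inl_of_evenRank_swap_lt ht
    exact sub_ne_zero.mpr (hpq i)
  obtain ⟨i, rfl⟩ := exists_eq_inl_of_evenRank_swap_lt ht
  rw [Sum.swap_inl, even_defect hΓ]
  refine sum_mem fun l hl => Submodule.smul_mem _ _ (Submodule.subset_span ?_)
  have hli : l < i := (Finset.mem_filter.mp hl).2
  refine ⟨.inl l, .inr l, rfl, ⟨Nat.succ_pos _, Nat.succ_lt_succ hli⟩, ?_, fun u hu => ?_⟩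
  · rw [evenField_inl_add_inr Γ p q hli, evenField_inl_inr_self hΓ, evenEigenvalue, Sum.elim_inl,
      add_sub_cancel]
  · obtain ⟨j, hij, rfl⟩ := evenRank_inl_lt hu
    rw [evenField_inl_add_inr Γ p q (hli.trans hij), add_comm, evenField_inl_add_inr Γ p q hij]

theorem odd_defect_none {Γ : Matrix (Fin n) (Fin n) k} (hΓ : Γ.transpose = -Γ)
    (p q : Fin n → k) (lam : k) (t : Fin n ⊕ Fin n) :
    defect (oddEuclidean Γ hΓ p q lam) (oddField Γ p q) (some t) none = 0 := by
  have hgen : (oddEuclidean Γ hΓ p q lam).bracket (X (some t)) (X none) =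
    oddGen Γ p q lam (some t) none := poly_X ..
  rw [defect, hgen]
  rcases t with i | i <;> simp only [oddGen, oddField, Matrix.of_apply, C_neg] <;> ring

theorem odd_defect_some {Γ : Matrix (Fin n) (Fin n) k} (hΓ : Γ.transpose = -Γ)
    (p q : Fin n → k) (lam : k) {t a : Fin n ⊕ Fin n} (h : evenRank a < evenRank t) :
    defect (oddEuclidean Γ hΓ p q lam) (oddField Γ p q) (some t) (some a) =
      rename some (defect (evenEuclidean Γ hΓ p q) (evenField Γ p q) t a) +
        if a = t.swap then lam • (X none * X none) else 0 := by
  have hodd : (oddEuclidean Γ hΓ p q lam).bracket (X (some t)) (X (some a)) =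
    oddGen Γ p q lam (some t) (some a) := poly_X ..
  have heven : (evenEuclidean Γ hΓ p q).bracket (X t) (X a) = evenGen Γ p q t a := poly_X ..
  rw [defect, defect, hodd, heven, oddField_some]
  rcases t with i | i <;> rcases a with j | j
  · simp only [oddGen, evenGen, skewExtend]
    split_ifs <;> simp_all
  · rcases lt_trichotomy i j with hij | rfl | hij
    · simp [oddGen, evenGen, hij, hij.ne']
    · simp only [oddGen, evenGen, lt_irrefl, if_false, Sum.swap_inl, if_true,
        MvPolynomial.smul_eq_C_mul, map_sub, map_add, map_sum, map_mul, rename_X, rename_C]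
      ring
    · simp [oddGen, evenGen, hij, hij.ne, hij.not_gt]
  · simp only [evenRank, Sum.elim_inl, Sum.elim_inr] at h
    omega
  · simp [oddGen, evenGen]

theorem odd_defect_eq_zero {Γ : Matrix (Fin n) (Fin n) k} (hΓ : Γ.transpose = -Γ)
    (p q : Fin n → k) (lam : k) {t a : Option (Fin n ⊕ Fin n)} (h : oddRank a < oddRank t)
    (hat : a ≠ t.map Sum.swap) :
    defect (oddEuclidean Γ hΓ p q lam) (oddField Γ p q) t a = 0 := by
  rcases t with _ | t
  · exact absurd h (Nat.not_lt_zero _)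
  rcases a with _ | a
  · exact odd_defect_none hΓ p q lam t
  have h' : evenRank a < evenRank t := Nat.lt_of_succ_lt_succ h
  have hat' : a ≠ t.swap := fun hat' => hat (congrArg some hat')
  rw [odd_defect_some hΓ p q lam h', even_defect_eq_zero hΓ p q h' hat', map_zero, if_neg hat',
    add_zero]

theorem odd_defect {Γ : Matrix (Fin n) (Fin n) k} (hΓ : Γ.transpose = -Γ)
    (p q : Fin n → k) (lam : k) (i : Fin n) :
    defect (oddEuclidean Γ hΓ p q lam) (oddField Γ p q) (some (.inl i)) (some (.inr i)) =
      (∑ l with l < i, (q l - p l) • (X (some (.inl l)) * X (some (.inr l)))) +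
        lam • (X none * X none) := by
  have hrank : evenRank (.inr i) < evenRank (.inl i) := i.isLt.trans_le (Nat.le_add_right _ _)
  rw [odd_defect_some hΓ p q lam hrank, even_defect hΓ, if_pos Sum.swap_inl.symm]
  simp only [map_sum, map_smul, map_mul, rename_X]

theorem odd_isDeletable {Γ : Matrix (Fin n) (Fin n) k} (hΓ : Γ.transpose = -Γ)
    (p q : Fin n → k) (lam : k) (hpq : ∀ i, p i ≠ q i) :
    IsDeletable (oddEuclidean Γ hΓ p q lam) (oddField Γ p q) oddRank
      fun t => t.elim 0 (evenEigenvalue p q) := by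
  refine isDeletable_of_defect_eq_zero oddRank_injective (Option.map Sum.swap)
    (fun t a => odd_defect_eq_zero hΓ p q lam) (fun t ht => ?_) (fun t => t.elim 0 evenDepth)
    fun t ht => ?_
  · obtain ⟨i, rfl⟩ := exists_eq_some_inl_of_oddRank_swap_lt ht
    exact sub_ne_zero.mpr (hpq i)
  obtain ⟨i, rfl⟩ := exists_eq_some_inl_of_oddRank_swap_lt ht
  rw [Option.map_some, Sum.swap_inl, odd_defect hΓ]
  refine add_mem (sum_mem fun l hl => Submodule.smul_mem _ _ (Submodule.subset_span ?_))
    (Submodule.smul_mem _ _ (Submodule.subset_span ?_))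
  · have hli : l < i := (Finset.mem_filter.mp hl).2
    refine ⟨some (.inl l), some (.inr l), rfl, ⟨Nat.succ_pos _, Nat.succ_lt_succ hli⟩, ?_,
      fun u hu => ?_⟩
    · simp only [oddField_some, Option.elim_some, evenEigenvalue, Sum.elim_inl]
      rw [evenField_inl_add_inr Γ p q hli, evenField_inl_inr_self hΓ, add_sub_cancel]
    · obtain ⟨j, hij, rfl⟩ := oddRank_some_inl_lt hu
      simp only [oddField_some]
      rw [evenField_inl_add_inr Γ p q (hli.trans hij), add_comm, evenField_inl_add_inr Γ p q hij]
  · refine ⟨none, none, rfl, ⟨Nat.succ_pos _, Nat.succ_pos _⟩, ?_, fun u hu => ?_⟩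
    · rw [oddField_some, evenField_inl_inr_self hΓ, Option.elim_some, evenEigenvalue,
        Sum.elim_inl, add_sub_cancel]
      exact add_halves (p i)
    · obtain ⟨j, hij, rfl⟩ := oddRank_some_inl_lt hu
      rw [oddField_some, oddField_some, add_comm (evenField Γ p q _ _),
        evenField_inl_add_inr Γ p q hij]
      exact add_halves (p j)

end Euclidean

section PairIndexed

variable {k : Type*} [Field k] {n : ℕ}

/-- The multiplicity of the index `x` in the pair `u`. -/
def pairMult (k : Type*) [Field k] (u : Fin n × Fin n) (x : Fin n) : k :=
  (if x = u.1 then 1 else 0) + if x = u.2 then 1 else 0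

/-- The eigenvalue attached to the indeterminate `y_{lm}` of (anti)symmetric matrices. -/
def pairEigenvalue (k : Type*) [Field k] (t : Fin n × Fin n) : k :=
  -(pairMult k t t.1 + pairMult k t t.2)

theorem pairEigenvalue_ne_zero [CharZero k] (t : Fin n × Fin n) : pairEigenvalue k t ≠ 0 := by
  simp only [pairEigenvalue, pairMult, neg_ne_zero]
  split_ifs <;> first | omega | norm_num

theorem mul_mem_span_of_pairs {P : Fin n × Fin n → Prop} {Λ : Matrix {a // P a} {a // P a} k}
    (hΛ : ∀ u a, LexLT a.1 u.1 → Λ u a = -(pairMult k u.1 a.1.1 + pairMult k u.1 a.1.2))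
    {Y : Fin n → Fin n → MvPolynomial {a // P a} k}
    (hY : ∀ i j, Y i j ∈ Submodule.span k (X '' {a | a.1 = (i, j) ∨ a.1 = (j, i)}))
    {t i : {a // P a}} (hi : LexLT i.1 t.1) {x y z w : Fin n}
    (hxy : ∀ a, P a → a = (x, y) ∨ a = (y, x) →
      LexLT a t.1 ∧ (i.1.1 + i.1.2 : ℕ) < a.1 + a.2)
    (hzw : ∀ a, P a → a = (z, w) ∨ a = (w, z) →
      LexLT a t.1 ∧ (i.1.1 + i.1.2 : ℕ) < a.1 + a.2)
    (hsum : ∀ f : Fin n → k,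
      f x + f y + (f z + f w) = f i.1.1 + f i.1.2 + (f t.1.1 + f t.1.2)) :
    Y x y * Y z w ∈ Submodule.span k {f | ∃ a b, f = X a * X b ∧
      (2 * n - (a.1.1 + a.1.2 : ℕ) < 2 * n - (i.1.1 + i.1.2) ∧
        2 * n - (b.1.1 + b.1.2 : ℕ) < 2 * n - (i.1.1 + i.1.2)) ∧
      Λ t a + Λ t b = Λ t i + pairEigenvalue k t.1 ∧
      ∀ u : {a // P a}, lexRank t.1 < lexRank u.1 → Λ u a + Λ u b = Λ u i + Λ u t} := by
  have hmul := Submodule.mul_mem_mul (hY x y) (hY z w)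
  rw [Submodule.span_mul_span] at hmul
  refine Submodule.span_mono ?_ hmul
  rintro _ ⟨_, ⟨a, ha, rfl⟩, _, ⟨b, hb, rfl⟩, rfl⟩
  obtain ⟨hat, had⟩ := hxy a.1 a.2 ha
  obtain ⟨hbt, hbd⟩ := hzw b.1 b.2 hb
  have hab (f : Fin n → k) : f a.1.1 + f a.1.2 + (f b.1.1 + f b.1.2) =
      f i.1.1 + f i.1.2 + (f t.1.1 + f t.1.2) := by
    rw [← hsum f]
    rcases ha with ha | ha <;> rcases hb with hb | hb <;> rw [ha, hb] <;> ring
  refine ⟨a, b, rfl, ⟨by omega, by omega⟩, ?_, fun u hu => ?_⟩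
  · rw [hΛ t a hat, hΛ t b hbt, hΛ t i hi, pairEigenvalue]
    linear_combination -hab (pairMult k t.1)
  · have htrans {a : Fin n × Fin n} (h : LexLT a t.1) : LexLT a u.1 :=
      lexRank_lt_iff.mp ((lexRank_lt_of_lexLT h).trans hu)
    rw [hΛ u a (htrans hat), hΛ u b (htrans hbt), hΛ u i (htrans hi),
      hΛ u t (lexRank_lt_iff.mp hu)]
    linear_combination -hab (pairMult k u.1)

/-- Here `Y i j` stands for the entries of an (anti)symmetric matrix, each of which is a multiple of
an indeterminate. -/
theorem isDeletable_of_pairs [CharZero k] {P : Fin n × Fin n → Prop}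
    {π : PoissonBracket k (MvPolynomial {a // P a} k)} {Λ : Matrix {a // P a} {a // P a} k}
    (hP : ∀ a, P a → a.1 ≤ a.2)
    (hΛ : ∀ u a, LexLT a.1 u.1 → Λ u a = -(pairMult k u.1 a.1.1 + pairMult k u.1 a.1.2))
    {Y : Fin n → Fin n → MvPolynomial {a // P a} k}
    (hY : ∀ i j, Y i j ∈ Submodule.span k (X '' {a | a.1 = (i, j) ∨ a.1 = (j, i)})) (c d : k)
    (hπ : ∀ t a : {a // P a}, LexLT a.1 t.1 → defect π Λ t a =
      if a.1.1 < t.1.1 ∧ a.1.2 < t.1.2 then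
        c • (Y a.1.1 t.1.2 * Y a.1.2 t.1.1) +
          if a.1.2 < t.1.1 then d • (Y a.1.1 t.1.1 * Y a.1.2 t.1.2) else 0
      else 0) :
    IsDeletable π Λ (fun a => lexRank a.1) fun t => pairEigenvalue k t.1 := by
  refine isDeletable_of_defect_mem_span (lexRank_injective.comp Subtype.val_injective)
    (fun t => .inl (pairEigenvalue_ne_zero t.1)) (fun a => 2 * n - (a.1.1 + a.1.2))
    fun t i hi => ?_
  rw [lexRank_lt_iff] at hi
  have hPt := hP t.1 t.2
  rw [hπ t i hi]
  split_ifs with hlt hlt'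
  · refine add_mem
      (Submodule.smul_mem _ _ (mul_mem_span_of_pairs hΛ hY hi ?_ ?_ fun f => by ring))
      (Submodule.smul_mem _ _ (mul_mem_span_of_pairs hΛ hY hi ?_ ?_ fun f => by ring)) <;>
    · rintro a ha (rfl | rfl) <;>
      · have hPa := hP _ ha
        simp only [LexLT, true_and] at hi hPa ⊢
        omega
  · rw [add_zero]
    refine Submodule.smul_mem _ _ (mul_mem_span_of_pairs hΛ hY hi ?_ ?_ fun f => by ring) <;>
    · rintro a ha (rfl | rfl) <;>
      · have hPa := hP _ ha
        simp only [LexLT, true_and] at hi hPa ⊢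
        omega
  · exact zero_mem _

theorem symmetricField_of_lexLT {u a : {a : Fin n × Fin n // a.1 ≤ a.2}} (h : LexLT a.1 u.1) :
    symmetricField k n u a = -(pairMult k u.1 a.1.1 + pairMult k u.1 a.1.2) := by
  obtain ⟨⟨l, m⟩, h1⟩ := u
  obtain ⟨⟨i, j⟩, h2⟩ := a
  simp only [symmetricField, Matrix.of_apply, skewExtend, if_neg (LexLT.asymm _ _ h), if_pos h,
    pairMult]
  simp only [LexLT] at h h1 h2
  congr 1
  split_ifs <;> first | omega | norm_num

theorem antisymmetricField_of_lexLT {u a : {a : Fin n × Fin n // a.1 < a.2}} (h : LexLT a.1 u.1) :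
    antisymmetricField k n u a = -(pairMult k u.1 a.1.1 + pairMult k u.1 a.1.2) := by
  obtain ⟨⟨l, m⟩, h1⟩ := u
  obtain ⟨⟨i, j⟩, h2⟩ := a
  have hcard : (({i, j} : Finset (Fin n)) ∩ {l, m}).card =
      (if i = l ∨ i = m then 1 else 0) + if j = l ∨ j = m then 1 else 0 := by
    rw [← Finset.filter_mem_eq_inter, Finset.card_filter, Finset.sum_pair h2.ne]
    simp only [Finset.mem_insert, Finset.mem_singleton]
  simp only [antisymmetricField, Matrix.of_apply, skewExtend, if_neg (LexLT.asymm _ _ h), if_pos h,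
    pairMult, hcard]
  simp only [LexLT] at h h1 h2
  congr 1
  split_ifs <;> first | omega | norm_num

theorem symY_mem_span (i j : Fin n) :
    symY k i j ∈ Submodule.span k (X '' {a | a.1 = (i, j) ∨ a.1 = (j, i)}) := by
  refine Submodule.subset_span ⟨_, ?_, rfl⟩
  rcases le_total i j with h | h
  · exact .inl (by simp only [min_eq_left h, max_eq_right h])
  · exact .inr (by simp only [min_eq_right h, max_eq_left h])

theorem altY_mem_span (i j : Fin n) :
    altY k i j ∈ Submodule.span k (X '' {a | a.1 = (i, j) ∨ a.1 = (j, i)}) := by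
  rcases lt_trichotomy i j with h | rfl | h
  · rw [altY_of_lt k n ⟨(i, j), h⟩]
    exact Submodule.subset_span ⟨_, .inl rfl, rfl⟩
  · rw [altY_self]
    exact zero_mem _
  · rw [altY_comm, altY_of_lt k n ⟨(j, i), h⟩]
    exact neg_mem (Submodule.subset_span ⟨_, .inr rfl, rfl⟩)

theorem symmetric_defect [CharZero k] {t a : {a : Fin n × Fin n // a.1 ≤ a.2}}
    (h : LexLT a.1 t.1) : defect (symmetric k n) (symmetricField k n) t a =
      if a.1.1 < t.1.1 ∧ a.1.2 < t.1.2 then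
        (-2 : k) • (symY k a.1.1 t.1.2 * symY k a.1.2 t.1.1) +
          if a.1.2 < t.1.1 then (-2 : k) • (symY k a.1.1 t.1.1 * symY k a.1.2 t.1.2) else 0
      else 0 := by
  have hgen : (symmetric k n).bracket (X t) (X a) = symGen k n t a := poly_X ..
  rw [defect, hgen, symmetricField_of_lexLT h, ← symY_of_le k n a, ← symY_of_le k n t]
  obtain ⟨⟨l, m⟩, hlm⟩ := t
  obtain ⟨⟨i, j⟩, hij⟩ := a
  simp only [LexLT] at hlm hij h
  simp only [symGen, pairMult, sg, MvPolynomial.smul_eq_C_mul, apply_ite C, C_neg, C_add, C_0, C_1,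
    map_ofNat]
  grind [symY_comm]

theorem antisymmetric_defect [CharZero k] {t a : {a : Fin n × Fin n // a.1 < a.2}}
    (h : LexLT a.1 t.1) : defect (antisymmetric k n) (antisymmetricField k n) t a =
      if a.1.1 < t.1.1 ∧ a.1.2 < t.1.2 then
        (2 : k) • (altY k a.1.1 t.1.2 * altY k a.1.2 t.1.1) +
          if a.1.2 < t.1.1 then (-2 : k) • (altY k a.1.1 t.1.1 * altY k a.1.2 t.1.2) else 0
      else 0 := by
  have hgen : (antisymmetric k n).bracket (X t) (X a) = altGen k n t a := poly_X ..
  rw [defect, hgen, antisymmetricField_of_lexLT h, ← altY_of_lt k n a, ← altY_of_lt k n t]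
  obtain ⟨⟨l, m⟩, hlm⟩ := t
  obtain ⟨⟨i, j⟩, hij⟩ := a
  simp only [LexLT] at hlm hij h
  simp only [altGen, pairMult, sg, MvPolynomial.smul_eq_C_mul, apply_ite C, C_neg, C_add, C_0, C_1,
    map_ofNat]
  grind [altY_comm, altY_self]

theorem symmetric_isDeletable (k : Type*) [Field k] [CharZero k] (n : ℕ) :
    IsDeletable (symmetric k n) (symmetricField k n) (fun a => lexRank a.1)
      fun t => pairEigenvalue k t.1 :=
  isDeletable_of_pairs (fun _ h => h) (fun _ _ => symmetricField_of_lexLT) symY_mem_span _ _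
    fun _ _ => symmetric_defect

theorem antisymmetric_isDeletable (k : Type*) [Field k] [CharZero k] (n : ℕ) :
    IsDeletable (antisymmetric k n) (antisymmetricField k n) (fun a => lexRank a.1)
      fun t => pairEigenvalue k t.1 :=
  isDeletable_of_pairs (fun _ h => h.le) (fun _ _ => antisymmetricField_of_lexLT) altY_mem_span _ _
    fun _ _ => antisymmetric_defect

end PairIndexed

end PoissonBracket

theorem theorem4p1 {k : Type*} [Field k] [CharZero k] (n : ℕ) :
    -- quantum affine spaces
    (∀ (q : Matrix (Fin n) (Fin n) k) (hq : q.transpose = -q),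
      (PoissonBracket.quadratic k q hq).QuadraticGelfandKirillov q hq) ∧
    -- quantum matrices
    (∀ (lam : k) (p : Matrix (Fin n) (Fin n) k) (hp : p.transpose = -p),
      (PoissonBracket.matrices lam p hp).QuadraticGelfandKirillov
        (PoissonBracket.matricesField lam p) (PoissonBracket.matricesField_skew lam p)) ∧
    -- quantum symplectic and even-dimensional euclidean spaces
    (∀ (Γ : Matrix (Fin n) (Fin n) k) (hΓ : Γ.transpose = -Γ) (p q : Fin n → k),
      (∀ i, p i ≠ q i) →
      (PoissonBracket.evenEuclidean Γ hΓ p q).QuadraticGelfandKirillov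
        (PoissonBracket.evenField Γ p q) (PoissonBracket.evenField_skew hΓ p q)) ∧
    -- odd-dimensional quantum euclidean spaces
    (∀ (Γ : Matrix (Fin n) (Fin n) k) (hΓ : Γ.transpose = -Γ) (p q : Fin n → k) (lam : k),
      (∀ i, p i ≠ q i) →
      (PoissonBracket.oddEuclidean Γ hΓ p q lam).QuadraticGelfandKirillov
        (PoissonBracket.oddField Γ p q) (PoissonBracket.oddField_skew hΓ p q)) ∧
    -- quantum symmetric matrices
    (PoissonBracket.symmetric k n).QuadraticGelfandKirillov
      (PoissonBracket.symmetricField k n) (PoissonBracket.symmetricField_skew k n) ∧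
    -- quantum antisymmetric matrices
    (PoissonBracket.antisymmetric k n).QuadraticGelfandKirillov
      (PoissonBracket.antisymmetricField k n) (PoissonBracket.antisymmetricField_skew k n) := by
  refine ⟨fun q hq => ?_, fun lam p hp => ?_, fun Γ hΓ p q hpq => ?_,
    fun Γ hΓ p q lam hpq => ?_, ?_, ?_⟩
  · exact (PoissonBracket.quadratic_hasLogCanonicalImages q hq).quadraticGelfandKirillov hq
  · exact ((PoissonBracket.matrices_isDeletable lam hp).hasLogCanonicalImages
      (PoissonBracket.matricesField_skew lam p)).quadraticGelfandKirillov _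
  · exact ((PoissonBracket.even_isDeletable hΓ p q hpq).hasLogCanonicalImages
      (PoissonBracket.evenField_skew hΓ p q)).quadraticGelfandKirillov _
  · exact ((PoissonBracket.odd_isDeletable hΓ p q lam hpq).hasLogCanonicalImages
      (PoissonBracket.oddField_skew hΓ p q)).quadraticGelfandKirillov _
  · exact ((PoissonBracket.symmetric_isDeletable k n).hasLogCanonicalImages
      (PoissonBracket.symmetricField_skew k n)).quadraticGelfandKirillov _
  · exact ((PoissonBracket.antisymmetric_isDeletable k n).hasLogCanonicalImages
      (PoissonBracket.antisymmetricField_skew k n)).quadraticGelfandKirillov _
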